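/- **Theorem 3.1 (Clustering Error Rate).** *Model.* There are $n$ workers with abilities $p^*=(p_1^*,\dots,p_n^*)\in[0,1]^n$ and $m$ items with true labels $y^*\in\{0,1\}^m$. The answers $X_{ij}\in\{0,1\}$ ($i\in[n]$, $j\in[m]$) are independent, with $\mathbb P(X_{ij}=y_j^*)=p_i^*$ and $\mathbb P(X_{ij}=1-y_j^*)=1-p_i^*$. Put $\mu_i=\max(p_i^*,1-p_i^*)$, $\bar\mu=\frac1n\sum_{i}\mu_i$, $\bar\nu=\frac1n\sum_{i}(2\mu_i-1)^2$, and $D(a\|b)=a\log\frac ab+(1-a)\log\frac{1-a}{1-b}$. For $p\in[0,1]^n$ and $y\in[0,1]^m$, with the conventions $\log 0=-\infty$ and $0\log 0=0\log\frac10=0$, define the Dawid–Skene objective $$F(p,y)=\sum_{i,j}y_j\bigl(X_{ij}\log p_i+(1-X_{ij})\log(1-p_i)\bigr)+\sum_{i,j}(1-y_j)\bigl(X_{ij}\log(1-p_i)+(1-X_{ij})\log p_i\bigr)+\sum_j\Bigl(y_j\log\tfrac1{y_j}+(1-y_j)\log\tfrac1{1-y_j}\Bigr).$$ *Claim.* There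 are absolute constants $C'>0$ and $N$ such that for all $n,m\ge N$ with $n\le m\le e^n$, all $p^*\in[0,1]^n$ with $\bar\nu\ge\frac{12\log n}{n}$, and all $y^*\in\{0,1\}^m$, the following holds with probability at least $1-C'/m$: every $\hat y$ for which some $(\hat p,\hat y)$ is a global maximizer of $F$ over $[0,1]^n\times[0,1]^m$ satisfies $$\min\Bigl\{\frac1m\sum_{j}|\hat y_j-y_j^*|,\ \frac1m\sum_{j}|\hat y_j-(1-y_j^*)|\Bigr\}\le\exp\Bigl(-\frac18n\bar\nu\Bigr).$$ If in addition $\bar\mu<1$ and $\bar\nu>\frac1n\log\frac4{1-\bar\mu}$, then with probability at least $1-C'/m$ every such $\hat y$ satisfies the same inequality with the right-hand side replaced by $$\exp\Bigl(-\frac18n\max\bigl\{\bar\nu,\tfrac13D(\bar\mu\|1-\bar\mu)\bigr\}\Bigr).$$ -/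

import Mathlib

open MeasureTheory ProbabilityTheory

namespace DawidSkene

noncomputable section

/-- A label in `{0,1}`, read as a real number. -/
def bit (b : Bool) : ℝ := if b then 1 else 0

/-- The logarithm of a nonnegative real number, with `log 0 = -∞`. In `EReal` one has
`0 * (-∞) = 0`, which is the usual convention `0 log 0 = 0` of likelihood theory. -/
def extLog (t : ℝ) : EReal := ENNReal.log (ENNReal.ofReal t)

/-- The one-coin model: the answers `X i j` are independent, and worker `i` reports the true label
of item `j` with probability `pTrue i` (hence the flipped label with probability
`1 - pTrue i`). -/
structure IsOneCoinModel {Ω : Type*} [MeasurableSpace Ω] (P : Measure Ω) {n m : ℕ}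
    (X : Fin n → Fin m → Ω → Bool) (pTrue : Fin n → ℝ) (yTrue : Fin m → Bool) : Prop where
  measurable : ∀ i j, Measurable (X i j)
  indep : iIndepFun (fun ij : Fin n × Fin m => X ij.1 ij.2) P
  prob_correct : ∀ i j, P.real {ω | X i j ω = yTrue j} = pTrue i

/-- The objective `F(p,y)` for the observed answers `x`, with values in `[-∞, ∞)` on the cube
`[0,1]^n × [0,1]^m`. Here `Real.binEntropy t = t log (1/t) + (1-t) log (1/(1-t))`. -/
def objective {n m : ℕ} (x : Fin n → Fin m → Bool) (p : Fin n → ℝ) (y : Fin m → ℝ) : EReal :=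
  (∑ i, ∑ j, (y j : EReal) *
      ((bit (x i j) : EReal) * extLog (p i)
        + ((1 - bit (x i j) : ℝ) : EReal) * extLog (1 - p i)))
  + (∑ i, ∑ j, ((1 - y j : ℝ) : EReal) *
      ((bit (x i j) : EReal) * extLog (1 - p i)
        + ((1 - bit (x i j) : ℝ) : EReal) * extLog (p i)))
  + ((∑ j, Real.binEntropy (y j) : ℝ) : EReal)

/-- `(p, y)` is a global maximizer of the objective over `[0,1]^n × [0,1]^m`. -/
def IsGlobalMaximizer {n m : ℕ} (x : Fin n → Fin m → Bool) (p : Fin n → ℝ) (y : Fin m → ℝ) :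
    Prop :=
  ((∀ i, p i ∈ Set.Icc (0 : ℝ) 1) ∧ ∀ j, y j ∈ Set.Icc (0 : ℝ) 1) ∧
    ∀ (p' : Fin n → ℝ) (y' : Fin m → ℝ), (∀ i, p' i ∈ Set.Icc (0 : ℝ) 1) →
      (∀ j, y' j ∈ Set.Icc (0 : ℝ) 1) → objective x p' y' ≤ objective x p y

/-- Effective ability of a worker of ability `p`. -/
def effAbility (p : ℝ) : ℝ := if 1 / 2 ≤ p then p else 1 - p

/-- The average effective ability `μ̄`. -/
def muBar {n : ℕ} (p : Fin n → ℝ) : ℝ := (1 / (n : ℝ)) * ∑ i, effAbility (p i)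

/-- The collective wisdom `ν̄`, the average of `(2 μ_i - 1)²`. -/
def nuBar {n : ℕ} (p : Fin n → ℝ) : ℝ := (1 / (n : ℝ)) * ∑ i, (2 * effAbility (p i) - 1) ^ 2

/-- The Kullback-Leibler divergence `D(a‖b)` between Bernoulli laws; it is used for
`a, b ∈ (0,1)` only. -/
def klBern (a b : ℝ) : ℝ := a * Real.log (a / b) + (1 - a) * Real.log ((1 - a) / (1 - b))

/-- The clustering error of `y` with respect to the true labels. -/
def clusteringError {m : ℕ} (y : Fin m → ℝ) (yTrue : Fin m → Bool) : ℝ :=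
  min ((1 / (m : ℝ)) * ∑ j, |y j - bit (yTrue j)|)
    ((1 / (m : ℝ)) * ∑ j, |y j - (1 - bit (yTrue j))|)

end

end DawidSkene

/-!
Write `h` for the binary entropy, `Tᵢ` for the set of items on which worker `i` is wrong, and `w` for
the soft labels of a maximizer, measured from the true labels or from their flips, whichever is
closer; `w` has mean `a ≤ 1 / 2`, and `a` bounds the clustering error.

Maximizing over the abilities turns the objective into `-m ∑ᵢ h(Nᵢ(w) / m) + ∑ⱼ h(wⱼ)`, where `Nᵢ(w)`
is the soft number of wrong answers of worker `i`. The value at a maximizer is at least the value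
`-m ∑ᵢ h(|Tᵢ| / m)` at the true labels, whence `0 ≤ softGain w T + m h(a)`
(`IsGlobalMaximizer.softGain_nonneg`). As `-h` is convex, the soft gain is at most a mixture of the
gains `gain S T = m ∑ᵢ (h(|Tᵢ| / m) - h(|Tᵢ ∆ S| / m))` of two sets `S` of sizes `⌊am⌋` and `⌊am⌋ + 1`
(`exists_softGain_le`). Hence a large error is impossible as soon as the gain of every set `S` is
more negative than its entropy `|S| log (m / |S|)`; this is the event `FlipsCostly`
(`clusteringError_le_of_flipsCostly`).

That event has probability at least `1 - 3 / m` by Chernoff's inequality and a union bound over `S`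
(`exists_real_not_flipsCostly_le`). The moment generating function of the gain factors over the
workers, and each factor is a moment of a function of two independent binomial variables
(`gainMGF`). For sets of linear size the entropies are compared through Pinsker's inequality and
strong concavity (`gainMGF_sixth_le`), which leaves a constant factor for each worker: this is
harmless, because `n ν̄ ≥ 12 log n` then makes the exponent superlinear in `m`. For smaller sets
such a factor is too much, and at the exponent `1 / 2` the moment is compared with
`(4ε(1 - ε))^(k / 2)`, where `ε` is the error rate of the worker, `k = |S|` and `7 / 16` replaces
`1 / 2` to absorb the losses (`exists_gainMGF_half_le`).

The resulting exponential rate `flipRate` is at least `(7 / 16) n ν̄`, because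
`4ε(1 - ε) = 1 - (2μᵢ - 1)² ≤ exp(-(2μᵢ - 1)²)`. If `D = D(μ̄ ‖ 1 - μ̄)` exceeds `3 ν̄`, the concavity
of the logarithm replaces all workers by average ones, and `-log (1 - (2μ̄ - 1)²) ≥ D / 2` gives a
rate proportional to `n D` (`exists_flipRate_ge_klBern`). This can fail only when `1 - μ̄` is below
`m⁻³`, and then with probability `1 - 1 / m` every worker is always right or always wrong.
-/

/-! ### Inequalities for the binary entropy -/

namespace DawidSkene

open Real (binEntropy)

/-- Hoeffding's lemma for a Bernoulli variable of parameter `q`. -/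
lemma bernoulli_mgf_le {q : ℝ} (h0 : 0 ≤ q) (h1 : q ≤ 1) (s : ℝ) :
    q * Real.exp s + (1 - q) ≤ Real.exp (q * s + s ^ 2 / 8) := by
  set μ : Measure ℝ := ENNReal.ofReal q • Measure.dirac 1 + ENNReal.ofReal (1 - q) • Measure.dirac 0
    with hμ
  have hprob : IsProbabilityMeasure μ := by
    constructor
    simp only [hμ, Measure.add_apply, Measure.smul_apply, measure_univ, smul_eq_mul, mul_one]
    rw [← ENNReal.ofReal_add h0 (by linarith)]
    simp
  have hint : ∀ f : ℝ → ℝ, ∫ x, f x ∂μ = q * f 1 + (1 - q) * f 0 := by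
    intro f
    have hi : ∀ (c a : ℝ), Integrable f (ENNReal.ofReal c • Measure.dirac a) := fun c a =>
      (integrable_dirac (by simp)).smul_measure ENNReal.ofReal_ne_top
    rw [hμ, integral_add_measure (hi _ _) (hi _ _), integral_smul_measure, integral_smul_measure,
      integral_dirac, integral_dirac, ENNReal.toReal_ofReal h0, ENNReal.toReal_ofReal (by linarith)]
    simp
  have hb : ∀ᵐ x ∂μ, (id x : ℝ) ∈ Set.Icc (0 : ℝ) 1 := by
    rw [hμ, ae_add_measure_iff]
    constructor
    · exact Measure.ae_smul_measure (by simp [ae_dirac_eq]) _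
    · exact Measure.ae_smul_measure (by simp [ae_dirac_eq]) _
  have := (hasSubgaussianMGF_of_mem_Icc (μ := μ) (X := id) aemeasurable_id hb).mgf_le s
  rw [mgf, hint, hint] at this
  simp only [id, mul_one, mul_zero, add_zero, sub_zero, nnnorm_one, NNReal.coe_pow, NNReal.coe_div,
    NNReal.coe_one, NNReal.coe_ofNat] at this
  have e1 : Real.exp (s * (1 - q)) = Real.exp s * Real.exp (-(q * s)) := by
    rw [← Real.exp_add]; ring_nf
  have e2 : Real.exp (s * (0 - q)) = Real.exp (-(q * s)) := by ring_nf
  rw [e1, e2] at this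
  have e3 : Real.exp (q * s + s ^ 2 / 8)
      = Real.exp (q * s) * Real.exp ((1 / 2) ^ 2 * s ^ 2 / 2) := by
    rw [← Real.exp_add]; ring_nf
  have e4 : Real.exp (q * s) * Real.exp (-(q * s)) = 1 := by
    rw [← Real.exp_add]; simp
  rw [e3]
  calc q * Real.exp s + (1 - q)
      = Real.exp (q * s) * (q * (Real.exp s * Real.exp (-(q * s)))
          + (1 - q) * Real.exp (-(q * s))) := by
        linear_combination (-(q * Real.exp s + (1 - q))) * e4
    _ ≤ _ := mul_le_mul_of_nonneg_left this (Real.exp_pos _).le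

lemma mul_log_inv_le {x q : ℝ} (hx : 0 ≤ x) (hq : 0 < q) :
    x * Real.log x⁻¹ ≤ -(x * Real.log q) + (q - x) := by
  rcases hx.eq_or_lt with rfl | hx
  · simp [hq.le]
  have := Real.log_le_sub_one_of_pos (div_pos hq hx)
  rw [Real.log_div hq.ne' hx.ne'] at this
  have h2 := mul_le_mul_of_nonneg_left this hx.le
  have : x * (q / x - 1) = q - x := by field_simp
  rw [Real.log_inv]
  linarith

/-- Gibbs' inequality: the entropy is at most the cross entropy. -/
lemma binEntropy_le_crossEntropy {x q : ℝ} (hx0 : 0 ≤ x) (hx1 : x ≤ 1) (hq0 : 0 < q) (hq1 : q < 1) :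
    binEntropy x ≤ -(x * Real.log q) - (1 - x) * Real.log (1 - q) := by
  have h1 := mul_log_inv_le hx0 hq0
  have h2 := mul_log_inv_le (sub_nonneg.2 hx1) (sub_pos.2 hq1)
  rw [binEntropy]
  linarith

lemma mul_log_inv_ge {x q : ℝ} (hx : 0 ≤ x) (hq : 0 < q) :
    -(x * Real.log q) - (x ^ 2 / q - x) ≤ x * Real.log x⁻¹ := by
  rcases hx.eq_or_lt with rfl | hx
  · simp
  have := Real.log_le_sub_one_of_pos (div_pos hx hq)
  rw [Real.log_div hx.ne' hq.ne'] at this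
  have h2 := mul_le_mul_of_nonneg_left this hx.le
  have : x * (x / q - 1) = x ^ 2 / q - x := by field_simp
  rw [Real.log_inv]
  linarith

/-- The relative entropy is at most the `χ²` divergence. -/
lemma crossEntropy_sub_le_binEntropy {x q : ℝ} (hx0 : 0 ≤ x) (hx1 : x ≤ 1) (hq0 : 0 < q)
    (hq1 : q < 1) :
    -(x * Real.log q) - (1 - x) * Real.log (1 - q) - (x - q) ^ 2 / (q * (1 - q))
      ≤ binEntropy x := by
  have h1 := mul_log_inv_ge hx0 hq0
  have h2 := mul_log_inv_ge (sub_nonneg.2 hx1) (sub_pos.2 hq1)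
  have hq1' : 1 - q ≠ 0 := (sub_pos.2 hq1).ne'
  have : (x - q) ^ 2 / (q * (1 - q)) = (x ^ 2 / q - x) + ((1 - x) ^ 2 / (1 - q) - (1 - x)) := by
    field_simp
    ring
  rw [binEntropy, this]
  linarith

lemma binEntropy_le_mul_log {x : ℝ} (hx1 : x ≤ 1) :
    binEntropy x ≤ x * (Real.log x⁻¹ + 1) := by
  have h2 := mul_log_inv_le (x := 1 - x) (q := 1) (sub_nonneg.2 hx1) one_pos
  rw [binEntropy]
  simp only [Real.log_one] at h2
  linarith

/-- Pinsker's inequality for Bernoulli laws, deduced from Gibbs' inequality for the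
exponentially tilted law and Hoeffding's lemma. -/
lemma pinsker {z q : ℝ} (hz0 : 0 ≤ z) (hz1 : z ≤ 1) (hq0 : 0 < q) (hq1 : q < 1) :
    2 * (z - q) ^ 2 ≤ -(z * Real.log q) - (1 - z) * Real.log (1 - q) - binEntropy z := by
  set s := 4 * (z - q)
  set Z := q * Real.exp s + (1 - q)
  have hZ1 : 0 < q * Real.exp s := by positivity
  have hZ : 0 < Z := by simp only [Z]; linarith
  have hZle : Real.log Z ≤ q * s + s ^ 2 / 8 := by
    rw [Real.log_le_iff_le_exp hZ]; exact bernoulli_mgf_le hq0.le hq1.le s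
  have h := binEntropy_le_crossEntropy hz0 hz1 (q := q * Real.exp s / Z) (by positivity)
    (by rw [div_lt_one hZ]; simp only [Z]; linarith)
  have e : 1 - q * Real.exp s / Z = (1 - q) / Z := by
    field_simp; simp only [Z]; ring
  rw [e, Real.log_div hZ1.ne' hZ.ne', Real.log_div (by linarith) hZ.ne',
    Real.log_mul hq0.ne' (Real.exp_pos _).ne', Real.log_exp] at h
  have : s * z - (q * s + s ^ 2 / 8) = 2 * (z - q) ^ 2 := by simp only [s]; ring
  nlinarith

/-- Strong concavity of the binary entropy (modulus `4`, since `h'' ≤ -4`). -/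
lemma binEntropy_strong_concave {a b y z : ℝ} (ha : 0 < a) (hb : 0 < b) (hab : a + b = 1)
    (hy0 : 0 ≤ y) (hy1 : y ≤ 1) (hz0 : 0 ≤ z) (hz1 : z ≤ 1) :
    a * binEntropy y + b * binEntropy z + 2 * (a * b) * (y - z) ^ 2
      ≤ binEntropy (a * y + b * z) := by
  obtain rfl : b = 1 - a := by linarith
  set x := a * y + (1 - a) * z with hx
  have hx0 : 0 ≤ x := by positivity
  have hx1 : x ≤ 1 := by nlinarith
  rcases hx0.eq_or_lt with h | hx0
  · have h1 : a * y = 0 := by nlinarith [mul_nonneg ha.le hy0, mul_nonneg hb.le hz0]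
    have h2 : (1 - a) * z = 0 := by nlinarith [mul_nonneg ha.le hy0, mul_nonneg hb.le hz0]
    have : y = 0 := by simpa [ha.ne'] using h1
    have : z = 0 := by simpa [hb.ne'] using h2
    subst y z; rw [← h]; simp
  rcases hx1.eq_or_lt with h | hx1
  · have h1 : a * (1 - y) = 0 := by
      nlinarith [mul_nonneg ha.le (sub_nonneg.2 hy1), mul_nonneg hb.le (sub_nonneg.2 hz1)]
    have h2 : (1 - a) * (1 - z) = 0 := by
      nlinarith [mul_nonneg ha.le (sub_nonneg.2 hy1), mul_nonneg hb.le (sub_nonneg.2 hz1)]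
    have : 1 - y = 0 := by simpa [ha.ne'] using h1
    have : 1 - z = 0 := by simpa [hb.ne'] using h2
    obtain rfl : y = 1 := by linarith
    obtain rfl : z = 1 := by linarith
    rw [h]; simp
  have h1 := mul_le_mul_of_nonneg_left (pinsker hy0 hy1 hx0 hx1) ha.le
  have h2 := mul_le_mul_of_nonneg_left (pinsker hz0 hz1 hx0 hx1) hb.le
  have e : binEntropy x = -(x * Real.log x) - (1 - x) * Real.log (1 - x) := by
    rw [binEntropy, Real.log_inv, Real.log_inv]; ring
  have e2 : a * (2 * (y - x) ^ 2) + (1 - a) * (2 * (z - x) ^ 2)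
      = 2 * (a * (1 - a)) * (y - z) ^ 2 := by rw [hx]; ring
  rw [e]
  have e3 : a * (-(y * Real.log x) - (1 - y) * Real.log (1 - x))
      + (1 - a) * (-(z * Real.log x) - (1 - z) * Real.log (1 - x))
      = -(x * Real.log x) - (1 - x) * Real.log (1 - x) := by rw [hx]; ring
  linarith

/-! ### Sums against the binomial distribution -/

noncomputable section

/-- The expectation of `g` under the binomial distribution with `M` trials and success
probability `ε`. -/
def binExp (M : ℕ) (ε : ℝ) (g : ℕ → ℝ) : ℝ :=
  ∑ v ∈ Finset.range (M + 1), ε ^ v * (1 - ε) ^ (M - v) * (M.choose v) * g v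

end

lemma binExp_mono {M : ℕ} {ε : ℝ} (h0 : 0 ≤ ε) (h1 : ε ≤ 1) {f g : ℕ → ℝ}
    (h : ∀ v ≤ M, f v ≤ g v) : binExp M ε f ≤ binExp M ε g := by
  refine Finset.sum_le_sum fun v hv => ?_
  have : 0 ≤ 1 - ε := by linarith
  exact mul_le_mul_of_nonneg_left (h v (by simpa [Nat.lt_succ_iff] using hv)) (by positivity)

lemma binExp_nonneg {M : ℕ} {ε : ℝ} (h0 : 0 ≤ ε) (h1 : ε ≤ 1) {g : ℕ → ℝ}
    (h : ∀ v ≤ M, 0 ≤ g v) : 0 ≤ binExp M ε g := by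
  refine Finset.sum_nonneg fun v hv => ?_
  have : 0 ≤ 1 - ε := by linarith
  exact mul_nonneg (by positivity) (h v (by simpa [Nat.lt_succ_iff] using hv))

lemma binExp_pow (M : ℕ) (ε x : ℝ) : binExp M ε (fun v => x ^ v) = (ε * x + (1 - ε)) ^ M := by
  rw [add_pow, binExp]
  refine Finset.sum_congr rfl fun v _ => ?_
  rw [mul_pow]; ring

lemma binExp_const (M : ℕ) (ε c : ℝ) : binExp M ε (fun _ => c) = c := by
  have := binExp_pow M ε 1
  simp only [one_pow, mul_one, add_sub_cancel] at this
  rw [binExp] at *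
  rw [← Finset.sum_mul]
  simp only [mul_one] at this
  rw [this, one_mul]

lemma binExp_const_mul (M : ℕ) (ε c : ℝ) (g : ℕ → ℝ) :
    binExp M ε (fun v => c * g v) = c * binExp M ε g := by
  rw [binExp, binExp, Finset.mul_sum]
  exact Finset.sum_congr rfl fun v _ => by ring

lemma binExp_add (M : ℕ) (ε : ℝ) (f g : ℕ → ℝ) :
    binExp M ε (fun v => f v + g v) = binExp M ε f + binExp M ε g := by
  rw [binExp, binExp, binExp, ← Finset.sum_add_distrib]
  exact Finset.sum_congr rfl fun v _ => by ring

lemma binExp_exp (M : ℕ) (ε c : ℝ) :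
    binExp M ε (fun v => Real.exp (c * v)) = (ε * Real.exp c + (1 - ε)) ^ M := by
  rw [← binExp_pow]
  refine congrArg _ (funext fun v => ?_)
  rw [← Real.exp_nat_mul, mul_comm]

lemma binExp_zero (M : ℕ) (g : ℕ → ℝ) : binExp M 0 g = g 0 := by
  rw [binExp, Finset.sum_range_succ']
  simp

lemma binExp_congr {M : ℕ} {ε : ℝ} {f g : ℕ → ℝ} (h : ∀ v ≤ M, f v = g v) :
    binExp M ε f = binExp M ε g :=
  Finset.sum_congr rfl fun v hv => by rw [h v (by simpa [Nat.lt_succ_iff] using hv)]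

lemma binExp_symm (M : ℕ) (ε : ℝ) (g : ℕ → ℝ) :
    binExp M (1 - ε) g = binExp M ε (fun v => g (M - v)) := by
  rw [binExp, binExp, ← Finset.sum_range_reflect]
  refine Finset.sum_congr rfl fun v hv => ?_
  have hv : v ≤ M := by simpa [Nat.lt_succ_iff] using hv
  have e : M + 1 - 1 - v = M - v := by omega
  rw [e, Nat.sub_sub_self hv, Nat.choose_symm hv]
  ring

/-- A binomial variable centred at its mean is sub-Gaussian with variance proxy `M / 4`. -/
lemma binExp_exp_centered_le {M : ℕ} {ε : ℝ} (h0 : 0 ≤ ε) (h1 : ε ≤ 1) (s : ℝ) :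
    binExp M ε (fun v => Real.exp (s * (v - M * ε))) ≤ Real.exp (M * s ^ 2 / 8) := by
  have e : ∀ v : ℕ, Real.exp (s * (v - M * ε)) = Real.exp (-(s * (M * ε))) * Real.exp (s * v) := by
    intro v; rw [← Real.exp_add]; ring_nf
  simp_rw [e]
  rw [binExp_const_mul, binExp_exp]
  have : (ε * Real.exp s + (1 - ε)) ^ M ≤ Real.exp (ε * s + s ^ 2 / 8) ^ M :=
    pow_le_pow_left₀ (by have := Real.exp_pos s; nlinarith [mul_nonneg h0 this.le])
      (bernoulli_mgf_le h0 h1 s) M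
  refine (mul_le_mul_of_nonneg_left this (Real.exp_pos _).le).trans (le_of_eq ?_)
  rw [← Real.exp_nat_mul, ← Real.exp_add]
  ring_nf

/-! ### Exponential moments of the relative entropy of a binomial sample -/

noncomputable section

/-- `M` times the relative entropy of the empirical frequency `v / M` with respect to `ε`. -/
def sampleKL (M : ℕ) (ε : ℝ) (v : ℕ) : ℝ :=
  -(v * Real.log ε) - ((M : ℝ) - v) * Real.log (1 - ε) - M * binEntropy (v / M)

end

lemma exp_neg_mul_binEntropy {M v : ℕ} (hv : v ≤ M) :
    Real.exp (-(M * binEntropy (v / M))) = ((v : ℝ) / M) ^ v * (1 - (v : ℝ) / M) ^ (M - v) := by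
  rcases Nat.eq_zero_or_pos M with rfl | hM
  · obtain rfl : v = 0 := by omega
    simp
  have hM' : (0 : ℝ) < M := by exact_mod_cast hM
  have key : ∀ (x : ℝ) (r : ℕ), 0 ≤ x → (r : ℝ) = M * x → Real.exp (M * (x * Real.log x)) = x ^ r := by
    intro x r hx hr
    rcases hx.eq_or_lt with rfl | hx
    · have : r = 0 := by exact_mod_cast (by simpa using hr : (r : ℝ) = 0)
      simp [this]
    · rw [← mul_assoc, ← hr, Real.exp_nat_mul, Real.exp_log hx]
  have h1 := key (v / M) v (by positivity) (by field_simp)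
  have hvM : (v : ℝ) / M ≤ 1 := by rw [div_le_one hM']; exact_mod_cast hv
  have h2 := key (1 - v / M) (M - v) (by linarith) (by rw [Nat.cast_sub hv]; field_simp)
  rw [← h1, ← h2, ← Real.exp_add, binEntropy, Real.log_inv, Real.log_inv]
  ring_nf

lemma exp_sampleKL {M v : ℕ} (hv : v ≤ M) {ε : ℝ} (h0 : 0 < ε) (h1 : ε < 1) :
    Real.exp (sampleKL M ε v) * (ε ^ v * (1 - ε) ^ (M - v))
      = ((v : ℝ) / M) ^ v * (1 - (v : ℝ) / M) ^ (M - v) := by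
  rw [← exp_neg_mul_binEntropy hv]
  have e1 : ε ^ v = Real.exp (v * Real.log ε) := by rw [Real.exp_nat_mul, Real.exp_log h0]
  have e2 : (1 - ε) ^ (M - v) = Real.exp (((M : ℝ) - v) * Real.log (1 - ε)) := by
    rw [← Nat.cast_sub hv, Real.exp_nat_mul, Real.exp_log (by linarith)]
  rw [e1, e2, ← Real.exp_add, ← Real.exp_add, sampleKL]
  ring_nf

/-- The mass of the binomial distribution on `[t, M]`. -/
noncomputable def binTail (M : ℕ) (ε : ℝ) (t : ℕ) : ℝ :=
  ∑ s ∈ Finset.Ico t (M + 1), ε ^ s * (1 - ε) ^ (M - s) * (M.choose s)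

lemma binTail_nonneg {M : ℕ} {ε : ℝ} (h0 : 0 ≤ ε) (h1 : ε ≤ 1) (t : ℕ) : 0 ≤ binTail M ε t := by
  refine Finset.sum_nonneg fun s _ => ?_
  have : 0 ≤ 1 - ε := by linarith
  positivity

lemma binTail_zero (M : ℕ) (ε : ℝ) : binTail M ε 0 = 1 := by
  have := binExp_const M ε 1
  simp only [binExp, mul_one] at this
  rwa [binTail, ← Finset.range_eq_Ico]

/-- Chernoff's bound, proved by comparison with the binomial law of parameter `t / M`. -/
lemma exp_sampleKL_mul_binTail_le {M t : ℕ} (ht : t ≤ M) {ε : ℝ} (h0 : 0 < ε) (h1 : ε < 1)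
    (hεt : M * ε ≤ t) : Real.exp (sampleKL M ε t) * binTail M ε t ≤ 1 := by
  rcases Nat.eq_zero_or_pos M with rfl | hM
  · obtain rfl : t = 0 := by omega
    simp [sampleKL, binTail]
  have hM' : (0 : ℝ) < M := by exact_mod_cast hM
  set z : ℝ := (t : ℝ) / M with hz
  have hz0 : 0 ≤ z := by positivity
  have hz1 : z ≤ 1 := by rw [hz, div_le_one hM']; exact_mod_cast ht
  have hεz : ε ≤ z := by rw [hz, le_div_iff₀ hM']; linarith
  have hcmp : ε * (1 - z) ≤ z * (1 - ε) := by linarith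
  have h1' : 0 < 1 - ε := by linarith
  rw [← binTail_zero M z, binTail, binTail, Finset.mul_sum]
  refine (Finset.sum_le_sum (g := fun s => z ^ s * (1 - z) ^ (M - s) * (M.choose s))
    fun s hs => ?_).trans (Finset.sum_le_sum_of_subset_of_nonneg
    (Finset.Ico_subset_Ico_left (Nat.zero_le t)) fun s _ _ => ?_)
  · rw [Finset.mem_Ico] at hs
    obtain ⟨j, rfl⟩ := Nat.exists_eq_add_of_le hs.1
    have hMt : M - t = (M - (t + j)) + j := by omega
    have key := exp_sampleKL ht h0 h1
    rw [← hz, hMt] at key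
    have hp : (ε * (1 - z)) ^ j ≤ (z * (1 - ε)) ^ j :=
      pow_le_pow_left₀ (mul_nonneg h0.le (by linarith)) hcmp j
    have hpos : 0 < (1 - ε) ^ j := by positivity
    rw [← mul_assoc]
    refine mul_le_mul_of_nonneg_right ?_ (by positivity)
    refine le_of_mul_le_mul_right ?_ hpos
    have hnn : 0 ≤ z ^ t * (1 - z) ^ (M - (t + j)) := by
      have : 0 ≤ 1 - z := by linarith
      positivity
    calc Real.exp (sampleKL M ε t) * (ε ^ (t + j) * (1 - ε) ^ (M - (t + j))) * (1 - ε) ^ j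
        = Real.exp (sampleKL M ε t) * (ε ^ t * (1 - ε) ^ (M - (t + j) + j)) * ε ^ j := by ring
      _ = z ^ t * (1 - z) ^ (M - (t + j)) * (ε * (1 - z)) ^ j := by
          rw [key, mul_pow]; ring
      _ ≤ z ^ t * (1 - z) ^ (M - (t + j)) * (z * (1 - ε)) ^ j :=
        mul_le_mul_of_nonneg_left hp hnn
      _ = _ := by rw [mul_pow]; ring
  · have : 0 ≤ 1 - z := by linarith
    positivity

/-- The upper half of the exponential moment of the relative entropy. By Chernoff's bound
`exp (K / 2)` is at most `W ^ (-1/2)` for the tail mass `W`, and `∑ (W_v - W_{v+1}) / √W_v`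
is bounded by a telescoping sum. -/
lemma binExp_exp_half_sampleKL_upper_le {M : ℕ} {ε : ℝ} (h0 : 0 < ε) (h1 : ε < 1) :
    binExp M ε (fun v => if M * ε ≤ v then Real.exp (1 / 2 * sampleKL M ε v) else 0) ≤ 2 := by
  have hW := binTail_nonneg (M := M) h0.le h1.le
  have hterm : ∀ v ∈ Finset.range (M + 1), ε ^ v * (1 - ε) ^ (M - v) * (M.choose v)
      * (if M * ε ≤ v then Real.exp (1 / 2 * sampleKL M ε v) else 0)
      ≤ 2 * √(binTail M ε v) - 2 * √(binTail M ε (v + 1)) := by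
    intro v hv
    have hv : v ≤ M := by simpa [Nat.lt_succ_iff] using hv
    set b := ε ^ v * (1 - ε) ^ (M - v) * (M.choose v) with hb
    have hb0 : 0 ≤ b := by
      have : 0 ≤ 1 - ε := by linarith
      positivity
    have hsplit : binTail M ε v = b + binTail M ε (v + 1) := by
      rw [binTail, Finset.sum_eq_sum_Ico_succ_bot (by omega)]; rfl
    have hmono : √(binTail M ε (v + 1)) ≤ √(binTail M ε v) :=
      Real.sqrt_le_sqrt (by linarith)
    split_ifs with hc
    · have hch := exp_sampleKL_mul_binTail_le hv h0 h1 hc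
      have hsq : Real.exp (1 / 2 * sampleKL M ε v) * √(binTail M ε v) ≤ 1 := by
        have e : ((2 : ℕ) : ℝ) * (1 / 2 * sampleKL M ε v) = sampleKL M ε v := by
          push_cast; ring
        rw [← abs_of_nonneg (a := Real.exp (1 / 2 * sampleKL M ε v) * √(binTail M ε v))
          (by positivity), ← sq_le_one_iff_abs_le_one, mul_pow, Real.sq_sqrt (hW v),
          ← Real.exp_nat_mul, e]
        exact hch
      have e1 := Real.sq_sqrt (hW v)
      have e2 := Real.sq_sqrt (hW (v + 1))
      have hbe : b = (√(binTail M ε v) - √(binTail M ε (v + 1)))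
          * (√(binTail M ε v) + √(binTail M ε (v + 1))) := by
        have : b = √(binTail M ε v) ^ 2 - √(binTail M ε (v + 1)) ^ 2 := by
          rw [e1, e2]; linarith
        rw [this]; ring
      set A := √(binTail M ε v)
      set B := √(binTail M ε (v + 1))
      set E := Real.exp (1 / 2 * sampleKL M ε v)
      have hE : 0 < E := Real.exp_pos _
      have hB : 0 ≤ B := Real.sqrt_nonneg _
      rw [hbe]
      have : (A - B) * (A + B) * E ≤ (A - B) * (2 * A) * E := by
        have : 0 ≤ A - B := by linarith
        gcongr
        linarith
      nlinarith
    · rw [mul_zero]; linarith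
  refine (Finset.sum_le_sum hterm).trans ?_
  rw [Finset.sum_range_sub' (fun v => 2 * √(binTail M ε v)), binTail_zero, Real.sqrt_one]
  have := Real.sqrt_nonneg (binTail M ε (M + 1))
  linarith

lemma sampleKL_symm {M v : ℕ} (hv : v ≤ M) (ε : ℝ) :
    sampleKL M (1 - ε) (M - v) = sampleKL M ε v := by
  rcases Nat.eq_zero_or_pos M with rfl | hM
  · obtain rfl : v = 0 := by omega
    simp [sampleKL]
  have hM' : (M : ℝ) ≠ 0 := by exact_mod_cast hM.ne'
  have e : ((M - v : ℕ) : ℝ) / M = 1 - v / M := by rw [Nat.cast_sub hv]; field_simp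
  rw [sampleKL, sampleKL, e, Real.binEntropy_one_sub, Nat.cast_sub hv, sub_sub_cancel]
  ring_nf

lemma binExp_exp_half_sampleKL_le {M : ℕ} {ε : ℝ} (h0 : 0 < ε) (h1 : ε < 1) :
    binExp M ε (fun v => Real.exp (1 / 2 * sampleKL M ε v)) ≤ 4 := by
  have hA := binExp_exp_half_sampleKL_upper_le (M := M) h0 h1
  have hB := binExp_exp_half_sampleKL_upper_le (M := M) (ε := 1 - ε) (by linarith) (by linarith)
  rw [binExp_symm] at hB
  refine (binExp_mono h0.le h1.le fun v hv => ?_).trans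
    ((binExp_add M ε _ _).le.trans ((add_le_add hA hB).trans (by norm_num)))
  have hs := sampleKL_symm hv ε
  simp only [hs]
  have hp := Real.exp_pos (1 / 2 * sampleKL M ε v)
  by_cases hc : (M : ℝ) * ε ≤ v
  · rw [if_pos hc]
    split_ifs <;> linarith
  · have : (M : ℝ) * (1 - ε) ≤ ((M - v : ℕ) : ℝ) := by rw [Nat.cast_sub hv]; linarith
    rw [if_neg hc, if_pos this]; linarith

lemma pinsker_sampleKL {M v : ℕ} (hv : v ≤ M) {ε : ℝ} (h0 : 0 < ε) (h1 : ε < 1) :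
    2 * M * ((v : ℝ) / M - ε) ^ 2 ≤ sampleKL M ε v := by
  rcases Nat.eq_zero_or_pos M with rfl | hM
  · obtain rfl : v = 0 := by omega
    simp [sampleKL]
  have hM' : (0 : ℝ) < M := by exact_mod_cast hM
  have hvM : (v : ℝ) / M ≤ 1 := by rw [div_le_one hM']; exact_mod_cast hv
  have := mul_le_mul_of_nonneg_left (pinsker (z := v / M) (by positivity) hvM h0 h1) hM'.le
  have e : (M : ℝ) * (-((v : ℝ) / M * Real.log ε) - (1 - (v : ℝ) / M) * Real.log (1 - ε)
      - binEntropy (v / M)) = sampleKL M ε v := by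
    rw [sampleKL]; field_simp
  linarith

/-! ### The exponential moment of one worker's likelihood gain -/

noncomputable section

/-- The gain in the profile log-likelihood of a worker with `u` wrong answers outside and `v` wrong
answers inside a set of `k` items, when the labels of these `k` items are flipped; there are
`l` other items. -/
def flipGain (k l u v : ℕ) : ℝ :=
  ((k : ℝ) + l) * (binEntropy (((u : ℝ) + v) / (k + l)) - binEntropy (((u : ℝ) + k - v) / (k + l)))

/-- The exponential moment of order `θ` of the likelihood gain of a worker with error
probability `ε`. -/
def gainMGF (θ : ℝ) (k l : ℕ) (ε : ℝ) : ℝ :=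
  binExp l ε fun u => binExp k ε fun v => Real.exp (θ * flipGain k l u v)

end

lemma gainMGF_symm (θ : ℝ) (k l : ℕ) (ε : ℝ) : gainMGF θ k l (1 - ε) = gainMGF θ k l ε := by
  rw [gainMGF, gainMGF, binExp_symm]
  refine binExp_congr fun u hu => ?_
  rw [binExp_symm]
  refine binExp_congr fun v hv => ?_
  rcases Nat.eq_zero_or_pos (k + l) with h | h
  · obtain ⟨rfl, rfl⟩ : k = 0 ∧ l = 0 := by omega
    simp [flipGain]
  have hm : (k : ℝ) + l ≠ 0 := by exact_mod_cast h.ne'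
  have e1 : (((l - u : ℕ) : ℝ) + ((k - v : ℕ) : ℝ)) / (k + l) = 1 - ((u : ℝ) + v) / (k + l) := by
    rw [Nat.cast_sub hu, Nat.cast_sub hv]; field_simp; ring
  have e2 : (((l - u : ℕ) : ℝ) + k - ((k - v : ℕ) : ℝ)) / (k + l)
      = 1 - ((u : ℝ) + k - v) / (k + l) := by
    rw [Nat.cast_sub hu, Nat.cast_sub hv]; field_simp; ring
  rw [flipGain, flipGain, e1, e2, Real.binEntropy_one_sub, Real.binEntropy_one_sub]

/-- Bounding the entropy of the original labels by the cross entropy with `ε`, and that of the flipped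
labels by strong concavity, leaves the deviations of `u` and `v` from their means, which Pinsker's
inequality absorbs into the relative entropies. -/
lemma flipGain_le_sampleKL {k l u v : ℕ} (hk : 0 < k) (hl : 0 < l) (hu : u ≤ l) (hv : v ≤ k) {ε : ℝ}
    (h0 : 0 < ε) (h1 : ε < 1) :
    flipGain k l u v ≤ 3 * sampleKL k ε v + 3 * sampleKL l ε u
      - (k : ℝ) * l / (k + l) * (1 - 2 * ε) ^ 2 := by
  have hk' : (0 : ℝ) < k := by exact_mod_cast hk
  have hl' : (0 : ℝ) < l := by exact_mod_cast hl
  have hu' : (u : ℝ) ≤ l := by exact_mod_cast hu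
  have hv' : (v : ℝ) ≤ k := by exact_mod_cast hv
  have hm : (0 : ℝ) < k + l := by positivity
  have hpk := pinsker_sampleKL hv h0 h1
  have hpl := pinsker_sampleKL hu h0 h1
  set z : ℝ := v / k with hz
  set y : ℝ := u / l with hy
  have hz0 : 0 ≤ z := by positivity
  have hy0 : 0 ≤ y := by positivity
  have hz1 : z ≤ 1 := by rw [hz, div_le_one hk']; exact hv'
  have hy1 : y ≤ 1 := by rw [hy, div_le_one hl']; exact hu'
  have hvz : (v : ℝ) = k * z := by rw [hz]; field_simp
  have huy : (u : ℝ) = l * y := by rw [hy]; field_simp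
  have hgibbs := mul_le_mul_of_nonneg_left (binEntropy_le_crossEntropy
    (x := ((u : ℝ) + v) / (k + l)) (by positivity)
    (by rw [div_le_one hm]; linarith) h0 h1) hm.le
  have hconc := mul_le_mul_of_nonneg_left (binEntropy_strong_concave (a := k / (k + l))
    (b := l / (k + l)) (y := 1 - z) (z := y) (by positivity) (by positivity) (by field_simp)
    (by linarith) (by linarith) hy0 hy1) hm.le
  have e1 : (k : ℝ) / (k + l) * (1 - z) + l / (k + l) * y = ((u : ℝ) + k - v) / (k + l) := by
    rw [hvz, huy]; field_simp; ring
  rw [e1, Real.binEntropy_one_sub] at hconc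
  have e2 : ((k : ℝ) + l) * (-(((u : ℝ) + v) / (k + l) * Real.log ε)
      - (1 - ((u : ℝ) + v) / (k + l)) * Real.log (1 - ε))
      = k * binEntropy z + l * binEntropy y + sampleKL k ε v + sampleKL l ε u := by
    rw [sampleKL, sampleKL, ← hz, ← hy]; field_simp; ring
  have e3 : ((k : ℝ) + l) * (k / (k + l) * binEntropy z + l / (k + l) * binEntropy y
      + 2 * (k / (k + l) * (l / (k + l))) * (1 - z - y) ^ 2)
      = k * binEntropy z + l * binEntropy y + 2 * (k * l / (k + l)) * (1 - z - y) ^ 2 := by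
    field_simp
  rw [e2] at hgibbs
  rw [e3] at hconc
  set c : ℝ := (k : ℝ) * l / (k + l) with hc
  have hc0 : 0 ≤ c := by positivity
  have hck : c ≤ k := by
    rw [hc, div_le_iff₀ hm]; exact mul_le_mul_of_nonneg_left (by linarith) hk'.le
  have hcl : c ≤ l := by
    rw [hc, div_le_iff₀ hm, mul_comm]; exact mul_le_mul_of_nonneg_left (by linarith) hl'.le
  have hsq : (1 - 2 * ε) ^ 2 - 4 * (z - ε) ^ 2 - 4 * (y - ε) ^ 2 ≤ 2 * (1 - z - y) ^ 2 := by
    linear_combination 2 * sq_nonneg ((z - ε) - (y - ε))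
      + sq_nonneg ((1 - 2 * ε) - 2 * ((z - ε) + (y - ε)))
  have h3 := mul_le_mul_of_nonneg_left hsq hc0
  have h4 := mul_le_mul_of_nonneg_right hck (sq_nonneg (z - ε))
  have h5 := mul_le_mul_of_nonneg_right hcl (sq_nonneg (y - ε))
  rw [flipGain, mul_sub]
  clear_value c z y
  generalize (z - ε) ^ 2 = A at *
  generalize (y - ε) ^ 2 = B at *
  generalize (1 - z - y) ^ 2 = Q at *
  generalize ((k : ℝ) + l) * binEntropy (((u : ℝ) + v) / (k + l)) = X at *
  generalize ((k : ℝ) + l) * binEntropy (((u : ℝ) + k - v) / (k + l)) = X' at *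
  generalize (k : ℝ) * binEntropy z = E at *
  generalize (l : ℝ) * binEntropy y = E' at *
  generalize (1 - 2 * ε) ^ 2 = d at *
  linarith only [hgibbs, hconc, h3, h4, h5, hpk, hpl]

/-- A bound for the exponential moment that is useful when a positive fraction of the items is
flipped: it loses a constant factor. -/
lemma gainMGF_sixth_le {k l : ℕ} (hk : 0 < k) (hl : 0 < l) {ε : ℝ} (h0 : 0 ≤ ε) (h1 : ε < 1) :
    gainMGF (1 / 6) k l ε ≤ 16 * Real.exp (-((k : ℝ) * l / (k + l) * (1 - 2 * ε) ^ 2 / 6)) := by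
  have hk' : (0 : ℝ) < k := by exact_mod_cast hk
  have hl' : (0 : ℝ) < l := by exact_mod_cast hl
  rcases h0.eq_or_lt with rfl | h0
  · rw [gainMGF, binExp_zero, binExp_zero]
    have hconc := binEntropy_strong_concave (a := k / ((k : ℝ) + l))
      (b := l / (k + l)) (y := 1) (z := 0) (by positivity) (by positivity) (by field_simp)
      (by norm_num) (by norm_num) (by norm_num) (by norm_num)
    have : flipGain k l 0 0 ≤ -((k : ℝ) * l / (k + l) * (1 - 2 * 0) ^ 2) := by
      simp only [flipGain, Nat.cast_zero, zero_add, zero_div, sub_zero, Real.binEntropy_zero,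
        zero_sub, mul_neg, mul_zero, one_pow, mul_one, neg_le_neg_iff, Real.binEntropy_one] at *
      have h2 := mul_le_mul_of_nonneg_left hconc (by positivity : (0 : ℝ) ≤ k + l)
      have e : ((k : ℝ) + l) * (0 + 0 + 2 * (k / (k + l) * (l / (k + l))))
        = 2 * (k * l / (k + l)) := by field_simp; ring
      have : 0 ≤ (k : ℝ) * l / (k + l) := by positivity
      simp only [add_zero] at h2
      linarith
    calc _ ≤ 1 * Real.exp (-((k : ℝ) * l / (k + l) * (1 - 2 * 0) ^ 2 / 6)) := by
          rw [one_mul, Real.exp_le_exp]; linarith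
      _ ≤ _ := by gcongr; norm_num
  set A := Real.exp (-((k : ℝ) * l / (k + l) * (1 - 2 * ε) ^ 2 / 6))
  have hA : 0 < A := Real.exp_pos _
  have h4k := binExp_exp_half_sampleKL_le (M := k) h0 h1
  have h4l := binExp_exp_half_sampleKL_le (M := l) h0 h1
  calc gainMGF (1 / 6) k l ε
      ≤ binExp l ε fun u => binExp k ε fun v => (A * Real.exp (1 / 2 * sampleKL l ε u))
          * Real.exp (1 / 2 * sampleKL k ε v) := by
        refine binExp_mono h0.le h1.le fun u hu => binExp_mono h0.le h1.le fun v hv => ?_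
        rw [← Real.exp_add, ← Real.exp_add, Real.exp_le_exp]
        have := flipGain_le_sampleKL hk hl hu hv h0 h1
        linarith
    _ ≤ binExp l ε fun u => (A * 4) * Real.exp (1 / 2 * sampleKL l ε u) := by
        refine binExp_mono h0.le h1.le fun u hu => ?_
        rw [binExp_const_mul]
        have := Real.exp_pos (1 / 2 * sampleKL l ε u)
        nlinarith [mul_pos hA this]
    _ ≤ 16 * A := by
        rw [binExp_const_mul]
        nlinarith

/-! ### Gaussian linearization of quadratic exponents -/

lemma gaussianPDFReal_mul_exp_sq (τ x : ℝ) :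
    gaussianPDFReal 0 1 x * Real.exp (τ * x ^ 2)
      = (√(2 * Real.pi))⁻¹ * Real.exp (-(1 / 2 - τ) * x ^ 2) := by
  rw [gaussianPDFReal, mul_assoc, ← Real.exp_add]
  simp only [NNReal.coe_one, mul_one, sub_zero]
  ring_nf

lemma integrable_exp_sq_gaussianReal {τ : ℝ} (hτ : τ < 1 / 2) :
    Integrable (fun x => Real.exp (τ * x ^ 2)) (gaussianReal 0 1) := by
  rw [gaussianReal_of_var_ne_zero 0 one_ne_zero,
    integrable_withDensity_iff_integrable_smul' (measurable_gaussianPDF 0 1)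
      (by simp [gaussianPDF])]
  have : ∀ x, (gaussianPDF 0 1 x).toReal • Real.exp (τ * x ^ 2)
      = (√(2 * Real.pi))⁻¹ * Real.exp (-(1 / 2 - τ) * x ^ 2) := by
    intro x
    rw [toReal_gaussianPDF, smul_eq_mul, gaussianPDFReal_mul_exp_sq]
  simp_rw [this]
  exact (integrable_exp_neg_mul_sq (by linarith)).const_mul _

lemma integral_exp_sq_gaussianReal_le {τ : ℝ} (h0 : 0 ≤ τ) (hτ : τ ≤ 1 / 4) :
    ∫ x, Real.exp (τ * x ^ 2) ∂(gaussianReal 0 1) ≤ Real.exp (2 * τ) := by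
  rw [integral_gaussianReal_eq_integral_smul one_ne_zero]
  simp_rw [smul_eq_mul, gaussianPDFReal_mul_exp_sq]
  rw [integral_const_mul, integral_gaussian, ← Real.sqrt_inv, ← Real.sqrt_mul (by positivity)]
  have hpos : 0 < 1 - 2 * τ := by linarith
  have hpi := Real.pi_pos
  have e : (2 * Real.pi)⁻¹ * (Real.pi / (1 / 2 - τ)) = (1 - 2 * τ)⁻¹ := by
    have : 1 / 2 - τ ≠ 0 := by linarith
    field_simp
  rw [e, Real.sqrt_le_left (Real.exp_pos _).le, ← Real.exp_nat_mul, inv_le_comm₀ hpos (Real.exp_pos _),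
    ← Real.exp_neg]
  have h1 := Real.add_one_le_exp (4 * τ)
  have h2 : ((2 : ℕ) : ℝ) * (2 * τ) = 4 * τ := by push_cast; ring
  rw [h2, Real.exp_neg, inv_le_comm₀ (Real.exp_pos _) hpos]
  refine le_trans ?_ h1
  rw [inv_le_iff_one_le_mul₀ hpos]
  nlinarith

/-- If all exponential moments of `x` (with weight `w`) are bounded like those of a Gaussian
variable, then so are the exponential moments of `x²`. This follows from
`exp (c x²) = 𝔼 exp (√(2c) x g)` for a standard Gaussian `g`. -/
lemma binExp_exp_sq_le {M : ℕ} {ε : ℝ} {w x : ℕ → ℝ} {K b c : ℝ} (hK : 0 ≤ K) (hb : 0 ≤ b)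
    (hc : 0 ≤ c) (hbc : 8 * b * c ≤ 1)
    (h : ∀ s : ℝ, binExp M ε (fun v => w v * Real.exp (s * x v)) ≤ K * Real.exp (b * s ^ 2)) :
    binExp M ε (fun v => w v * Real.exp (c * x v ^ 2)) ≤ K * Real.exp (4 * b * c) := by
  have hmgf : ∀ y : ℝ, ∫ g, Real.exp ((√(2 * c) * y) * g) ∂(gaussianReal 0 1)
      = Real.exp (c * y ^ 2) := by
    intro y
    have := congrFun (mgf_id_gaussianReal (μ := 0) (v := 1)) (√(2 * c) * y)
    simp only [mgf, id] at this
    rw [this, mul_pow, Real.sq_sqrt (by positivity), NNReal.coe_one]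
    ring_nf
  have hint : ∀ y : ℝ, Integrable (fun g => Real.exp ((√(2 * c) * y) * g)) (gaussianReal 0 1) :=
    fun y => integrable_exp_mul_gaussianReal _
  have heq : binExp M ε (fun v => w v * Real.exp (c * x v ^ 2))
      = ∫ g, binExp M ε (fun v => w v * Real.exp ((√(2 * c) * g) * x v)) ∂(gaussianReal 0 1) := by
    simp only [binExp]
    have e : ∀ (g : ℝ) (v : ℕ), Real.exp ((√(2 * c) * g) * x v)
        = Real.exp ((√(2 * c) * x v) * g) := fun g v => by ring_nf
    simp_rw [e]
    rw [integral_finsetSum]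
    · refine Finset.sum_congr rfl fun v _ => ?_
      rw [integral_const_mul, integral_const_mul, hmgf]
    · intro v _
      exact ((hint (x v)).const_mul _).const_mul _
  have hτ : 2 * b * c ≤ 1 / 4 := by linarith
  rw [heq]
  calc _ ≤ ∫ g, K * Real.exp ((2 * b * c) * g ^ 2) ∂(gaussianReal 0 1) := by
        refine integral_mono ?_ ((integrable_exp_sq_gaussianReal (by linarith)).const_mul K) ?_
        · simp only [binExp]
          refine integrable_finsetSum _ fun v _ => ?_
          have e : ∀ g : ℝ, Real.exp ((√(2 * c) * g) * x v)
            = Real.exp ((√(2 * c) * x v) * g) := fun g => by ring_nf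
          simp_rw [e]
          exact ((hint (x v)).const_mul _).const_mul _
        · intro g
          refine (h _).trans (le_of_eq ?_)
          rw [mul_pow, Real.sq_sqrt (by positivity)]
          ring_nf
    _ ≤ _ := by
        rw [integral_const_mul]
        refine mul_le_mul_of_nonneg_left ((integral_exp_sq_gaussianReal_le (by positivity) hτ).trans
          (le_of_eq ?_)) hK
        ring_nf

lemma binExp_exp_sq_centered_le {M : ℕ} {ε c : ℝ} (h0 : 0 ≤ ε) (h1 : ε ≤ 1) (hc : 0 ≤ c)
    (hMc : M * c ≤ 1) :
    binExp M ε (fun v => Real.exp (c * (v - M * ε) ^ 2)) ≤ Real.exp (M * c) := by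
  have := binExp_exp_sq_le (M := M) (ε := ε) (w := fun _ => 1) (x := fun v => v - M * ε) (K := 1)
    (b := M / 8) (c := c) zero_le_one (by positivity) hc (by linarith) (fun s => by
      simp only [one_mul]
      exact (binExp_exp_centered_le h0 h1 s).trans (le_of_eq (by ring_nf)))
  simp only [one_mul] at this
  refine this.trans (Real.exp_le_exp.2 ?_)
  have : 0 ≤ (M : ℝ) * c := by positivity
  linarith

/-! ### The likelihood gain around the midpoint of the two error frequencies -/

/-- The likelihood gain is controlled by the log-odds at the midpoint
`q = (u + k/2) / m` of the two error frequencies, up to a `χ²` term. -/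
lemma flipGain_le_midpoint {k l u v : ℕ} (hk : 0 < k) (hu : u ≤ l) (hv : v ≤ k) {q : ℝ}
    (hq : q = (u + k / 2) / (k + l)) (hq1 : q < 1) :
    1 / 2 * flipGain k l u v ≤ (v - k / 2) * (Real.log (1 - q) - Real.log q)
      + (k - 2 * v) ^ 2 / (8 * (k + l) * (q * (1 - q))) := by
  have hk' : (0 : ℝ) < k := by exact_mod_cast hk
  have hu' : (u : ℝ) ≤ l := by exact_mod_cast hu
  have hv' : (v : ℝ) ≤ k := by exact_mod_cast hv
  have hm : (0 : ℝ) < k + l := by positivity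
  have hq0 : 0 < q := by rw [hq]; positivity
  have hA := mul_le_mul_of_nonneg_left (binEntropy_le_crossEntropy (x := ((u : ℝ) + v) / (k + l))
    (by positivity) (by rw [div_le_one hm]; linarith) hq0 hq1) hm.le
  have hB := mul_le_mul_of_nonneg_left (crossEntropy_sub_le_binEntropy
    (x := ((u : ℝ) + k - v) / (k + l)) (div_nonneg (by
      have : (0 : ℝ) ≤ u := by positivity
      linarith) hm.le)
    (by rw [div_le_one hm]; linarith [(by positivity : (0 : ℝ) ≤ v)]) hq0 hq1) hm.le
  have e1 : ((u : ℝ) + k - v) / (k + l) - q = (k - 2 * v) / (2 * (k + l)) := by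
    rw [hq]; field_simp; ring
  rw [e1] at hB
  have hq1' : 0 < 1 - q := by linarith
  have e2 : ((k : ℝ) + l) * (((k : ℝ) - 2 * v) / (2 * (k + l))) ^ 2 / (q * (1 - q))
      = 2 * ((k - 2 * v) ^ 2 / (8 * (k + l) * (q * (1 - q)))) := by
    field_simp
    ring
  rw [mul_sub, ← mul_div_assoc, e2] at hB
  rw [flipGain]
  have e3 : ((k : ℝ) + l) * (-(((u : ℝ) + v) / (k + l) * Real.log q)
      - (1 - ((u : ℝ) + v) / (k + l)) * Real.log (1 - q))
      = -((u + v) * Real.log q) - ((k + l) - (u + v)) * Real.log (1 - q) := by field_simp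
  have e4 : ((k : ℝ) + l) * (-(((u : ℝ) + k - v) / (k + l) * Real.log q)
      - (1 - ((u : ℝ) + k - v) / (k + l)) * Real.log (1 - q))
      = -((u + k - v) * Real.log q) - ((k + l) - (u + k - v)) * Real.log (1 - q) := by field_simp
  rw [e3] at hA
  rw [e4] at hB
  rw [mul_sub]
  linarith

/-! ### Nearly perfect workers -/

lemma binExp_exp_half_flipGain_le {k l u : ℕ} (hk : 0 < k) (hu : u ≤ l) {q ε : ℝ} (h0 : 0 ≤ ε)
    (h1 : ε ≤ 1) (hq : q = (u + k / 2) / (k + l)) (hq1 : q ≤ 1 / 2) :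
    binExp k ε (fun v => Real.exp (1 / 2 * flipGain k l u v)) ≤ (2 * (√(2 * q) + ε / √q)) ^ k := by
  have hk' : (0 : ℝ) < k := by exact_mod_cast hk
  have hm : (0 : ℝ) < k + l := by positivity
  have hq0 : 0 < q := by rw [hq]; positivity
  have hqk : (k : ℝ) ≤ 2 * ((k + l) * q) := by
    rw [hq]; field_simp; linarith [(by positivity : (0 : ℝ) ≤ u)]
  have h1q : 0 < 1 - q := by linarith
  set ρ := q / (1 - q) with hρ
  have hρ0 : 0 < ρ := by positivity
  have hρ1 : q ≤ ρ := by rw [hρ, le_div_iff₀ h1q]; nlinarith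
  have hρ2 : ρ ≤ 2 * q := by rw [hρ, div_le_iff₀ h1q]; nlinarith
  have hlogρ : Real.log ρ = Real.log q - Real.log (1 - q) := Real.log_div hq0.ne' h1q.ne'
  have hpt : ∀ v ≤ k, Real.exp (1 / 2 * flipGain k l u v)
      ≤ (Real.exp (1 / 2) * √ρ) ^ k * (ρ⁻¹) ^ v := by
    intro v hv
    have hv' : (v : ℝ) ≤ k := by exact_mod_cast hv
    have hv0 : (0 : ℝ) ≤ v := by positivity
    have h := flipGain_le_midpoint hk hu hv hq (by linarith)
    have hχ : ((k : ℝ) - 2 * v) ^ 2 / (8 * (k + l) * (q * (1 - q))) ≤ k / 2 := by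
      rw [div_le_iff₀ (by positivity)]
      have : (k : ℝ) ≤ 4 * ((k + l) * q) * (1 - q) := by nlinarith
      nlinarith
    have e1 : √ρ = Real.exp (Real.log ρ / 2) := by
      rw [← Real.log_sqrt hρ0.le, Real.exp_log (Real.sqrt_pos.2 hρ0)]
    have e2 : ρ⁻¹ = Real.exp (-Real.log ρ) := by rw [Real.exp_neg, Real.exp_log hρ0]
    rw [e1, e2, ← Real.exp_add, ← Real.exp_nat_mul, ← Real.exp_nat_mul, ← Real.exp_add,
      Real.exp_le_exp]
    have : ((v : ℝ) - k / 2) * (Real.log (1 - q) - Real.log q)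
        = k * (Real.log ρ / 2) + v * -Real.log ρ := by rw [hlogρ]; ring
    linarith
  refine (binExp_mono h0 h1 hpt).trans ?_
  rw [binExp_const_mul, binExp_pow, ← mul_pow]
  have hsρ : 0 < √ρ := Real.sqrt_pos.2 hρ0
  have he : Real.exp (1 / 2) ≤ 2 := by
    have h2 : Real.exp (1 / 2) ^ 2 = Real.exp 1 := by
      rw [← Real.exp_nat_mul]; norm_num
    nlinarith [Real.exp_one_lt_d9, Real.exp_pos (1 / 2)]
  have hs1 : √ρ ≤ √(2 * q) := Real.sqrt_le_sqrt hρ2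
  have hs2 : ε / √ρ ≤ ε / √q := by
    have := Real.sqrt_pos.2 hq0
    gcongr
  have hinv : √ρ * ρ⁻¹ = (√ρ)⁻¹ := by
    nth_rewrite 2 [← Real.sq_sqrt hρ0.le]; field_simp
  have h1ε : 0 ≤ 1 - ε := by linarith
  refine pow_le_pow_left₀ (by positivity) ?_ k
  calc Real.exp (1 / 2) * √ρ * (ε * ρ⁻¹ + (1 - ε))
      = Real.exp (1 / 2) * (ε * (√ρ * ρ⁻¹) + (1 - ε) * √ρ) := by ring
    _ ≤ 2 * (ε * (√ρ * ρ⁻¹) + 1 * √ρ) := by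
        gcongr
        linarith
    _ ≤ _ := by
        rw [hinv, ← div_eq_mul_inv]
        linarith

lemma binExp_exp_le_two_mul {M : ℕ} {ε s : ℝ} (h0 : 0 ≤ ε) (h1 : ε ≤ 1) (hs0 : 0 ≤ s) (hs : s ≤ 1) :
    binExp M ε (fun u => Real.exp (s * u)) ≤ Real.exp (2 * (M * ε * s)) := by
  rw [binExp_exp]
  have h2 : Real.exp s ≤ 1 + 2 * s := by
    have := Real.abs_exp_sub_one_le (x := s) (by rwa [abs_of_nonneg hs0])
    rw [abs_of_nonneg hs0] at this
    linarith [le_abs_self (Real.exp s - 1)]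
  have h3 : ε * Real.exp s + (1 - ε) ≤ Real.exp (2 * ε * s) := by
    have := Real.add_one_le_exp (2 * ε * s)
    nlinarith
  refine (pow_le_pow_left₀ (by have := Real.exp_pos s; nlinarith [mul_nonneg h0 this.le]) h3 M).trans
    (le_of_eq ?_)
  rw [← Real.exp_nat_mul]; ring_nf

lemma binExp_exp_neg_le {M : ℕ} {ε : ℝ} (h0 : 0 ≤ ε) (h1 : ε ≤ 1) :
    binExp M ε (fun u => Real.exp (-u)) ≤ Real.exp (-(3 / 5 * (M * ε))) := by
  have : ∀ u : ℕ, Real.exp (-(u : ℝ)) = Real.exp (-1 * (u : ℝ)) := fun u => by ring_nf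
  simp_rw [this]
  rw [binExp_exp]
  have h2 : Real.exp (-1) ≤ 2 / 5 := by
    have := Real.exp_one_gt_d9
    rw [Real.exp_neg, inv_le_comm₀ (by positivity) (by norm_num)]
    norm_num; linarith
  have h3 : ε * Real.exp (-1) + (1 - ε) ≤ Real.exp (-(3 / 5 * ε)) := by
    have := Real.add_one_le_exp (-(3 / 5 * ε))
    nlinarith
  refine (pow_le_pow_left₀ (by have := Real.exp_pos (-1); nlinarith [mul_nonneg h0 this.le]) h3 M).trans
    (le_of_eq ?_)
  rw [← Real.exp_nat_mul]; ring_nf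

/-- A pointwise bound, in the number `u` of wrong answers outside the flipped set, by functions
whose binomial expectation is explicit. The last one is active for `u > m / 4` only, an event of
tiny probability. -/
lemma binExp_exp_half_flipGain_le_sum {k l : ℕ} (hk : 0 < k) {ε s m lam A1 A2 A3 : ℝ} (h0 : 0 ≤ ε)
    (hεs : ε ≤ s) (hmdef : m = (k : ℝ) + l) (hks : (k : ℝ) ≤ s * m) (hs0 : 0 < s) (hs : s ≤ 1 / 64)
    (hlam : lam = k / (2 * s * m)) (hA1 : A1 = (√(2 * s)) ^ k * Real.exp (k / 4))
    (hA2 : A2 = (ε * √(2 * m / k)) ^ k * Real.exp (m * ε / 4))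
    (hA3 : A3 = Real.exp (m * Real.log 2 / 2 + m / 4 * Real.log s)) {u : ℕ} (hu : u ≤ l) :
    binExp k ε (fun v => Real.exp (1 / 2 * flipGain k l u v))
      ≤ 4 ^ k * (A1 * Real.exp (lam * u) + (2 * √ε) ^ k + A2 * Real.exp (-u))
        + A3 * Real.exp (-Real.log s * u) := by
  have hk' : (0 : ℝ) < k := by exact_mod_cast hk
  have hm : 0 < m := by rw [hmdef]; positivity
  have h1 : ε ≤ 1 := by linarith
  have hkm : 64 * (k : ℝ) ≤ m := by nlinarith
  have hlam0 : 0 ≤ lam := by rw [hlam]; positivity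
  have hlam1 : lam ≤ 1 / 2 := by
    rw [hlam, div_le_iff₀ (by positivity)]; linarith
  have hA10 : 0 ≤ A1 := by rw [hA1]; positivity
  have hA20 : 0 ≤ A2 := by rw [hA2]; positivity
  have hA30 : 0 ≤ A3 := by rw [hA3]; positivity
  have hu' : (u : ℝ) ≤ l := by exact_mod_cast hu
  have hu0 : (0 : ℝ) ≤ u := by positivity
  rcases le_or_gt (4 * (u : ℝ)) m with hc | hc
  · set q : ℝ := (u + k / 2) / (k + l) with hq
    rw [← hmdef] at hq
    have hq0 : 0 < q := by rw [hq]; positivity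
    have hq1 : q ≤ 1 / 2 := by rw [hq, div_le_iff₀ hm]; linarith
    have hsq : 0 < √q := Real.sqrt_pos.2 hq0
    refine (binExp_exp_half_flipGain_le hk hu h0 h1 (hq.trans (by rw [hmdef])) hq1).trans ?_
    have hpow : (√(2 * q) + ε / √q) ^ k ≤ 2 ^ k * (√(2 * q) ^ k + (ε / √q) ^ k) := by
      refine (add_pow_le (by positivity) (by positivity) k).trans ?_
      have : (2 : ℝ) ^ (k - 1) ≤ 2 ^ k := pow_le_pow_right₀ (by norm_num) (by omega)
      gcongr
    have hR1 : √(2 * q) ^ k ≤ A1 * Real.exp (lam * u) := by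
      have e1 : √(2 * q) ≤ √(2 * s) * Real.exp (q / (2 * s)) := by
        rw [Real.sqrt_le_left (by positivity), mul_pow, Real.sq_sqrt (by positivity),
          ← Real.exp_nat_mul]
        have := Real.add_one_le_exp (q / s)
        have e : ((2 : ℕ) : ℝ) * (q / (2 * s)) = q / s := by push_cast; field_simp
        rw [e]
        have hq' : q = s * (q / s) := by field_simp
        have := mul_le_mul_of_nonneg_left (this.trans' (by linarith : q / s ≤ q / s + 1)) hs0.le
        linarith only [this, hq']
      refine (pow_le_pow_left₀ (by positivity) e1 k).trans ?_
      rw [mul_pow, ← Real.exp_nat_mul, hA1, mul_assoc, ← Real.exp_add]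
      refine mul_le_mul_of_nonneg_left (Real.exp_le_exp.2 ?_) (by positivity)
      have e2 : (k : ℝ) * (q / (2 * s)) = lam * u + lam * (k / 2) := by
        rw [hq, hlam]; field_simp
      rw [e2]
      have := mul_le_mul_of_nonneg_right hlam1 hk'.le
      linarith only [this]
    have hR2 : (ε / √q) ^ k ≤ (2 * √ε) ^ k + A2 * Real.exp (-u) := by
      rcases le_or_gt (m * ε / 4) u with hc2 | hc2
      · have hqε : ε / 4 ≤ q := by rw [hq, le_div_iff₀ hm]; linarith
        have : ε / √q ≤ 2 * √ε := by
          rw [div_le_iff₀ hsq]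
          have h2 : √ε / 2 ≤ √q := by
            rw [Real.le_sqrt (by positivity) hq0.le, div_pow, Real.sq_sqrt h0]
            linarith
          have := mul_le_mul_of_nonneg_left h2 (Real.sqrt_nonneg ε)
          linarith only [this, Real.mul_self_sqrt h0]
        have h3 := pow_le_pow_left₀ (by positivity) this k
        have : 0 ≤ A2 * Real.exp (-u) := by positivity
        linarith
      · have h4 : ε / √q ≤ ε * √(2 * m / k) := by
          rw [div_eq_mul_inv, ← Real.sqrt_inv]
          refine mul_le_mul_of_nonneg_left (Real.sqrt_le_sqrt ?_) h0
          rw [hq, inv_div]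
          rw [div_le_div_iff₀ (by positivity) hk']
          have := mul_nonneg hm.le hu0
          linarith only [this]
        have h5 := pow_le_pow_left₀ (by positivity) h4 k
        have h6 : 1 ≤ Real.exp (m * ε / 4) * Real.exp (-u) := by
          rw [← Real.exp_add]; exact Real.one_le_exp (by linarith)
        have h7 : 0 ≤ (2 * √ε) ^ k := by positivity
        have h8 : 0 ≤ (ε * √(2 * m / k)) ^ k := by positivity
        have : A2 * Real.exp (-u) = (ε * √(2 * m / k)) ^ k
          * (Real.exp (m * ε / 4) * Real.exp (-u)) := by rw [hA2]; ring
        rw [this]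
        have h10 := le_mul_of_one_le_right h8 h6
        linarith only [h5, h7, h10]
    have h9 : 0 ≤ A3 * Real.exp (-Real.log s * u) := by positivity
    have e4 : (4 : ℝ) ^ k = 2 ^ k * 2 ^ k := by rw [← mul_pow]; norm_num
    rw [mul_pow, e4]
    have h2k : (0 : ℝ) < 2 ^ k := by positivity
    calc (2 : ℝ) ^ k * (√(2 * q) + ε / √q) ^ k
        ≤ 2 ^ k * (2 ^ k * (√(2 * q) ^ k + (ε / √q) ^ k)) := by gcongr
      _ ≤ 2 ^ k * (2 ^ k * (A1 * Real.exp (lam * u) + ((2 * √ε) ^ k + A2 * Real.exp (-u)))) := by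
        gcongr
      _ ≤ _ := by linarith
  · have h9 : 0 ≤ 4 ^ k * (A1 * Real.exp (lam * u) + (2 * √ε) ^ k + A2 * Real.exp (-u)) := by
      positivity
    have hlogs : Real.log s ≤ 0 := Real.log_nonpos hs0.le (by linarith)
    have : binExp k ε (fun v => Real.exp (1 / 2 * flipGain k l u v))
        ≤ binExp k ε (fun _ => Real.exp (m * Real.log 2 / 2)) := by
      refine binExp_mono h0 h1 fun v hv => Real.exp_le_exp.2 ?_
      have hv' : (v : ℝ) ≤ k := by exact_mod_cast hv
      have hv0 : (0 : ℝ) ≤ v := by positivity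
      have ha : binEntropy (((u : ℝ) + v) / (k + l)) ≤ Real.log 2 := Real.binEntropy_le_log_two
      have hb : 0 ≤ binEntropy (((u : ℝ) + k - v) / (k + l)) :=
        Real.binEntropy_nonneg (div_nonneg (by linarith) (by positivity))
          (by rw [div_le_one (by positivity)]; linarith)
      rw [flipGain, ← hmdef]
      rw [← hmdef] at ha hb
      have := mul_le_mul_of_nonneg_left (sub_le_self _ hb |>.trans ha) hm.le
      linarith only [this]
    rw [binExp_const] at this
    refine this.trans ?_
    rw [hA3, ← Real.exp_add]
    have : Real.exp (m * Real.log 2 / 2)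
        ≤ Real.exp (m * Real.log 2 / 2 + m / 4 * Real.log s + -Real.log s * u) := by
      rw [Real.exp_le_exp]
      have := mul_nonneg (neg_nonneg.2 hlogs) (by linarith : 0 ≤ u - m / 4)
      linarith only [this]
    linarith only [this, h9]

/-- For error probability at most `s`, when at most a fraction `s` of the items is flipped, the
exponential moment is at most `(C √s) ^ k`. -/
lemma gainMGF_half_le_of_small {k l : ℕ} (hk : 0 < k) {ε s : ℝ} (h0 : 0 ≤ ε) (hεs : ε ≤ s)
    (hks : (k : ℝ) ≤ s * (k + l)) (hs : s ≤ 1 / 64) :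
    gainMGF (1 / 2) k l ε ≤ (100 * √s) ^ k := by
  have hk' : (0 : ℝ) < k := by exact_mod_cast hk
  set m : ℝ := (k : ℝ) + l with hmdef
  have hm : 0 < m := by positivity
  have hs0 : 0 < s := by
    by_contra h
    have : s * m ≤ 0 := mul_nonpos_of_nonpos_of_nonneg (by linarith) hm.le
    linarith
  have h1 : ε ≤ 1 := by linarith
  have hkm : 64 * (k : ℝ) ≤ m := by nlinarith
  have hss : 0 < √s := Real.sqrt_pos.2 hs0
  have hsε : √ε ≤ √s := Real.sqrt_le_sqrt hεs
  set lam : ℝ := k / (2 * s * m) with hlam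
  have hlam0 : 0 ≤ lam := by positivity
  have hlam1 : lam ≤ 1 / 2 := by
    rw [hlam, div_le_iff₀ (by positivity)]; linarith
  set A1 : ℝ := (√(2 * s)) ^ k * Real.exp (k / 4) with hA1
  set A2 : ℝ := (ε * √(2 * m / k)) ^ k * Real.exp (m * ε / 4) with hA2
  set A3 : ℝ := Real.exp (m * Real.log 2 / 2 + m / 4 * Real.log s) with hA3
  have hpt := fun (u : ℕ) (hu : u ≤ l) =>
    binExp_exp_half_flipGain_le_sum hk h0 hεs hmdef hks hs0 hs hlam hA1 hA2 hA3 hu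
  have hfin := binExp_mono h0 h1 hpt
  simp only [binExp_add, binExp_const_mul, binExp_const] at hfin
  have hE1 : A1 * binExp l ε (fun u => Real.exp (lam * u)) ≤ (6 * √s) ^ k := by
    have hb := binExp_exp_le_two_mul (M := l) h0 h1 hlam0 (by linarith)
    have hb2 : 2 * (l * ε * lam) ≤ k := by
      have hlm : (l : ℝ) ≤ m := by rw [hmdef]; linarith
      have e : 2 * (m * s * lam) = k := by rw [hlam]; field_simp
      rw [← e]
      gcongr
    have : binExp l ε (fun u => Real.exp (lam * u)) ≤ Real.exp k :=
      hb.trans (Real.exp_le_exp.2 hb2)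
    calc A1 * binExp l ε (fun u => Real.exp (lam * u)) ≤ A1 * Real.exp k := by gcongr
      _ = (√(2 * s) * Real.exp (5 / 4)) ^ k := by
        rw [hA1, mul_pow, ← Real.exp_nat_mul, mul_assoc, ← Real.exp_add]; ring_nf
      _ ≤ _ := by
        refine pow_le_pow_left₀ (by positivity) ?_ k
        have e1 : Real.exp (5 / 4) ≤ 4 := by
          have h2 : Real.exp (5 / 4) ^ 4 = Real.exp 1 ^ 5 := by
            rw [← Real.exp_nat_mul, ← Real.exp_nat_mul]; norm_num
          have h3 : Real.exp 1 ^ 5 ≤ 4 ^ 4 :=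
            (pow_le_pow_left₀ (by positivity) Real.exp_one_lt_d9.le 5).trans (by norm_num)
          exact le_of_pow_le_pow_left₀ (by norm_num) (by norm_num) (h2.trans_le h3)
        have e2 : √2 ≤ 3 / 2 := by
          rw [Real.sqrt_le_left (by norm_num)]; norm_num
        rw [Real.sqrt_mul (by norm_num)]
        calc √2 * √s * Real.exp (5 / 4) ≤ 3 / 2 * √s * 4 := by gcongr
          _ = _ := by ring
  have hE2 : A2 * binExp l ε (fun u => Real.exp (-u)) ≤ (2 * √s) ^ k := by
    have hb := binExp_exp_neg_le (M := l) h0 h1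
    calc A2 * binExp l ε (fun u => Real.exp (-u)) ≤ A2 * Real.exp (-(3 / 5 * (l * ε))) := by gcongr
      _ ≤ (ε * √(2 * m / k)) ^ k * Real.exp (-(m * ε / 4)) := by
        rw [hA2, mul_assoc, ← Real.exp_add]
        refine mul_le_mul_of_nonneg_left (Real.exp_le_exp.2 ?_) (by positivity)
        have : m * ε ≤ 64 / 63 * (l * ε) := by
          rw [← mul_assoc]
          refine mul_le_mul_of_nonneg_right ?_ h0
          linarith
        nlinarith
      _ = (ε * √(2 * m / k) * Real.exp (-(m * ε / (4 * k)))) ^ k := by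
        rw [mul_pow _ (Real.exp _), ← Real.exp_nat_mul]
        congr 2
        field_simp
      _ ≤ _ := by
        refine pow_le_pow_left₀ (by positivity) ?_ k
        refine le_trans ?_ (mul_le_mul_of_nonneg_left hsε zero_le_two)
        rw [Real.exp_neg, ← div_eq_mul_inv, div_le_iff₀ (Real.exp_pos _)]
        have h2 : √ε * √(2 * m / k) ≤ 2 * Real.exp (m * ε / (4 * k)) := by
          rw [← Real.sqrt_mul h0, Real.sqrt_le_left (by positivity), mul_pow, ← Real.exp_nat_mul]
          have := Real.add_one_le_exp (m * ε / (2 * k))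
          have e : ((2 : ℕ) : ℝ) * (m * ε / (4 * k)) = m * ε / (2 * k) := by
            push_cast; field_simp; ring
          have e' : ε * (2 * m / k) = 4 * (m * ε / (2 * k)) := by field_simp; ring
          rw [e, e']
          linarith
        calc ε * √(2 * m / k) = √ε * (√ε * √(2 * m / k)) := by
              rw [← mul_assoc, Real.mul_self_sqrt h0]
          _ ≤ √ε * (2 * Real.exp (m * ε / (4 * k))) := by gcongr
          _ = _ := by ring
  have hE3 : A3 * binExp l ε (fun u => Real.exp (-Real.log s * u)) ≤ (8 * √s) ^ k := by
    rw [binExp_exp, Real.exp_neg, Real.exp_log hs0]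
    have h2 : ε * s⁻¹ + (1 - ε) ≤ 2 := by
      have : ε * s⁻¹ ≤ 1 := by rw [← div_eq_mul_inv, div_le_one hs0]; exact hεs
      linarith
    have h3 : (ε * s⁻¹ + (1 - ε)) ^ l ≤ Real.exp (m * Real.log 2) := by
      refine (pow_le_pow_left₀ (by have : 0 ≤ 1 - ε := by linarith
                                   positivity) h2 l).trans ?_
      rw [← Real.exp_log (zero_lt_two : (0 : ℝ) < 2), ← Real.exp_nat_mul, Real.log_exp,
        Real.exp_le_exp]
      have := Real.log_nonneg (by norm_num : (1 : ℝ) ≤ 2)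
      nlinarith
    have h64 : Real.log (64 * s) ≤ 0 := Real.log_nonpos (by positivity) (by linarith)
    have e64 : Real.log (64 * s) = 6 * Real.log 2 + Real.log s := by
      rw [Real.log_mul (by norm_num) hs0.ne', show (64 : ℝ) = 2 ^ 6 by norm_num, Real.log_pow]
      norm_num
    have e8 : 8 * √s = √(64 * s) := by
      rw [Real.sqrt_mul (by norm_num), show (64 : ℝ) = 8 ^ 2 by norm_num,
        Real.sqrt_sq (by norm_num)]
    calc A3 * (ε * s⁻¹ + (1 - ε)) ^ l ≤ A3 * Real.exp (m * Real.log 2) := by gcongr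
      _ = Real.exp (m / 4 * Real.log (64 * s)) := by
        rw [hA3, ← Real.exp_add, e64]; ring_nf
      _ ≤ Real.exp (k * (Real.log (64 * s) / 2)) := by
        rw [Real.exp_le_exp]; nlinarith
      _ = _ := by
        rw [e8, Real.exp_nat_mul, ← Real.log_sqrt (by positivity),
          Real.exp_log (by positivity)]
  have hE4 : (2 * √ε) ^ k ≤ (2 * √s) ^ k := by gcongr
  rw [gainMGF]
  refine hfin.trans ?_
  have hX : 0 ≤ √s ^ k := by positivity
  have h4k : (0 : ℝ) ≤ 4 ^ k := by positivity
  calc _ ≤ 4 ^ k * ((6 * √s) ^ k + (2 * √s) ^ k + (2 * √s) ^ k) + (8 * √s) ^ k := by gcongr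
    _ = 24 ^ k * √s ^ k + 8 ^ k * √s ^ k + 8 ^ k * √s ^ k + 8 ^ k * √s ^ k := by
      simp only [mul_pow]
      have e1 : (24 : ℝ) ^ k = 4 ^ k * 6 ^ k := by rw [← mul_pow]; norm_num
      have e2 : (8 : ℝ) ^ k = 4 ^ k * 2 ^ k := by rw [← mul_pow]; norm_num
      rw [e1, e2]; ring
    _ ≤ 25 ^ k * √s ^ k + 25 ^ k * √s ^ k + 25 ^ k * √s ^ k + 25 ^ k * √s ^ k := by
      gcongr <;> norm_num
    _ = 4 * (25 ^ k * √s ^ k) := by ring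
    _ ≤ 4 ^ k * (25 ^ k * √s ^ k) := by
      gcongr
      calc (4 : ℝ) = 4 ^ 1 := by norm_num
        _ ≤ 4 ^ k := pow_le_pow_right₀ (by norm_num) hk
    _ = _ := by
      rw [← mul_assoc, ← mul_pow, ← mul_pow]; norm_num

/-! ### Workers of error probability bounded away from zero -/

/-- The moment generating function of a sign with probability `ε` of being `1` has its minimum
`2 √(ε (1 - ε))` at `t₀ = log ((1 - ε) / ε) / 2`, and it grows at most like a Gaussian one
around that point. -/
lemma signed_mgf_le {ε : ℝ} (h0 : 0 < ε) (h1 : ε < 1) (s : ℝ) :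
    ε * Real.exp s + (1 - ε) * Real.exp (-s)
      ≤ Real.exp (1 / 2 * Real.log (4 * ε * (1 - ε))
          + (s - 1 / 2 * (Real.log (1 - ε) - Real.log ε)) ^ 2 / 2) := by
  have h1' : 0 < 1 - ε := by linarith
  set y := s - 1 / 2 * (Real.log (1 - ε) - Real.log ε) with hy
  have e4 : 1 / 2 * Real.log (4 * ε * (1 - ε))
      = Real.log 2 + 1 / 2 * (Real.log ε + Real.log (1 - ε)) := by
    rw [Real.log_mul (by positivity) h1'.ne', Real.log_mul (by norm_num) h0.ne',
      show (4 : ℝ) = 2 ^ 2 by norm_num, Real.log_pow]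
    push_cast; ring
  rw [Real.exp_add]
  refine le_trans (le_of_eq ?_) (mul_le_mul_of_nonneg_left (Real.cosh_le_exp_half_sq y)
    (Real.exp_pos _).le)
  rw [Real.cosh_eq, e4, Real.exp_add, Real.exp_log two_pos]
  have e1 : Real.exp (1 / 2 * (Real.log ε + Real.log (1 - ε))) * Real.exp y = ε * Real.exp s := by
    rw [← Real.exp_add, show 1 / 2 * (Real.log ε + Real.log (1 - ε)) + y = Real.log ε + s by
      rw [hy]; ring, Real.exp_add, Real.exp_log h0]
  have e2 : Real.exp (1 / 2 * (Real.log ε + Real.log (1 - ε))) * Real.exp (-y)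
      = (1 - ε) * Real.exp (-s) := by
    rw [← Real.exp_add, show 1 / 2 * (Real.log ε + Real.log (1 - ε)) + -y = Real.log (1 - ε) + -s by
      rw [hy]; ring, Real.exp_add, Real.exp_log h1']
  linear_combination -e1 - e2

lemma abs_log_sub_log_le {x y c : ℝ} (hc : 0 < c) (hx : c ≤ x) (hy : c ≤ y) :
    |Real.log x - Real.log y| ≤ |x - y| / c := by
  have key : ∀ {x y : ℝ}, c ≤ x → c ≤ y → Real.log x - Real.log y ≤ |x - y| / c := by
    intro x y hx hy
    have hx0 : 0 < x := hc.trans_le hx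
    have hy0 : 0 < y := hc.trans_le hy
    rw [← Real.log_div hx0.ne' hy0.ne']
    refine (Real.log_le_sub_one_of_pos (by positivity)).trans ?_
    have : x / y - 1 = (x - y) / y := by field_simp
    rw [this]
    exact (div_le_div_of_nonneg_right (le_abs_self _) hy0.le).trans (by gcongr)
  rw [abs_sub_le_iff]
  exact ⟨key hx hy, by rw [abs_sub_comm]; exact key hy hx⟩

lemma log_odds_sub_sq_le {ε₀ ε q : ℝ} (h0 : 0 < ε₀) (hε₀ : ε₀ ≤ 1 / 2) (hε : ε₀ ≤ ε)
    (hε1 : ε ≤ 1 / 2) (hq : |q - ε| ≤ ε₀ / 2) :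
    (1 / 2 * (Real.log (1 - q) - Real.log q) - 1 / 2 * (Real.log (1 - ε) - Real.log ε)) ^ 2
      ≤ 4 / ε₀ ^ 2 * (q - ε) ^ 2 := by
  have hq' := abs_le.1 hq
  have h1 := abs_log_sub_log_le (c := 1 / 4) (x := 1 - q) (y := 1 - ε) (by norm_num)
    (by linarith) (by linarith)
  have h2 := abs_log_sub_log_le (c := ε₀ / 2) (x := q) (y := ε) (by positivity)
    (by linarith) (by linarith)
  rw [show 1 - q - (1 - ε) = -(q - ε) by ring, abs_neg] at h1
  have h3 : |q - ε| / (1 / 4) ≤ 2 / ε₀ * |q - ε| := by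
    rw [div_eq_inv_mul]
    refine mul_le_mul_of_nonneg_right ?_ (abs_nonneg _)
    rw [le_div_iff₀ h0]; norm_num; linarith
  have h4 : |q - ε| / (ε₀ / 2) = 2 / ε₀ * |q - ε| := by field_simp
  have h5 : |1 / 2 * (Real.log (1 - q) - Real.log q) - 1 / 2 * (Real.log (1 - ε) - Real.log ε)|
      ≤ 2 / ε₀ * |q - ε| := by
    have : 1 / 2 * (Real.log (1 - q) - Real.log q) - 1 / 2 * (Real.log (1 - ε) - Real.log ε)
        = 1 / 2 * ((Real.log (1 - q) - Real.log (1 - ε)) - (Real.log q - Real.log ε)) := by ring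
    rw [this, abs_mul, abs_of_pos (by norm_num : (0 : ℝ) < 1 / 2)]
    have := abs_sub (Real.log (1 - q) - Real.log (1 - ε)) (Real.log q - Real.log ε)
    linarith
  calc _ = |1 / 2 * (Real.log (1 - q) - Real.log q) - 1 / 2 * (Real.log (1 - ε) - Real.log ε)| ^ 2 :=
        (sq_abs _).symm
    _ ≤ (2 / ε₀ * |q - ε|) ^ 2 := pow_le_pow_left₀ (abs_nonneg _) h5 2
    _ = _ := by rw [mul_pow, sq_abs, div_pow]; norm_num

/-- The moment over the flipped items, given that the frequency of wrong answers outside them is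
close to its mean. -/
lemma binExp_exp_half_flipGain_le_of_near {k l u : ℕ} (hk : 0 < k) (hu : u ≤ l) {ε₀ ε q : ℝ}
    (h0 : 0 < ε₀) (hε₀ : ε₀ ≤ 1 / 2) (hε : ε₀ ≤ ε) (hε1 : ε ≤ 1 / 2)
    (hkl : 8 * (k : ℝ) ≤ ε₀ * (k + l)) (hq : q = (u + k / 2) / (k + l)) (hqε : |q - ε| ≤ ε₀ / 2) :
    binExp k ε (fun v => Real.exp (1 / 2 * flipGain k l u v))
      ≤ Real.exp (k * (1 / 2 * Real.log (4 * ε * (1 - ε))) + k * (4 / ε₀ ^ 2 * (q - ε) ^ 2))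
        * Real.exp (4 * (k / (k + l)) / ε₀) := by
  have hk' : (0 : ℝ) < k := by exact_mod_cast hk
  have hm : (0 : ℝ) < k + l := by positivity
  have hq' := abs_le.1 hqε
  have hεp : 0 < ε := by linarith
  have hqp : 0 < q := by linarith
  have hq1 : q < 1 := by linarith
  set t := 1 / 2 * (Real.log (1 - q) - Real.log q) with ht
  set t₀ := 1 / 2 * (Real.log (1 - ε) - Real.log ε) with ht₀
  have htt := log_odds_sub_sq_le h0 hε₀ hε hε1 hqε
  rw [← ht, ← ht₀] at htt
  set L := 1 / 2 * Real.log (4 * ε * (1 - ε)) with hL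
  set c : ℝ := 1 / ((k + l) * ε₀) with hc
  have hc0 : 0 ≤ c := by positivity
  have hpt : ∀ v ≤ k, Real.exp (1 / 2 * flipGain k l u v)
      ≤ Real.exp (t * (2 * v - k)) * Real.exp (c * (2 * v - k) ^ 2) := by
    intro v hv
    rw [← Real.exp_add, Real.exp_le_exp]
    have h := flipGain_le_midpoint hk hu hv hq hq1
    have h2 : ((k : ℝ) - 2 * v) ^ 2 / (8 * (k + l) * (q * (1 - q))) ≤ c * (2 * v - k) ^ 2 := by
      rw [hc, one_div, ← div_eq_inv_mul, show ((k : ℝ) - 2 * v) ^ 2 = (2 * v - k) ^ 2 by ring]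
      refine div_le_div_of_nonneg_left (sq_nonneg _) (by positivity) ?_
      have : ε₀ ≤ 8 * (q * (1 - q)) := by nlinarith
      nlinarith
    have h3 : ((v : ℝ) - k / 2) * (Real.log (1 - q) - Real.log q) = t * (2 * v - k) := by
      rw [ht]; ring
    linarith
  have hmgf : ∀ s : ℝ, binExp k ε (fun v => Real.exp (t * (2 * v - k)) * Real.exp (s * (2 * v - k)))
      ≤ Real.exp (k * L + k * (t - t₀) ^ 2) * Real.exp (k * s ^ 2) := by
    intro s
    have e : ∀ v : ℕ, Real.exp (t * (2 * v - k)) * Real.exp (s * (2 * v - k))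
        = Real.exp (-(t + s)) ^ k * Real.exp (2 * (t + s) * v) := by
      intro v
      rw [← Real.exp_add, ← Real.exp_nat_mul, ← Real.exp_add]; ring_nf
    simp_rw [e]
    rw [binExp_const_mul, binExp_exp, ← mul_pow]
    have e2 : Real.exp (-(t + s)) * (ε * Real.exp (2 * (t + s)) + (1 - ε))
        = ε * Real.exp (t + s) + (1 - ε) * Real.exp (-(t + s)) := by
      have : Real.exp (-(t + s)) * Real.exp (2 * (t + s)) = Real.exp (t + s) := by
        rw [← Real.exp_add]; ring_nf
      linear_combination ε * this
    rw [e2]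
    have h1ε : 0 ≤ 1 - ε := by linarith
    refine (pow_le_pow_left₀ (by positivity) (signed_mgf_le hεp (by linarith) (t + s)) k).trans ?_
    rw [← ht₀, ← hL, ← Real.exp_nat_mul, ← Real.exp_add, Real.exp_le_exp]
    have : (t + s - t₀) ^ 2 / 2 ≤ (t - t₀) ^ 2 + s ^ 2 := by nlinarith [sq_nonneg (t - t₀ - s)]
    have := mul_le_mul_of_nonneg_left this hk'.le
    linarith
  refine (binExp_mono hεp.le (by linarith) hpt).trans ?_
  have h8 : 8 * (k : ℝ) * c ≤ 1 := by
    rw [hc, mul_one_div, div_le_one (by positivity)]; linarith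
  refine (binExp_exp_sq_le (Real.exp_pos _).le hk'.le hc0 h8 hmgf).trans ?_
  have e : 4 * (k : ℝ) * c = 4 * (k / (k + l)) / ε₀ := by rw [hc]; field_simp
  rw [e]
  refine mul_le_mul_of_nonneg_right (Real.exp_le_exp.2 ?_) (Real.exp_pos _).le
  have := mul_le_mul_of_nonneg_left htt hk'.le
  linarith

/-- A pointwise bound, in the number `u` of wrong answers outside the flipped set, by functions
of the deviation of `u` from its mean. The second one is active for large deviations only, where
the bound on the gain is crude. -/
lemma binExp_exp_half_flipGain_le_interior {k l u : ℕ} (hk : 0 < k) (hu : u ≤ l)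
    {ε₀ ε κ δ m a d L X c₂ : ℝ} (h0 : 0 < ε₀) (hε₀ : ε₀ ≤ 1 / 2) (hε : ε₀ ≤ ε) (hε1 : ε ≤ 1 / 2)
    (hκ : κ = ε₀ ^ 2 / 32)
    (hcont : ∀ x ∈ Set.Icc (0 : ℝ) 1, ∀ y ∈ Set.Icc (0 : ℝ) 1, dist x y < δ →
      dist (binEntropy x) (binEntropy y) < 2 * κ)
    (hmdef : m = (k : ℝ) + l) (ha : a = k / m) (ha1 : a ≤ ε₀ ^ 2 / 8) (ha3 : a ≤ δ / 2)
    (hd : d = 1 - 2 * ε) (hL : L = 1 / 2 * Real.log (4 * ε * (1 - ε)))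
    (hX : X = 4 * a / ε₀ + 2 / ε₀ ^ 2 * (k * a ^ 2 * d ^ 2)) (hc₂ : c₂ = 8 * a / (ε₀ ^ 2 * m)) :
    binExp k ε (fun v => Real.exp (1 / 2 * flipGain k l u v))
      ≤ Real.exp (k * L + X) * Real.exp (c₂ * (u - l * ε) ^ 2)
        + Real.exp (-(κ * m)) * Real.exp (1 / m * (u - l * ε) ^ 2) := by
  have hk' : (0 : ℝ) < k := by exact_mod_cast hk
  have hm : 0 < m := by rw [hmdef]; positivity
  have ha0 : 0 < a := by rw [ha]; positivity
  have hka : (k : ℝ) = a * m := by rw [ha]; field_simp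
  have hε₀2 : ε₀ ^ 2 ≤ ε₀ / 2 := by nlinarith only [h0, hε₀]
  have hεp : 0 < ε := by linarith
  have hε1' : ε ≤ 1 := by linarith
  have hd0 : 0 ≤ d := by rw [hd]; linarith
  have hd1 : d ≤ 1 := by rw [hd]; linarith
  have hu' : (u : ℝ) ≤ l := by exact_mod_cast hu
  set q : ℝ := (u + k / 2) / (k + l) with hq
  have hqe : q - ε = (u - l * ε) / m + a * d / 2 := by
    rw [hq, ← hmdef, ha, hd]; field_simp; rw [hmdef]; ring
  rcases le_or_gt |q - ε| (ε₀ / 2) with hc | hc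
  · have h := binExp_exp_half_flipGain_le_of_near hk hu h0 hε₀ hε hε1
      (by rw [← hmdef, hka]; nlinarith) hq hc
    have h2 : (0 : ℝ) ≤ Real.exp (-(κ * m)) * Real.exp (1 / m * (u - l * ε) ^ 2) := by positivity
    refine (h.trans ?_).trans (le_add_of_nonneg_right h2)
    rw [← Real.exp_add, ← Real.exp_add, Real.exp_le_exp, ← hL, ← hmdef, ← ha]
    have h3 : (q - ε) ^ 2 ≤ 2 * ((u - l * ε) / m) ^ 2 + a ^ 2 * d ^ 2 / 2 := by
      rw [hqe]; nlinarith only [sq_nonneg ((u - l * ε) / m - a * d / 2)]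
    have h4 : k * (4 / ε₀ ^ 2 * (q - ε) ^ 2)
        ≤ k * (4 / ε₀ ^ 2 * (2 * ((u - l * ε) / m) ^ 2 + a ^ 2 * d ^ 2 / 2)) := by gcongr
    have h5 : k * (4 / ε₀ ^ 2 * (2 * ((u - l * ε) / m) ^ 2 + a ^ 2 * d ^ 2 / 2))
        = c₂ * (u - l * ε) ^ 2 + 2 / ε₀ ^ 2 * (k * a ^ 2 * d ^ 2) := by
      rw [hc₂, ha]; field_simp; ring
    rw [hX]
    linarith only [h4, h5]
  · have h2 : (0 : ℝ) ≤ Real.exp (k * L + X) * Real.exp (c₂ * (u - l * ε) ^ 2) := by positivity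
    refine le_trans ?_ (le_add_of_nonneg_left h2)
    have h3 : binExp k ε (fun v => Real.exp (1 / 2 * flipGain k l u v))
        ≤ binExp k ε (fun _ => Real.exp (κ * m)) := by
      refine binExp_mono hεp.le hε1' fun v hv => Real.exp_le_exp.2 ?_
      have hv' : (v : ℝ) ≤ k := by exact_mod_cast hv
      have hv0 : (0 : ℝ) ≤ v := by positivity
      have hu0 : (0 : ℝ) ≤ u := by positivity
      have hdist : dist (((u : ℝ) + v) / m) ((u + k - v) / m) < δ := by
        rw [Real.dist_eq, ← sub_div, abs_div, abs_of_pos hm, div_lt_iff₀ hm]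
        have : |(u : ℝ) + v - (u + k - v)| ≤ k := by rw [abs_le]; constructor <;> linarith
        refine this.trans_lt ?_
        rw [hka]
        have : a < δ := by linarith
        exact mul_lt_mul_of_pos_right this hm
      have := hcont (((u : ℝ) + v) / m)
        ⟨by positivity, by rw [div_le_one hm]; linarith⟩ ((u + k - v) / m)
        ⟨div_nonneg (by linarith) hm.le, by rw [div_le_one hm]; linarith⟩ hdist
      rw [Real.dist_eq] at this
      have := (le_abs_self _).trans this.le
      rw [flipGain, ← hmdef]
      have := mul_le_mul_of_nonneg_left this hm.le
      linarith only [this]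
    rw [binExp_const] at h3
    refine h3.trans ?_
    rw [← Real.exp_add, Real.exp_le_exp]
    have h4 : ε₀ / 4 ≤ |(u - l * ε) / m| := by
      rw [hqe] at hc
      have h5 := abs_add_le ((u - l * ε) / m) (a * d / 2)
      have h6 : |a * d / 2| ≤ ε₀ / 4 := by
        rw [abs_of_nonneg (by positivity)]; nlinarith only [ha1, hd1, hd0, ha0, hε₀2, h0]
      linarith only [hc, h5, h6]
    have h5 : ε₀ ^ 2 / 16 ≤ ((u - l * ε) / m) ^ 2 := by
      rw [← sq_abs ((u - l * ε) / m)]; nlinarith only [h4, h0]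
    have h6 : 1 / m * (u - l * ε) ^ 2 = m * ((u - l * ε) / m) ^ 2 := by field_simp
    have h7 := mul_le_mul_of_nonneg_left h5 hm.le
    rw [h6]
    have : m * (ε₀ ^ 2 / 16) = 2 * (κ * m) := by rw [hκ]; ring
    linarith only [h7, this]

lemma exp_neg_le_bhattacharyya_pow {k : ℕ} (hk : 0 < k) {ε₀ ε κ m a L : ℝ} (h0 : 0 < ε₀)
    (hε : ε₀ ≤ ε) (hε1 : ε ≤ 1 / 2) (hκ0 : 0 < κ) (hm : 0 < m) (ha0 : 0 < a)
    (hka : (k : ℝ) = a * m) (ha2 : a ≤ 2 * ε₀ * κ)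
    (hL : L = 1 / 2 * Real.log (4 * ε * (1 - ε))) :
    Real.exp (-(κ * m)) * Real.exp 1 ≤ Real.exp (k * L) * (6 * a / κ) := by
  have hk' : (0 : ℝ) < k := by exact_mod_cast hk
  have hk1 : (1 : ℝ) ≤ k := by exact_mod_cast hk
  have h1 : -(κ * m / 2) ≤ k * L := by
    have h2 : -(1 / (2 * ε₀)) ≤ Real.log (4 * ε * (1 - ε)) := by
      have h3 : 2 * ε₀ ≤ 4 * ε * (1 - ε) := by nlinarith only [hε, hε1, h0]
      have h4 := Real.one_sub_inv_le_log_of_pos (by positivity : (0 : ℝ) < 2 * ε₀)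
      have h5 := Real.log_le_log (by positivity) h3
      rw [← one_div] at h4
      linarith
    have h3 : k * (1 / (2 * ε₀)) ≤ κ * m := by
      rw [hka, mul_one_div, div_le_iff₀ (by positivity)]
      nlinarith only [mul_le_mul_of_nonneg_right ha2 hm.le]
    have h4 := mul_le_mul_of_nonneg_left h2 hk'.le
    rw [hL]
    linarith only [h3, h4]
  have h5 : Real.exp (-(κ * m / 2)) ≤ 2 * a / κ := by
    have h6 := Real.add_one_le_exp (κ * m / 2)
    rw [Real.exp_neg, inv_le_comm₀ (Real.exp_pos _) (by positivity), inv_div]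
    refine le_trans ?_ h6
    have : κ / (2 * a) ≤ κ * m / 2 := by
      rw [div_le_div_iff₀ (by positivity) (by norm_num)]
      have : κ ≤ κ * (a * m) := by rw [← hka]; nlinarith only [hκ0, hk1]
      linarith only [this]
    linarith only [this]
  have h7 : Real.exp 1 ≤ 3 := by linarith [Real.exp_one_lt_d9]
  calc Real.exp (-(κ * m)) * Real.exp 1
      = Real.exp (-(κ * m / 2)) * (Real.exp (-(κ * m / 2)) * Real.exp 1) := by
        rw [← Real.exp_add, ← Real.exp_add, ← Real.exp_add]; ring_nf
    _ ≤ Real.exp (k * L) * (2 * a / κ * 3) := by gcongr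
    _ = _ := by ring

/-- The exponential moment of order `1/2` of a worker whose error probability is bounded away
from `0`: up to lower order terms it is the `k`-th power of the Bhattacharyya coefficient
`2 √(ε (1 - ε))`. -/
lemma exists_gainMGF_half_le_of_interior {ε₀ : ℝ} (h0 : 0 < ε₀) (hε₀ : ε₀ ≤ 1 / 2) :
    ∃ a₁ > 0, ∃ C ≥ 0, ∀ (k l : ℕ) (ε : ℝ), 0 < k → (k : ℝ) ≤ a₁ * (k + l) → ε₀ ≤ ε → ε ≤ 1 / 2 →
      gainMGF (1 / 2) k l ε ≤ Real.exp (k * (1 / 2 * Real.log (4 * ε * (1 - ε)))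
        + C * (k / (k + l)) + C * (k * (k / (k + l)) ^ 2 * (1 - 2 * ε) ^ 2)) := by
  set κ : ℝ := ε₀ ^ 2 / 32 with hκ
  have hκ0 : 0 < κ := by positivity
  -- away from its mean, the crude bound on the gain comes from the continuity of the entropy
  obtain ⟨δ, hδ, hcont⟩ := Metric.uniformContinuousOn_iff.1
    (isCompact_Icc.uniformContinuousOn_of_continuous
      (Real.binEntropy_continuous.continuousOn (s := Set.Icc (0 : ℝ) 1))) (2 * κ) (by positivity)
  refine ⟨min (min (ε₀ ^ 2 / 8) (2 * ε₀ * κ)) (δ / 2), by positivity,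
    4 / ε₀ + 10 / ε₀ ^ 2 + 6 / κ, by positivity, ?_⟩
  intro k l ε hk hkl hε hε1
  have hk' : (0 : ℝ) < k := by exact_mod_cast hk
  have hk1 : (1 : ℝ) ≤ k := by exact_mod_cast hk
  set m : ℝ := (k : ℝ) + l with hmdef
  have hm : 0 < m := by positivity
  have hlm : (l : ℝ) ≤ m := by rw [hmdef]; linarith
  set a : ℝ := k / m with ha
  have ha0 : 0 < a := by positivity
  have hka : (k : ℝ) = a * m := by rw [ha]; field_simp
  have haA : a ≤ min (min (ε₀ ^ 2 / 8) (2 * ε₀ * κ)) (δ / 2) := by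
    rw [ha, div_le_iff₀ hm]; exact hkl
  have ha1 : a ≤ ε₀ ^ 2 / 8 := haA.trans ((min_le_left _ _).trans (min_le_left _ _))
  have ha2 : a ≤ 2 * ε₀ * κ := haA.trans ((min_le_left _ _).trans (min_le_right _ _))
  have ha3 : a ≤ δ / 2 := haA.trans (min_le_right _ _)
  have hε₀2 : ε₀ ^ 2 ≤ ε₀ / 2 := by nlinarith
  have hεp : 0 < ε := by linarith
  have hε1' : ε ≤ 1 := by linarith
  set L := 1 / 2 * Real.log (4 * ε * (1 - ε)) with hL
  set d := 1 - 2 * ε with hd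
  have hd0 : 0 ≤ d := by rw [hd]; linarith
  have hd1 : d ≤ 1 := by rw [hd]; linarith
  set X := 4 * a / ε₀ + 2 / ε₀ ^ 2 * (k * a ^ 2 * d ^ 2) with hX
  set c₂ := 8 * a / (ε₀ ^ 2 * m) with hc₂
  have hpt := fun (u : ℕ) (hu : u ≤ l) => binExp_exp_half_flipGain_le_interior hk hu h0 hε₀ hε hε1
    hκ hcont hmdef ha ha1 ha3 hd hL hX hc₂
  have hfin := binExp_mono (M := l) hεp.le hε1' hpt
  rw [binExp_add, binExp_const_mul, binExp_const_mul] at hfin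
  have hc₂l : l * c₂ ≤ 8 * a / ε₀ ^ 2 := by
    rw [hc₂]
    calc (l : ℝ) * (8 * a / (ε₀ ^ 2 * m)) ≤ m * (8 * a / (ε₀ ^ 2 * m)) := by gcongr
      _ = _ := by field_simp
  have hc₂1 : l * c₂ ≤ 1 := by
    refine hc₂l.trans ?_
    rw [div_le_one (by positivity)]; linarith
  have hE1 := binExp_exp_sq_centered_le (M := l) hεp.le hε1' (c := c₂) (by positivity) hc₂1
  have hl1 : (l : ℝ) * (1 / m) ≤ 1 := by
    rw [mul_one_div, div_le_one hm]; exact hlm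
  have hE2 := (binExp_exp_sq_centered_le (M := l) hεp.le hε1' (c := 1 / m) (by positivity)
    hl1).trans (Real.exp_le_exp.2 hl1)
  have hE1' := hE1.trans (Real.exp_le_exp.2 hc₂l)
  set Y := X + 8 * a / ε₀ ^ 2 with hY
  have hY0 : 0 ≤ Y := by positivity
  have hoff := exp_neg_le_bhattacharyya_pow hk h0 hε hε1 hκ0 hm ha0 hka ha2 hL
  rw [gainMGF]
  have hb : 0 ≤ 6 * a / κ := by positivity
  calc _ ≤ Real.exp (k * L + X) * Real.exp (8 * a / ε₀ ^ 2)
          + Real.exp (-(κ * m)) * Real.exp 1 := by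
        refine hfin.trans ?_
        gcongr
    _ ≤ Real.exp (k * L) * Real.exp Y + Real.exp (k * L) * (6 * a / κ) := by
        refine add_le_add (le_of_eq ?_) hoff
        rw [← Real.exp_add, ← Real.exp_add, hY]; ring_nf
    _ ≤ Real.exp (k * L) * (Real.exp Y * Real.exp (6 * a / κ)) := by
        rw [← mul_add]
        refine mul_le_mul_of_nonneg_left ?_ (Real.exp_pos _).le
        have h1 := Real.one_le_exp hY0
        have h2 := Real.add_one_le_exp (6 * a / κ)
        nlinarith
    _ ≤ _ := by
        rw [← Real.exp_add, ← Real.exp_add, Real.exp_le_exp, hY, hX]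
        have hW : 0 ≤ k * a ^ 2 * d ^ 2 := by positivity
        have e : (4 / ε₀ + 10 / ε₀ ^ 2 + 6 / κ) * a + (4 / ε₀ + 10 / ε₀ ^ 2 + 6 / κ) *
          (k * a ^ 2 * d ^ 2) - (4 * a / ε₀ + 2 / ε₀ ^ 2 * (k * a ^ 2 * d ^ 2) + 8 * a / ε₀ ^ 2
            + 6 * a / κ) = 2 / ε₀ ^ 2 * a + (4 / ε₀ + 8 / ε₀ ^ 2 + 6 / κ) * (k * a ^ 2 * d ^ 2) := by
          ring
        have : 0 ≤ 2 / ε₀ ^ 2 * a + (4 / ε₀ + 8 / ε₀ ^ 2 + 6 / κ) * (k * a ^ 2 * d ^ 2) := by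
          positivity
        linarith only [e, this]

/-- The exponential moment of order `1/2` for arbitrary error probabilities. The loss `C k / m`
in the exponent is summable over `n ≤ m` workers to `O(k)`. -/
lemma exists_gainMGF_half_le :
    ∃ a₁ > 0, a₁ ≤ Real.exp (-80) ∧ ∃ C ≥ 0, ∀ (k l : ℕ) (ε : ℝ), 0 < k →
      (k : ℝ) ≤ a₁ * (k + l) → 0 ≤ ε → ε ≤ 1 / 2 →
      gainMGF (1 / 2) k l ε ≤ Real.exp (k * (7 / 16 * Real.log (max (4 * ε * (1 - ε)) (k / (k + l))))
        + C * (k / (k + l))) := by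
  have h80 : Real.exp (-80) ≤ 1 / 64 := by
    have := Real.add_one_le_exp (80 : ℝ)
    rw [Real.exp_neg, inv_le_comm₀ (Real.exp_pos _) (by norm_num)]
    norm_num; linarith
  obtain ⟨a₁, ha₁, C, hC, h⟩ := exists_gainMGF_half_le_of_interior (Real.exp_pos (-80)) (by linarith)
  refine ⟨min (min a₁ (Real.exp (-80))) (1 / (4 * (C + 1))), by positivity,
    (min_le_left _ _).trans (min_le_right _ _), C, hC, ?_⟩
  intro k l ε hk hkl hε hε1
  have hk' : (0 : ℝ) < k := by exact_mod_cast hk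
  have hm : (0 : ℝ) < k + l := by positivity
  set a : ℝ := k / (k + l) with ha
  have ha0 : 0 < a := by positivity
  have haA : a ≤ min (min a₁ (Real.exp (-80))) (1 / (4 * (C + 1))) := by
    rw [ha, div_le_iff₀ hm]; exact hkl
  have ha1 : a ≤ a₁ := haA.trans ((min_le_left _ _).trans (min_le_left _ _))
  have ha2 : a ≤ Real.exp (-80) := haA.trans ((min_le_left _ _).trans (min_le_right _ _))
  have ha3 : a ≤ 1 / (4 * (C + 1)) := haA.trans (min_le_right _ _)
  have hka : (k : ℝ) = a * (k + l) := by rw [ha]; field_simp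
  -- For `ε ≤ exp (-80)` the constant `100` is absorbed by the gap between `√s` and `s ^ (7 / 16)`;
  -- otherwise that gap absorbs the term with `(1 - 2ε)²`, which is at most `-log (4ε(1 - ε))`.
  rcases le_or_gt ε (Real.exp (-80)) with hc | hc
  · set s := max ε a with hs
    have hs0 : 0 < s := lt_max_of_lt_right ha0
    have hs80 : s ≤ Real.exp (-80) := max_le hc ha2
    have hsm := gainMGF_half_le_of_small (l := l) hk hε (le_max_left ε a)
      (hka.le.trans (mul_le_mul_of_nonneg_right (le_max_right _ _) hm.le)) (hs80.trans h80)
    refine hsm.trans ?_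
    rw [← Real.exp_log (show 0 < 100 * √s by positivity), ← Real.exp_nat_mul, Real.exp_le_exp,
      Real.log_mul (by norm_num) (by positivity), Real.log_sqrt hs0.le]
    have hlog100 : Real.log 100 ≤ 5 := by
      rw [Real.log_le_iff_le_exp (by norm_num)]
      have : (2.7 : ℝ) ^ 5 ≤ Real.exp 1 ^ 5 :=
        pow_le_pow_left₀ (by norm_num) (by linarith [Real.exp_one_gt_d9]) 5
      rw [← Real.exp_nat_mul] at this
      norm_num at this ⊢
      linarith
    have hlogs : Real.log s ≤ -80 := by
      rw [← Real.log_exp (-80)]; exact Real.log_le_log hs0 hs80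
    have hmono : Real.log s ≤ Real.log (max (4 * ε * (1 - ε)) a) := by
      refine Real.log_le_log hs0 (max_le_max ?_ le_rfl)
      nlinarith
    have : Real.log 100 + Real.log s / 2 ≤ 7 / 16 * Real.log (max (4 * ε * (1 - ε)) a) := by
      linarith
    have := mul_le_mul_of_nonneg_left this hk'.le
    have : 0 ≤ C * a := by positivity
    linarith
  · have hεp : 0 < ε := (Real.exp_pos _).trans hc
    refine (h k l ε hk (hka.le.trans (mul_le_mul_of_nonneg_right ha1 hm.le)) hc.le hε1).trans ?_
    rw [← ha, Real.exp_le_exp]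
    set y := 4 * ε * (1 - ε) with hy
    have hy0 : 0 < y := by
      have : 0 < 1 - ε := by linarith
      positivity
    have hdy : (1 - 2 * ε) ^ 2 ≤ -Real.log y := by
      have := Real.log_le_sub_one_of_pos hy0
      have e : (1 - 2 * ε) ^ 2 = 1 - y := by rw [hy]; ring
      linarith
    have hCa : C * a ^ 2 ≤ 1 / 16 := by
      have h1 : a * (4 * (C + 1)) ≤ 1 := by rwa [le_div_iff₀ (by positivity)] at ha3
      have h2 : 0 ≤ C * a := by positivity
      have h3 : C * a * a ≤ 1 / 4 * (1 / 4) :=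
        mul_le_mul (by linarith only [h1, ha0]) (by linarith only [h1, h2]) ha0.le (by norm_num)
      linarith only [h3]
    have h1 : C * (k * a ^ 2 * (1 - 2 * ε) ^ 2) ≤ k * (1 / 16 * -Real.log y) := by
      have h2 : C * a ^ 2 * (1 - 2 * ε) ^ 2 ≤ 1 / 16 * -Real.log y :=
        mul_le_mul hCa hdy (sq_nonneg _) (by norm_num)
      have := mul_le_mul_of_nonneg_left h2 hk'.le
      linarith
    have h3 : Real.log y ≤ Real.log (max y a) := Real.log_le_log hy0 (le_max_left _ _)
    have := mul_le_mul_of_nonneg_left h3 hk'.le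
    linarith

/-! ### The law of the sets of wrong answers -/

/-- For a random set with independent elements, the numbers of elements outside and inside `S` are
independent binomial variables. -/
lemma sum_finset_sdiff_inter {m : ℕ} (S : Finset (Fin m)) (ε : ℝ) (G : ℕ → ℕ → ℝ) :
    ∑ T : Finset (Fin m), ε ^ T.card * (1 - ε) ^ (m - T.card) * G (T \ S).card (T ∩ S).card
      = binExp (m - S.card) ε fun u => binExp S.card ε fun v => G u v := by
  have hcard : Sᶜ.card = m - S.card := by rw [Finset.card_compl, Fintype.card_fin]
  have hS : S.card ≤ m := by simpa using Finset.card_le_univ S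
  have h1 : ∀ (A : Finset (Fin m)) (f : ℕ → ℝ), ∑ T ∈ A.powerset, ε ^ T.card
      * (1 - ε) ^ (A.card - T.card) * f T.card = binExp A.card ε f := by
    intro A f
    rw [Finset.sum_powerset_apply_card (fun c => ε ^ c * (1 - ε) ^ (A.card - c) * f c), binExp]
    refine Finset.sum_congr rfl fun v _ => ?_
    rw [nsmul_eq_mul]; ring
  rw [← hcard, ← h1]
  simp_rw [← h1 S, Finset.mul_sum]
  rw [← Finset.sum_product']
  refine Finset.sum_nbij' (fun T => (T \ S, T ∩ S)) (fun p => p.1 ∪ p.2) ?_ ?_ ?_ ?_ ?_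
  · intro T _
    simp only [Finset.mem_product, Finset.mem_powerset]
    refine ⟨fun x hx => ?_, Finset.inter_subset_right⟩
    simpa using (Finset.mem_sdiff.1 hx).2
  · intro p _; exact Finset.mem_univ _
  · intro T _; exact Finset.sdiff_union_inter T S
  · rintro ⟨A, B⟩ h
    simp only [Finset.mem_product, Finset.mem_powerset] at h
    have hA : ∀ x ∈ A, x ∉ S := fun x hx => by simpa using h.1 hx
    ext x
    · simp only [Finset.mem_sdiff, Finset.mem_union]
      exact ⟨fun hx => hx.1.resolve_right fun hB => hx.2 (h.2 hB), fun hx => ⟨Or.inl hx, hA x hx⟩⟩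
    · simp only [Finset.mem_inter, Finset.mem_union]
      exact ⟨fun hx => hx.1.resolve_left fun hA' => hA x hA' hx.2, fun hx => ⟨Or.inr hx, h.2 hx⟩⟩
  · intro T _
    have e := Finset.card_sdiff_add_card_inter T S
    have b1 : (T ∩ S).card ≤ S.card := Finset.card_le_card Finset.inter_subset_right
    have b2 : (T \ S).card ≤ Sᶜ.card := Finset.card_le_card fun x hx => by
      simpa using (Finset.mem_sdiff.1 hx).2
    have e2 : m - T.card = (Sᶜ.card - (T \ S).card) + (S.card - (T ∩ S).card) := by omega
    rw [e2, ← e, pow_add, pow_add]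
    ring

noncomputable section

/-- The gain in the profile log-likelihood `-m ∑ᵢ h(Nᵢ / m)` when the labels of the items in `S`
are flipped; `T i` is the set of items on which worker `i` is wrong with respect to the original
labels, so that `symmDiff (T i) S` is the corresponding set for the flipped labels. -/
def gain {n m : ℕ} (S : Finset (Fin m)) (T : Fin n → Finset (Fin m)) : ℝ :=
  ∑ i, (m : ℝ) * (binEntropy ((T i).card / m) - binEntropy ((symmDiff (T i) S).card / m))

/-- The set of items on which worker `i` gives a wrong answer. -/
def wrongSet {n m : ℕ} (x : Fin n → Fin m → Bool) (yTrue : Fin m → Bool) (i : Fin n) :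
    Finset (Fin m) :=
  Finset.univ.filter fun j => x i j ≠ yTrue j

end

lemma sum_exp_gain_eq_gainMGF {m : ℕ} (S : Finset (Fin m)) (θ ε : ℝ) :
    ∑ T : Finset (Fin m), ε ^ T.card * (1 - ε) ^ (m - T.card)
      * Real.exp (θ * (m * (binEntropy (T.card / m) - binEntropy ((symmDiff T S).card / m))))
      = gainMGF θ S.card (m - S.card) ε := by
  rw [gainMGF, ← sum_finset_sdiff_inter]
  refine Finset.sum_congr rfl fun T _ => ?_
  congr 2
  have hS : S.card ≤ m := by simpa using Finset.card_le_univ S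
  have e := Finset.card_sdiff_add_card_inter T S
  have e1 := Finset.card_sdiff_add_card_inter S T
  have e2 : (symmDiff T S).card = (T \ S).card + (S \ T).card := by
    rw [symmDiff_def, Finset.sup_eq_union, Finset.card_union_of_disjoint]
    exact disjoint_sdiff_sdiff
  rw [Finset.inter_comm S T] at e1
  have hm : (S.card : ℝ) + ((m - S.card : ℕ) : ℝ) = m := by
    rw [Nat.cast_sub hS]; ring
  have hT : ((T \ S).card : ℝ) + (T ∩ S).card = T.card := by exact_mod_cast e
  have hd : ((T \ S).card : ℝ) + S.card - (T ∩ S).card = (symmDiff T S).card := by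
    rw [e2, ← e1]; push_cast; ring
  rw [flipGain, hm, hT, hd]

section Law

variable {Ω : Type*} [MeasurableSpace Ω] {P : Measure Ω} [IsProbabilityMeasure P] {n m : ℕ}
  {X : Fin n → Fin m → Ω → Bool} {pTrue : Fin n → ℝ} {yTrue : Fin m → Bool}

lemma IsOneCoinModel.real_wrongSet_eq (h : IsOneCoinModel P X pTrue yTrue)
    (T : Fin n → Finset (Fin m)) :
    P.real {ω | wrongSet (fun i j => X i j ω) yTrue = T}
      = ∏ i, (1 - pTrue i) ^ (T i).card * (1 - (1 - pTrue i)) ^ (m - (T i).card) := by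
  set b : Fin n × Fin m → Bool := fun ij => if ij.2 ∈ T ij.1 then !yTrue ij.2 else yTrue ij.2
    with hb
  have hev : {ω | wrongSet (fun i j => X i j ω) yTrue = T}
      = ⋂ ij ∈ (Finset.univ : Finset (Fin n × Fin m)), (X ij.1 ij.2) ⁻¹' {b ij} := by
    ext ω
    simp only [Set.mem_ofPred_eq, Finset.mem_univ, Set.iInter_true, Set.mem_iInter, Set.mem_preimage,
      Set.mem_singleton_iff, funext_iff, Finset.ext_iff, wrongSet, Finset.mem_filter, true_and, hb,
      Prod.forall]
    refine forall_congr' fun i => forall_congr' fun j => ?_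
    by_cases hj : j ∈ T i <;> cases X i j ω <;> cases yTrue j <;> simp [hj]
  have hone : ∀ i j, P.real (X i j ⁻¹' {b (i, j)})
      = if j ∈ T i then 1 - pTrue i else pTrue i := by
    intro i j
    have h1 : X i j ⁻¹' {yTrue j} = {ω | X i j ω = yTrue j} := rfl
    by_cases hj : j ∈ T i
    · have h2 : X i j ⁻¹' {b (i, j)} = {ω | X i j ω = yTrue j}ᶜ := by
        ext ω
        simp only [hb, hj, if_true, Set.mem_preimage, Set.mem_singleton_iff, Set.mem_compl_iff,
          Set.mem_ofPred_eq]
        cases X i j ω <;> cases yTrue j <;> simp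
      rw [h2, probReal_compl_eq_one_sub, h.prob_correct, if_pos hj]
      rw [← h1]
      exact h.measurable i j (MeasurableSet.singleton _)
    · have h2 : X i j ⁻¹' {b (i, j)} = {ω | X i j ω = yTrue j} := by
        simp only [hb, hj, if_false]; rfl
      rw [h2, h.prob_correct, if_neg hj]
  rw [hev, measureReal_def, h.indep.measure_inter_preimage_eq_mul Finset.univ
    (sets := fun ij => {b ij}) (fun _ _ => MeasurableSet.singleton _), ENNReal.toReal_prod]
  simp only [← measureReal_def]
  rw [Fintype.prod_prod_type]
  refine Finset.prod_congr rfl fun i _ => ?_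
  simp_rw [hone]
  rw [Finset.prod_ite]
  simp only [Finset.prod_const]
  have e1 : (Finset.univ.filter fun j => j ∈ T i) = T i := by ext; simp
  have e2 : (Finset.univ.filter fun j => j ∉ T i).card = m - (T i).card := by
    have : (Finset.univ.filter fun j => j ∉ T i) = (T i)ᶜ := by ext; simp
    rw [this, Finset.card_compl, Fintype.card_fin]
  rw [e1, e2, sub_sub_cancel]

/-- Markov's inequality on the finite space of answer arrays. -/
lemma IsOneCoinModel.real_le_sum (h : IsOneCoinModel P X pTrue yTrue)
    (hp : ∀ i, pTrue i ∈ Set.Icc (0 : ℝ) 1) (A : Set (Fin n → Finset (Fin m)))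
    (g : (Fin n → Finset (Fin m)) → ℝ) (hg : ∀ T, 0 ≤ g T) (hA : ∀ T ∈ A, 1 ≤ g T) :
    P.real {ω | wrongSet (fun i j => X i j ω) yTrue ∈ A}
      ≤ ∑ T, (∏ i, (1 - pTrue i) ^ (T i).card * (1 - (1 - pTrue i)) ^ (m - (T i).card)) * g T := by
  classical
  have hsub : {ω | wrongSet (fun i j => X i j ω) yTrue ∈ A}
      ⊆ ⋃ T ∈ Finset.univ.filter (· ∈ A), {ω | wrongSet (fun i j => X i j ω) yTrue = T} := by
    intro ω hω
    simpa using hω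
  refine (measureReal_mono hsub (measure_ne_top _ _)).trans ((measureReal_biUnion_finset_le _ _).trans ?_)
  rw [Finset.sum_filter]
  refine Finset.sum_le_sum fun T _ => ?_
  have h0 : 0 ≤ ∏ i, (1 - pTrue i) ^ (T i).card * (1 - (1 - pTrue i)) ^ (m - (T i).card) := by
    refine Finset.prod_nonneg fun i _ => ?_
    have h1 : 0 ≤ 1 - pTrue i := by linarith [(hp i).2]
    have h2 : 0 ≤ 1 - (1 - pTrue i) := by linarith [(hp i).1]
    positivity
  split_ifs with hT
  · rw [h.real_wrongSet_eq]
    exact le_mul_of_one_le_right h0 (hA T hT)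
  · exact mul_nonneg h0 (hg T)

lemma one_sub_effAbility_mem {p : ℝ} (hp : p ∈ Set.Icc (0 : ℝ) 1) :
    0 ≤ 1 - effAbility p ∧ 1 - effAbility p ≤ 1 / 2 := by
  rw [effAbility]
  have := hp.1
  have := hp.2
  split_ifs <;> constructor <;> linarith

lemma gainMGF_one_sub_effAbility (θ : ℝ) (k l : ℕ) (p : ℝ) :
    gainMGF θ k l (1 - effAbility p) = gainMGF θ k l (1 - p) := by
  rw [effAbility]
  split_ifs
  · rfl
  · rw [gainMGF_symm]

/-- Chernoff's bound for the likelihood gain of flipping the labels of the items in `S`. -/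
lemma IsOneCoinModel.real_lt_gain_le (h : IsOneCoinModel P X pTrue yTrue)
    (hp : ∀ i, pTrue i ∈ Set.Icc (0 : ℝ) 1) (S : Finset (Fin m)) {θ : ℝ} (hθ : 0 ≤ θ) (L : ℝ) :
    P.real {ω | -L < gain S (wrongSet (fun i j => X i j ω) yTrue)}
      ≤ Real.exp (θ * L) * ∏ i, gainMGF θ S.card (m - S.card) (1 - effAbility (pTrue i)) := by
  have := h.real_le_sum hp {T | -L < gain S T} (fun T => Real.exp (θ * (L + gain S T)))
    (fun T => (Real.exp_pos _).le) (fun T hT => Real.one_le_exp (mul_nonneg hθ (by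
      have : -L < gain S T := hT
      linarith)))
  refine this.trans (le_of_eq ?_)
  simp_rw [gainMGF_one_sub_effAbility, ← sum_exp_gain_eq_gainMGF]
  rw [Finset.prod_univ_sum, Fintype.piFinset_univ, Finset.mul_sum]
  refine Finset.sum_congr rfl fun T _ => ?_
  conv_rhs => rw [Finset.prod_mul_distrib, ← Real.exp_sum, ← Finset.mul_sum]
  rw [mul_add, Real.exp_add, gain]
  ring

end Law

/-! ### No large set of labels can be flipped profitably -/

noncomputable section

/-- A lower bound, per flipped item, for the exponential rate at which it is unlikely that flipping
`k` labels increases the likelihood. -/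
def flipRate {n : ℕ} (pTrue : Fin n → ℝ) (m k : ℕ) : ℝ :=
  -(7 / 16 * ∑ i, Real.log (max (4 * (1 - effAbility (pTrue i)) * effAbility (pTrue i))
    ((k : ℝ) / m)))

/-- The event that flipping the labels of at most half of the items costs enough likelihood to
force a clustering error of at most `exp (-B)`. Only sets of size larger than about `m exp (-B)`
matter, up to a factor `2` that accounts for the rounding of a soft flip. If `exp (-B)` is less
than `1 / m`, soft flips of total weight less than `1` have to be excluded as well, and this needs the
stronger bound for singletons. -/
def FlipsCostly {n m : ℕ} (B : ℝ) (T : Fin n → Finset (Fin m)) : Prop :=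
  ∀ S : Finset (Fin m), 0 < S.card → 2 * S.card ≤ m + 1 →
    (Real.log (m / S.card) ≤ B + Real.log 2 →
      gain S T ≤ -(S.card * (2 + Real.log (m / S.card)))) ∧
    (S.card = 1 → Real.log m ≤ B → gain S T ≤ -(B + 2))

end

/-- The standard bound `(e m / k) ^ k` for the binomial coefficient. -/
lemma choose_le_exp {m k : ℕ} (hk : 0 < k) :
    (m.choose k : ℝ) ≤ Real.exp (k * (1 + Real.log (m / k))) := by
  rcases Nat.eq_zero_or_pos m with rfl | hm
  · rw [Nat.choose_eq_zero_of_lt hk]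
    simpa using (Real.exp_pos _).le
  have hk' : (0 : ℝ) < k := by exact_mod_cast hk
  have hm' : (0 : ℝ) < m := by exact_mod_cast hm
  have h1 : (m.choose k : ℝ) ≤ (m : ℝ) ^ k / k.factorial := Nat.choose_le_pow_div k m
  have h2 := Real.pow_div_factorial_le_exp (k : ℝ) hk'.le k
  have e : (m : ℝ) ^ k / k.factorial = ((m : ℝ) / k) ^ k * ((k : ℝ) ^ k / k.factorial) := by
    rw [div_pow]; field_simp
  rw [mul_add, mul_one, Real.exp_add, Real.exp_nat_mul (Real.log _) k,
    Real.exp_log (by positivity)]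
  rw [e, mul_comm] at h1
  exact h1.trans (by gcongr)

lemma log_le_mul_log_div {m k : ℝ} (hk : 1 ≤ k) (hm : 0 < m) (h : 1 ≤ Real.log (m / k)) :
    Real.log m ≤ k * Real.log (m / k) := by
  have hk0 : 0 < k := by linarith
  have e := Real.log_div hm.ne' hk0.ne'
  have h1 := Real.log_le_sub_one_of_pos hk0
  nlinarith

lemma natCast_mul_nuBar {n : ℕ} (hn : 0 < n) (p : Fin n → ℝ) :
    (n : ℝ) * nuBar p = ∑ i, (2 * effAbility (p i) - 1) ^ 2 := by
  have : (n : ℝ) ≠ 0 := by exact_mod_cast hn.ne'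
  rw [nuBar, ← mul_assoc, mul_one_div_cancel this, one_mul]

section Law

variable {Ω : Type*} [MeasurableSpace Ω] {P : Measure Ω} [IsProbabilityMeasure P] {n m : ℕ}
  {X : Fin n → Fin m → Ω → Bool} {pTrue : Fin n → ℝ} {yTrue : Fin m → Bool}

/-- For sets of at least `a₁ m` items, the hypothesis on `ν̄` makes the exponent superlinear in `m`; the
bound beats the number `2 ^ m` of such sets. -/
lemma IsOneCoinModel.real_lt_gain_le_of_large (h : IsOneCoinModel P X pTrue yTrue)
    (hp : ∀ i, pTrue i ∈ Set.Icc (0 : ℝ) 1) (hn : 0 < n) (hnm : n ≤ m) {a₁ : ℝ} (ha₁ : 0 < a₁)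
    (hm3 : 3 ≤ m) (hν : 12 * Real.log n / n ≤ nuBar pTrue)
    (hlog : (2 + Real.log (1 / a₁)) / 6 + Real.log 16 + Real.log 2 + 1 ≤ 2 / 3 * a₁ * Real.log n)
    {S : Finset (Fin m)} (hS : a₁ * m ≤ S.card) (hS2 : 2 * S.card ≤ m + 1) :
    P.real {ω | -(S.card * (2 + Real.log (m / S.card)))
        < gain S (wrongSet (fun i j => X i j ω) yTrue)} ≤ Real.exp (-m) * (1 / 2) ^ m := by
  set k := S.card with hk
  have hn' : (0 : ℝ) < n := by exact_mod_cast hn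
  have hnm' : (n : ℝ) ≤ m := by exact_mod_cast hnm
  have hm' : (3 : ℝ) ≤ m := by exact_mod_cast hm3
  have hk' : (0 : ℝ) < k := lt_of_lt_of_le (by positivity) hS
  have hk0 : 0 < k := by exact_mod_cast hk'
  have hkm : k ≤ m := by omega
  have hkm' : (k : ℝ) ≤ m := by exact_mod_cast hkm
  have hl0 : 0 < m - k := by omega
  have h3l : m ≤ 3 * (m - k) := by omega
  have h3l' : (m : ℝ) ≤ 3 * ((m - k : ℕ) : ℝ) := by exact_mod_cast h3l
  have hkl : (k : ℝ) + ((m - k : ℕ) : ℝ) = m := by rw [Nat.cast_sub hkm]; ring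
  refine (h.real_lt_gain_le hp S (by norm_num : (0 : ℝ) ≤ 1 / 6) _).trans ?_
  rw [← hk]
  have hprod : ∏ i, gainMGF (1 / 6) k (m - k) (1 - effAbility (pTrue i))
      ≤ ∏ i, 16 * Real.exp (-(k * ((m - k : ℕ) : ℝ) / m * (2 * effAbility (pTrue i) - 1) ^ 2 / 6)) := by
    refine Finset.prod_le_prod (fun i _ => ?_) fun i _ => ?_
    · have := one_sub_effAbility_mem (hp i)
      exact binExp_nonneg this.1 (by linarith) fun u _ => binExp_nonneg this.1 (by linarith)
        fun v _ => (Real.exp_pos _).le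
    · have := one_sub_effAbility_mem (hp i)
      have h2 := gainMGF_sixth_le hk0 hl0 this.1 (by linarith)
      rw [hkl, show (1 - 2 * (1 - effAbility (pTrue i))) = 2 * effAbility (pTrue i) - 1 by ring] at h2
      exact h2
  refine (mul_le_mul_of_nonneg_left hprod (Real.exp_pos _).le).trans ?_
  rw [Finset.prod_mul_distrib, Finset.prod_const, Finset.card_univ, Fintype.card_fin, ← Real.exp_sum,
    Finset.sum_neg_distrib, ← Finset.sum_div, ← Finset.mul_sum, ← natCast_mul_nuBar hn]
  have e16 : (16 : ℝ) ^ n = Real.exp (n * Real.log 16) := by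
    rw [Real.exp_nat_mul, Real.exp_log (by norm_num)]
  have e2 : (1 / 2 : ℝ) ^ m = Real.exp (-(m * Real.log 2)) := by
    rw [one_div, inv_pow, Real.exp_neg, Real.exp_nat_mul, Real.exp_log two_pos]
  rw [e16, e2, ← Real.exp_add, ← Real.exp_add, ← Real.exp_add, Real.exp_le_exp]
  have hnν : 12 * Real.log n ≤ n * nuBar pTrue := by
    rw [div_le_iff₀ hn'] at hν; linarith
  have hlogn : 0 ≤ Real.log n := Real.log_nonneg (by exact_mod_cast hn)
  have h1 : a₁ * m / 3 ≤ k * ((m - k : ℕ) : ℝ) / m := by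
    rw [le_div_iff₀ (by linarith)]
    nlinarith
  have h2 : a₁ * m / 3 * (12 * Real.log n) ≤ k * ((m - k : ℕ) : ℝ) / m * (n * nuBar pTrue) :=
    mul_le_mul h1 hnν (by positivity) (by positivity)
  have h3 : Real.log (m / k) ≤ Real.log (1 / a₁) := by
    refine Real.log_le_log (by positivity) ?_
    rw [div_le_div_iff₀ hk' ha₁]; linarith
  have h4 : 0 ≤ Real.log (m / k) := Real.log_nonneg (by rw [le_div_iff₀ hk']; linarith)
  have h5 : (k : ℝ) * (2 + Real.log (m / k)) ≤ m * (2 + Real.log (1 / a₁)) :=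
    mul_le_mul hkm' (by linarith) (by linarith) (by linarith)
  have h6 : (n : ℝ) * Real.log 16 ≤ m * Real.log 16 :=
    mul_le_mul_of_nonneg_right hnm' (Real.log_nonneg (by norm_num))
  have h7 := mul_le_mul_of_nonneg_left hlog (by linarith : (0 : ℝ) ≤ m)
  linarith

/-- Chernoff's bound of order `1 / 2` for small sets, in terms of `flipRate`. -/
lemma IsOneCoinModel.real_lt_gain_le_of_small (h : IsOneCoinModel P X pTrue yTrue)
    (hp : ∀ i, pTrue i ∈ Set.Icc (0 : ℝ) 1) (hnm : n ≤ m) {a₁ C : ℝ} (hC : 0 ≤ C)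
    (hMGF : ∀ (k l : ℕ) (ε : ℝ), 0 < k → (k : ℝ) ≤ a₁ * (k + l) → 0 ≤ ε → ε ≤ 1 / 2 →
      gainMGF (1 / 2) k l ε ≤ Real.exp (k * (7 / 16 * Real.log (max (4 * ε * (1 - ε)) (k / (k + l))))
        + C * (k / (k + l)))) {S : Finset (Fin m)} (hS : S.card ≤ a₁ * m) (hS0 : 0 < S.card) (L : ℝ) :
    P.real {ω | -L < gain S (wrongSet (fun i j => X i j ω) yTrue)}
      ≤ Real.exp (L / 2 - S.card * flipRate pTrue m S.card + C * S.card) := by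
  set k := S.card with hk
  have hkm : k ≤ m := by simpa using Finset.card_le_univ S
  have hk' : (0 : ℝ) < k := by exact_mod_cast hS0
  have hm' : (0 : ℝ) < m := hk'.trans_le (by exact_mod_cast hkm)
  have hnm' : (n : ℝ) ≤ m := by exact_mod_cast hnm
  have hkl : (k : ℝ) + ((m - k : ℕ) : ℝ) = m := by rw [Nat.cast_sub hkm]; ring
  refine (h.real_lt_gain_le hp S (by norm_num : (0 : ℝ) ≤ 1 / 2) L).trans ?_
  rw [← hk]
  have hprod : ∏ i, gainMGF (1 / 2) k (m - k) (1 - effAbility (pTrue i))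
      ≤ ∏ i, Real.exp (k * (7 / 16 * Real.log (max (4 * (1 - effAbility (pTrue i))
        * effAbility (pTrue i)) (k / m))) + C * (k / m)) := by
    refine Finset.prod_le_prod (fun i _ => ?_) fun i _ => ?_
    · have := one_sub_effAbility_mem (hp i)
      exact binExp_nonneg this.1 (by linarith) fun u _ => binExp_nonneg this.1 (by linarith)
        fun v _ => (Real.exp_pos _).le
    · have := one_sub_effAbility_mem (hp i)
      have h2 := hMGF k (m - k) _ hS0 (by rw [hkl]; exact hS) this.1 this.2
      rw [hkl, sub_sub_cancel] at h2
      exact h2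
  refine (mul_le_mul_of_nonneg_left hprod (Real.exp_pos _).le).trans ?_
  rw [← Real.exp_sum, ← Real.exp_add, Real.exp_le_exp, Finset.sum_add_distrib, ← Finset.mul_sum,
    ← Finset.mul_sum, Finset.sum_const, Finset.card_univ, Fintype.card_fin, nsmul_eq_mul, flipRate]
  have : (n : ℝ) * (C * (k / m)) ≤ C * k := by
    calc (n : ℝ) * (C * (k / m)) ≤ m * (C * (k / m)) := by gcongr
      _ = C * k := by field_simp
  linarith

/-- If the exponential rates `flipRate` dominate the entropy `log (m / k)` of the choice of `k`
items, then with probability `1 - 3 / m` all flips are costly. -/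
lemma exists_real_not_flipsCostly_le :
    ∃ a₁ > 0, a₁ ≤ Real.exp (-80) ∧ ∃ C : ℝ, ∃ N : ℕ, 3 ≤ N ∧ ∀ (n m : ℕ), N ≤ n → n ≤ m →
      ∀ (pTrue : Fin n → ℝ) (yTrue : Fin m → Bool), (∀ i, pTrue i ∈ Set.Icc (0 : ℝ) 1) →
      12 * Real.log n / n ≤ nuBar pTrue →
      ∀ B : ℝ,
      (∀ k : ℕ, 0 < k → (k : ℝ) ≤ a₁ * m → Real.log (m / k) ≤ B + Real.log 2 →
        3 * Real.log (m / k) + C ≤ flipRate pTrue m k) →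
      (Real.log m ≤ B → 2 * Real.log m + B / 2 + C ≤ flipRate pTrue m 1) →
      ∀ (Ω : Type*) [MeasurableSpace Ω] (P : Measure Ω) [IsProbabilityMeasure P]
        (X : Fin n → Fin m → Ω → Bool), IsOneCoinModel P X pTrue yTrue →
        P.real {ω | ¬ FlipsCostly B (wrongSet (fun i j => X i j ω) yTrue)} ≤ 3 / m := by
  obtain ⟨a₁, ha₁, ha₁80, C, hC, hMGF⟩ := exists_gainMGF_half_le
  have ha₁4 : a₁ ≤ 1 / 4 := by
    refine ha₁80.trans ?_
    rw [Real.exp_neg, inv_le_comm₀ (Real.exp_pos _) (by norm_num)]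
    linarith [Real.add_one_le_exp (80 : ℝ)]
  set K := (2 + Real.log (1 / a₁)) / 6 + Real.log 16 + Real.log 2 + 1 with hK
  refine ⟨a₁, ha₁, ha₁80, C + 3,
    max (max 3 ⌈Real.exp (K / (2 / 3 * a₁))⌉₊) ⌈1 / a₁⌉₊, by simp, ?_⟩
  intro n m hNn hnm pTrue yTrue hp hν B hB1 hB2 Ω _ P _ X hX
  have hn3 : 3 ≤ n := ((le_max_left _ _).trans (le_max_left _ _)).trans hNn
  have hn0 : 0 < n := by omega
  have hm3 : 3 ≤ m := by omega
  have hm' : (3 : ℝ) ≤ m := by exact_mod_cast hm3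
  have hm0 : (0 : ℝ) < m := by linarith
  have hn' : (0 : ℝ) < n := by exact_mod_cast hn0
  have ha₁m : 1 ≤ a₁ * m := by
    have h1 : ⌈1 / a₁⌉₊ ≤ m := ((le_max_right _ _).trans hNn).trans hnm
    have h2 : 1 / a₁ ≤ m := Nat.ceil_le.1 h1
    rw [div_le_iff₀ ha₁] at h2; linarith
  have hlog : K ≤ 2 / 3 * a₁ * Real.log n := by
    have h1 : ⌈Real.exp (K / (2 / 3 * a₁))⌉₊ ≤ n :=
      ((le_max_right _ _).trans (le_max_left _ _)).trans hNn
    have h2 : Real.exp (K / (2 / 3 * a₁)) ≤ n := Nat.ceil_le.1 h1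
    rw [← Real.le_log_iff_exp_le hn', div_le_iff₀ (by positivity)] at h2
    linarith
  set W := fun ω => wrongSet (fun i j => X i j ω) yTrue with hW
  set E1 : Finset (Fin m) → Set Ω := fun S => {ω | (0 < S.card ∧ 2 * S.card ≤ m + 1 ∧
    Real.log (m / S.card) ≤ B + Real.log 2) ∧
      -(S.card * (2 + Real.log (m / S.card))) < gain S (W ω)} with hE1
  set E2 : Finset (Fin m) → Set Ω := fun S => {ω | (S.card = 1 ∧ Real.log m ≤ B) ∧
      -(B + 2) < gain S (W ω)} with hE2
  -- `gB k` and `gC k` are the bounds for one set of `k` items; summed over all sets, both contribute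
  -- at most `1 / m`.
  set gB : ℕ → ℝ := fun k => if k = 0 then 0 else 1 / m * (1 / 2) ^ k / m.choose k with hgB
  set gC : ℕ → ℝ := fun k => if k = 1 then 1 / (m * m) else 0 with hgC
  have hgB0 : ∀ k, 0 ≤ gB k := fun k => by
    simp only [hgB]; split_ifs <;> positivity
  have hgC0 : ∀ k, 0 ≤ gC k := fun k => by
    simp only [hgC]; split_ifs <;> positivity
  have hsub : {ω | ¬ FlipsCostly B (W ω)} ⊆ ⋃ S ∈ (Finset.univ : Finset (Finset (Fin m))),
      (E1 S ∪ E2 S) := by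
    intro ω hω
    simp only [FlipsCostly, not_forall, Set.mem_ofPred_eq] at hω
    obtain ⟨S, h0, h2, h3⟩ := hω
    simp only [Finset.mem_univ, Set.iUnion_true, Set.mem_iUnion]
    refine ⟨S, ?_⟩
    by_contra hcon
    rw [Set.mem_union, not_or] at hcon
    refine h3 ⟨fun hl => ?_, fun h1 hl => ?_⟩
    · by_contra hc
      exact hcon.1 ⟨⟨h0, h2, hl⟩, not_le.1 hc⟩
    · by_contra hc
      exact hcon.2 ⟨⟨h1, hl⟩, not_le.1 hc⟩
  have hlogbig : ∀ k : ℕ, 0 < k → (k : ℝ) ≤ a₁ * m → 1 ≤ Real.log (m / k) := by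
    intro k hk hka
    have hk' : (0 : ℝ) < k := by exact_mod_cast hk
    have h1 : Real.exp 1 ≤ m / k := by
      rw [le_div_iff₀ hk']
      have := Real.exp_one_lt_d9
      nlinarith
    rw [← Real.log_exp 1]
    exact Real.log_le_log (Real.exp_pos _) h1
  have hb1 : ∀ S, P.real (E1 S) ≤ Real.exp (-m) * (1 / 2) ^ m + gB S.card := by
    intro S
    by_cases hc : 0 < S.card ∧ 2 * S.card ≤ m + 1 ∧ Real.log (m / S.card) ≤ B + Real.log 2
    · have hE : E1 S = {ω | -(S.card * (2 + Real.log (m / S.card))) < gain S (W ω)} := by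
        exact Set.ext fun ω => ⟨fun h => h.2, fun h => ⟨hc, h⟩⟩
      rw [hE]
      rcases le_or_gt (a₁ * m) (S.card : ℝ) with hS | hS
      · exact (hX.real_lt_gain_le_of_large hp hn0 hnm ha₁ hm3 hν hlog hS hc.2.1).trans
          (le_add_of_nonneg_right (hgB0 _))
      · refine le_trans ?_ (le_add_of_nonneg_left (by positivity))
        refine (hX.real_lt_gain_le_of_small hp hnm hC hMGF hS.le hc.1 _).trans ?_
        have hR := hB1 S.card hc.1 hS.le hc.2.2
        have hch := choose_le_exp (m := m) hc.1
        have hlb := hlogbig S.card hc.1 hS.le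
        have hk1 : (1 : ℝ) ≤ S.card := by exact_mod_cast hc.1
        have hlm := log_le_mul_log_div hk1 hm0 hlb
        have hchpos : 0 < (m.choose S.card : ℝ) := by
          exact_mod_cast Nat.choose_pos (by omega)
        have e : gB S.card = 1 / m * (1 / 2) ^ S.card / m.choose S.card := if_neg (by omega)
        rw [e, le_div_iff₀ hchpos]
        refine (mul_le_mul_of_nonneg_left hch (Real.exp_pos _).le).trans ?_
        have e2 : 1 / (m : ℝ) = Real.exp (-Real.log m) := by
          rw [Real.exp_neg, Real.exp_log hm0, one_div]
        have e3 : Real.exp (-(S.card : ℝ)) ≤ (1 / 2) ^ S.card := by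
          rw [show -(S.card : ℝ) = S.card * (-1 : ℝ) by ring, Real.exp_nat_mul]
          refine pow_le_pow_left₀ (Real.exp_pos _).le ?_ _
          rw [Real.exp_neg, one_div]
          refine inv_anti₀ two_pos ?_
          linarith [Real.exp_one_gt_d9]
        refine le_trans ?_ (mul_le_mul_of_nonneg_left e3 (by positivity))
        rw [e2, ← Real.exp_add, ← Real.exp_add, Real.exp_le_exp]
        have h6 := mul_le_mul_of_nonneg_left hR (by linarith : (0 : ℝ) ≤ S.card)
        have h7 : 0 ≤ (S.card : ℝ) * Real.log (m / S.card) :=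
          mul_nonneg (by linarith) (by linarith)
        linarith only [h6, h7, hlm, hk1]
    · have hE : E1 S = ∅ := by
        ext ω; simp only [hE1, hc, false_and, Set.mem_empty_iff_false, Set.mem_ofPred_eq]
      rw [hE, measureReal_empty]
      have := hgB0 S.card
      positivity
  have hb2 : ∀ S, P.real (E2 S) ≤ gC S.card := by
    intro S
    by_cases hc : S.card = 1 ∧ Real.log m ≤ B
    · have hE : E2 S = {ω | -(B + 2) < gain S (W ω)} := by
        exact Set.ext fun ω => ⟨fun h => h.2, fun h => ⟨hc, h⟩⟩
      rw [hE]
      have e : gC S.card = 1 / (m * m) := if_pos hc.1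
      rw [e]
      refine (hX.real_lt_gain_le_of_small hp hnm hC hMGF (by rw [hc.1]; simpa using ha₁m)
        (by omega) _).trans ?_
      have hR := hB2 hc.2
      rw [hc.1]
      have e2 : 1 / ((m : ℝ) * m) = Real.exp (-(2 * Real.log m)) := by
        rw [Real.exp_neg, two_mul, Real.exp_add, Real.exp_log hm0, one_div]
      rw [e2, Real.exp_le_exp, Nat.cast_one]
      linarith only [hR]
    · have hE : E2 S = ∅ := by
        ext ω; simp only [hE2, hc, false_and, Set.mem_empty_iff_false, Set.mem_ofPred_eq]
      rw [hE, measureReal_empty]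
      exact hgC0 _
  have hsum : ∀ f : ℕ → ℝ, ∑ S : Finset (Fin m), f S.card
      = ∑ k ∈ Finset.range (m + 1), (m.choose k : ℝ) * f k := by
    intro f
    have := Finset.sum_powerset_apply_card f (x := (Finset.univ : Finset (Fin m)))
    rw [Finset.powerset_univ, Finset.card_univ, Fintype.card_fin] at this
    rw [this]
    simp [nsmul_eq_mul]
  have hsA : ∑ _S : Finset (Fin m), Real.exp (-m) * (1 / 2) ^ m ≤ 1 / m := by
    rw [Finset.sum_const, Finset.card_univ, Fintype.card_finset, Fintype.card_fin, nsmul_eq_mul]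
    have h1 : ((2 ^ m : ℕ) : ℝ) * (Real.exp (-m) * (1 / 2) ^ m) = Real.exp (-m) := by
      push_cast
      have : (2 : ℝ) ^ m * (1 / 2) ^ m = 1 := by rw [← mul_pow]; norm_num
      linear_combination Real.exp (-m) * this
    rw [h1, Real.exp_neg, one_div]
    refine inv_anti₀ hm0 ?_
    linarith [Real.add_one_le_exp (m : ℝ)]
  have hsB : ∑ S : Finset (Fin m), gB S.card ≤ 1 / m := by
    rw [hsum, Finset.sum_range_succ']
    have e0 : gB 0 = 0 := if_pos rfl
    rw [e0, mul_zero, add_zero]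
    have h1 : ∀ k ∈ Finset.range m, (m.choose (k + 1) : ℝ) * gB (k + 1)
        = 1 / m * (1 / 2) * (1 / 2) ^ k := by
      intro k hk
      have : (m.choose (k + 1) : ℝ) ≠ 0 := by
        have := Nat.choose_pos (n := m) (k := k + 1) (by simpa using hk)
        exact_mod_cast this.ne'
      have e : gB (k + 1) = 1 / m * (1 / 2) ^ (k + 1) / m.choose (k + 1) := if_neg (by omega)
      rw [e, pow_succ]; field_simp
    rw [Finset.sum_congr rfl h1, ← Finset.mul_sum, geom_sum_eq (by norm_num)]
    have : 0 ≤ (1 / 2 : ℝ) ^ m := by positivity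
    have h2 : ((1 / 2 : ℝ) ^ m - 1) / (1 / 2 - 1) ≤ 2 := by
      rw [div_le_iff_of_neg (by norm_num)]; linarith
    calc 1 / (m : ℝ) * (1 / 2) * (((1 / 2) ^ m - 1) / (1 / 2 - 1)) ≤ 1 / (m : ℝ) * (1 / 2) * 2 := by
          gcongr
      _ = _ := by ring
  have hsC : ∑ S : Finset (Fin m), gC S.card ≤ 1 / m := by
    rw [hsum, Finset.sum_eq_single 1]
    · simp only [hgC, if_true, Nat.choose_one_right]
      apply le_of_eq; field_simp
    · intro k _ hk; simp [hgC, hk]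
    · intro hk
      exact absurd (Finset.mem_range.2 (by omega)) hk
  calc P.real {ω | ¬ FlipsCostly B (W ω)}
      ≤ ∑ S : Finset (Fin m), P.real (E1 S ∪ E2 S) :=
        (measureReal_mono hsub (measure_ne_top _ _)).trans (measureReal_biUnion_finset_le _ _)
    _ ≤ ∑ S : Finset (Fin m), ((Real.exp (-m) * (1 / 2) ^ m + gB S.card) + gC S.card) :=
        Finset.sum_le_sum fun S _ => (measureReal_union_le _ _).trans (add_le_add (hb1 S) (hb2 S))
    _ ≤ 3 / m := by
        rw [Finset.sum_add_distrib, Finset.sum_add_distrib]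
        have : (3 : ℝ) / m = 1 / m + 1 / m + 1 / m := by ring
        rw [this]
        exact add_le_add (add_le_add hsA hsB) hsC

end Law

/-! ### Lower bounds for the exponential rates -/

/-- By `4ε(1 - ε) = 1 - (2μᵢ - 1)² ≤ exp (-(2μᵢ - 1)²)`, each worker contributes at least
`(7 / 16) (2μᵢ - 1)²`. -/
lemma nuBar_le_flipRate {n m k : ℕ} (hn : 0 < n) {p : Fin n → ℝ} (hk : 0 < (k : ℝ) / m)
    (hk1 : (k : ℝ) / m ≤ Real.exp (-1)) (hp : ∀ i, p i ∈ Set.Icc (0 : ℝ) 1) :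
    7 / 16 * (n * nuBar p) ≤ flipRate p m k := by
  rw [natCast_mul_nuBar hn, flipRate, ← mul_neg, ← Finset.sum_neg_distrib]
  refine mul_le_mul_of_nonneg_left (Finset.sum_le_sum fun i _ => ?_) (by norm_num)
  have h := one_sub_effAbility_mem (hp i)
  rw [le_neg, Real.log_le_iff_le_exp (lt_max_of_lt_right hk)]
  refine max_le ?_ (hk1.trans (Real.exp_le_exp.2 ?_))
  · have := Real.add_one_le_exp (-(2 * effAbility (p i) - 1) ^ 2)
    linarith
  · nlinarith

lemma log_le_half_sub_inv {x : ℝ} (hx : 1 ≤ x) : Real.log x ≤ (x - x⁻¹) / 2 := by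
  rw [← Real.sinh_log (by linarith)]
  exact Real.self_le_sinh_iff.2 (Real.log_nonneg hx)

lemma log_div_le {d : ℝ} (h0 : 0 ≤ d) (h1 : d < 1) :
    Real.log ((1 + d) / (1 - d)) ≤ 2 * d / (1 - d ^ 2) := by
  have h2 : 0 < 1 - d := by linarith
  have h3 : 0 < 1 + d := by linarith
  refine (log_le_half_sub_inv (by rw [le_div_iff₀ h2]; linarith)).trans (le_of_eq ?_)
  have : 1 - d ^ 2 = (1 - d) * (1 + d) := by ring
  rw [this]
  field_simp
  ring

/-- Half of the divergence `D(μ ‖ 1 - μ)`, `μ = (1 + d) / 2`, is at most `-log (4μ(1 - μ))`. The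
difference of the two sides is monotone in `d`. -/
lemma half_mul_log_div_le {d : ℝ} (h0 : 0 ≤ d) (h1 : d < 1) :
    d / 2 * Real.log ((1 + d) / (1 - d)) ≤ -Real.log (1 - d ^ 2) := by
  set φ : ℝ → ℝ := fun x => -((1 + x / 2) * Real.log (1 + x)) - (1 - x / 2) * Real.log (1 - x)
    with hφ
  have hder : ∀ x ∈ Set.Ico (0 : ℝ) 1, HasDerivAt φ
      (x / (1 - x ^ 2) - Real.log ((1 + x) / (1 - x)) / 2) x := by
    intro x hx
    have hx1 : 0 < 1 + x := by linarith [hx.1]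
    have hx2 : 0 < 1 - x := by linarith [hx.2]
    have d1 := ((hasDerivAt_id x).const_add 1).log hx1.ne'
    have d2 := ((hasDerivAt_id x).const_sub 1).log hx2.ne'
    have e1 := (((hasDerivAt_id x).div_const 2).const_add 1).mul d1
    have e2 := (((hasDerivAt_id x).div_const 2).const_sub 1).mul d2
    have e3 := e1.neg.sub e2
    refine e3.congr_deriv ?_
    have : 1 - x ^ 2 = (1 - x) * (1 + x) := by ring
    rw [this, Real.log_div hx1.ne' hx2.ne']
    simp only [id]
    field_simp
    ring
  have hmono : MonotoneOn φ (Set.Ico 0 1) := by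
    refine monotoneOn_of_hasDerivWithinAt_nonneg (convex_Ico 0 1)
      (fun x hx => (hder x hx).continuousAt.continuousWithinAt)
      (fun x hx => (hder x (interior_subset hx)).hasDerivWithinAt) fun x hx => ?_
    have hx := interior_subset hx
    have := log_div_le hx.1 hx.2
    have e : 2 * x / (1 - x ^ 2) = 2 * (x / (1 - x ^ 2)) := by ring
    linarith
  have h := hmono ⟨le_rfl, one_pos⟩ ⟨h0, h1⟩ h0
  simp only [hφ] at h
  have hx1 : 0 < 1 + d := by linarith
  have hx2 : 0 < 1 - d := by linarith
  have : 1 - d ^ 2 = (1 - d) * (1 + d) := by ring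
  rw [this, Real.log_div hx1.ne' hx2.ne', Real.log_mul hx2.ne' hx1.ne']
  simp at h
  linarith

lemma klBern_one_sub (μ : ℝ) :
    klBern μ (1 - μ) = (2 * μ - 1) * Real.log (μ / (1 - μ)) := by
  rw [klBern, sub_sub_cancel, ← inv_div μ (1 - μ), Real.log_inv]
  ring

lemma half_le_muBar {n : ℕ} (hn : 0 < n) {p : Fin n → ℝ} (hp : ∀ i, p i ∈ Set.Icc (0 : ℝ) 1) :
    1 / 2 ≤ muBar p := by
  have hn' : (0 : ℝ) < n := by exact_mod_cast hn
  have : ∑ _i : Fin n, (1 / 2 : ℝ) ≤ ∑ i, effAbility (p i) := Finset.sum_le_sum fun i _ => by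
    linarith [one_sub_effAbility_mem (hp i)]
  rw [Finset.sum_const, Finset.card_univ, Fintype.card_fin, nsmul_eq_mul] at this
  rw [muBar, one_div_mul_eq_div, le_div_iff₀ hn']
  linarith

/-- Jensen's inequality for the square. -/
lemma sq_le_nuBar {n : ℕ} (hn : 0 < n) (p : Fin n → ℝ) : (2 * muBar p - 1) ^ 2 ≤ nuBar p := by
  have hn' : (0 : ℝ) < n := by exact_mod_cast hn
  have h := sq_sum_le_card_mul_sum_sq (s := Finset.univ) (f := fun i => 2 * effAbility (p i) - 1)
  rw [Finset.card_univ, Fintype.card_fin, ← natCast_mul_nuBar hn] at h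
  have e : ∑ i, (2 * effAbility (p i) - 1) = n * (2 * muBar p - 1) := by
    rw [Finset.sum_sub_distrib, ← Finset.mul_sum, Finset.sum_const, Finset.card_univ,
      Fintype.card_fin, nsmul_eq_mul, muBar]
    field_simp
  rw [e] at h
  have h2 : (n : ℝ) ^ 2 * (2 * muBar p - 1) ^ 2 ≤ n ^ 2 * nuBar p := by nlinarith
  exact le_of_mul_le_mul_left h2 (by positivity)

/-- By concavity of the logarithm, the rate is at least that of `n` workers of average quality. -/
lemma log_le_flipRate {n m k : ℕ} (hn : 0 < n) {p : Fin n → ℝ}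
    (hp : ∀ i, p i ∈ Set.Icc (0 : ℝ) 1) (hk : 0 < (k : ℝ) / m) {c : ℝ} (hc : c ≤ nuBar p)
    (hc1 : c < 1) :
    7 / 16 * (n * -Real.log (1 - c + k / m)) ≤ flipRate p m k := by
  have hn' : (0 : ℝ) < n := by exact_mod_cast hn
  set A := 1 - c + (k : ℝ) / m with hA
  have hA0 : 0 < A := by linarith
  rw [flipRate, ← mul_neg]
  refine mul_le_mul_of_nonneg_left ?_ (by norm_num)
  rw [mul_neg, neg_le_neg_iff]
  have h1 : ∀ i, Real.log (max (4 * (1 - effAbility (p i)) * effAbility (p i)) ((k : ℝ) / m))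
      ≤ (1 - (2 * effAbility (p i) - 1) ^ 2 + k / m) * A⁻¹ + (Real.log A - 1) := by
    intro i
    have h := one_sub_effAbility_mem (hp i)
    have h4 : 0 ≤ 4 * (1 - effAbility (p i)) * effAbility (p i) := by nlinarith
    set M := max (4 * (1 - effAbility (p i)) * effAbility (p i)) ((k : ℝ) / m)
    have hM : 0 < M := lt_max_of_lt_right hk
    have h2 := Real.log_le_sub_one_of_pos (div_pos hM hA0)
    rw [Real.log_div hM.ne' hA0.ne', div_eq_mul_inv] at h2
    have h3 : M ≤ 1 - (2 * effAbility (p i) - 1) ^ 2 + k / m := max_le (by nlinarith) (by nlinarith)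
    have h5 := mul_le_mul_of_nonneg_right h3 (inv_nonneg.2 hA0.le)
    linarith
  refine (Finset.sum_le_sum fun i _ => h1 i).trans ?_
  rw [Finset.sum_add_distrib, ← Finset.sum_mul, Finset.sum_add_distrib, Finset.sum_sub_distrib,
    ← natCast_mul_nuBar hn]
  simp only [Finset.sum_const, Finset.card_univ, Fintype.card_fin, nsmul_eq_mul, mul_one]
  have h2 : ((n : ℝ) - n * nuBar p + n * (k / m)) * A⁻¹ ≤ n := by
    rw [← div_eq_mul_inv, div_le_iff₀ hA0]
    nlinarith
  linarith

/-- Both rate conditions hold for the exponent `n ν̄ / 8`. -/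
lemma exists_flipRate_ge_nuBar (C : ℝ) : ∃ N : ℕ, 3 ≤ N ∧ ∀ n m : ℕ, N ≤ n → n ≤ m →
    ∀ p : Fin n → ℝ, (∀ i, p i ∈ Set.Icc (0 : ℝ) 1) → 12 * Real.log n / n ≤ nuBar p →
    ∀ B, B = n * nuBar p / 8 →
    (∀ k : ℕ, 0 < k → (k : ℝ) ≤ Real.exp (-1) * m → Real.log (m / k) ≤ B + Real.log 2 →
        3 * Real.log (m / k) + C ≤ flipRate p m k) ∧
      (Real.log m ≤ B → 2 * Real.log m + B / 2 + C ≤ flipRate p m 1) := by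
  refine ⟨max 3 ⌈Real.exp (2 * (3 * Real.log 2 + |C|))⌉₊, le_max_left _ _, ?_⟩
  intro n m hN hnm p hp hν B hB
  have hn3 : 3 ≤ n := (le_max_left _ _).trans hN
  have hn : 0 < n := by omega
  have hn' : (0 : ℝ) < n := by exact_mod_cast hn
  have hm3 : (3 : ℝ) ≤ m := by exact_mod_cast hn3.trans hnm
  have h1 : 2 * (3 * Real.log 2 + |C|) ≤ Real.log n := by
    rw [Real.le_log_iff_exp_le hn']
    exact Nat.ceil_le.1 ((le_max_right _ _).trans hN)
  rw [div_le_iff₀ hn'] at hν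
  have h0 : 0 ≤ Real.log n := Real.log_nonneg (by exact_mod_cast hn)
  have hlog2 : 0 < Real.log 2 := Real.log_pos one_lt_two
  have hC := le_abs_self C
  constructor
  · intro k hk hka hl
    have hk' : (0 : ℝ) < k := by exact_mod_cast hk
    have h2 := nuBar_le_flipRate (m := m) (k := k) hn (by positivity)
      (by rw [div_le_iff₀ (by linarith)]; exact hka) hp
    linarith
  · intro hl
    have h2 := nuBar_le_flipRate (m := m) (k := 1) hn (by simp; linarith)
      (by
        rw [Nat.cast_one, Real.exp_neg, one_div]
        exact inv_anti₀ (Real.exp_pos _) (by linarith [Real.exp_one_lt_d9])) hp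
    linarith

/-- Both rate conditions hold for the exponent `n D / 24`, `D = D(μ̄ ‖ 1 - μ̄)`, when `D > 3 ν̄` and
`μ̄` is not extremely close to `1`. -/
lemma exists_flipRate_ge_klBern (C : ℝ) : ∃ N : ℕ, ∀ n m : ℕ, N ≤ n → n ≤ m →
    ∀ p : Fin n → ℝ, (∀ i, p i ∈ Set.Icc (0 : ℝ) 1) → muBar p < 1 →
    3 * nuBar p < klBern (muBar p) (1 - muBar p) → 1 ≤ (1 - muBar p) * (m : ℝ) ^ 3 →
    ∀ B, B = n * klBern (muBar p) (1 - muBar p) / 24 →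
    (∀ k : ℕ, 0 < k → (k : ℝ) ≤ Real.exp (-80) * m → Real.log (m / k) ≤ B + Real.log 2 →
        3 * Real.log (m / k) + C ≤ flipRate p m k) ∧
      (Real.log m ≤ B → 2 * Real.log m + B / 2 + C ≤ flipRate p m 1) := by
  refine ⟨max ⌈Real.exp 80⌉₊ ⌈100 * (3 + |C|)⌉₊, ?_⟩
  intro n m hN hnm p hp hμ1 hD hδ B hB
  have hn80 : Real.exp 80 ≤ n := Nat.ceil_le.1 ((le_max_left _ _).trans hN)
  have hnC : 100 * (3 + |C|) ≤ n := Nat.ceil_le.1 ((le_max_right _ _).trans hN)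
  have hC0 := abs_nonneg C
  have hn' : (0 : ℝ) < n := by linarith
  have hn : 0 < n := by exact_mod_cast hn'
  have hnm' : (n : ℝ) ≤ m := by exact_mod_cast hnm
  have hm' : (0 : ℝ) < m := by linarith
  have hlogm : 80 ≤ Real.log m := by
    rw [Real.le_log_iff_exp_le hm']; linarith
  have hlog2 : Real.log 2 < 1 := by linarith [Real.log_two_lt_d9]
  have hC := le_abs_self C
  have hμ := half_le_muBar hn hp
  have hν := sq_le_nuBar hn p
  set μ := muBar p with hμdef
  set d := 2 * μ - 1 with hd
  set D := klBern μ (1 - μ) with hDdef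
  have eD : D = d * Real.log ((1 + d) / (1 - d)) := by
    rw [hDdef, klBern_one_sub]
    congr 2
    have : 1 - μ ≠ 0 := by linarith
    have : 1 - d ≠ 0 := by rw [hd]; intro h; apply this; linarith
    field_simp
    rw [hd]; ring
  have hd0 : 0 ≤ d := by linarith
  have hd1 : d < 1 := by linarith
  have hd2 : 0 < 1 - d ^ 2 := by nlinarith
  have hd3 : 0 < d := by
    rcases hd0.eq_or_lt with h | h
    · rw [eD, ← h] at hD
      rw [← h] at hν
      simp at hD hν
      linarith
    · exact h
  -- For small `d` the divergence is about `2d²`, so that `D > 3 ν̄ ≥ 3d²` bounds `d` from below.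
  have hD1 : 1 ≤ D := by
    have h1 := log_div_le hd0 hd1
    have h2 : 3 * d < 2 * d / (1 - d ^ 2) := by
      refine lt_of_lt_of_le ?_ h1
      refine lt_of_mul_lt_mul_left (a := d) ?_ hd0
      nlinarith
    rw [lt_div_iff₀ hd2] at h2
    nlinarith
  have hE : D / 2 ≤ -Real.log (1 - d ^ 2) := by
    have := half_mul_log_div_le hd0 hd1
    rw [eD]; linarith
  have hD3 : D ≤ 3 * Real.log m := by
    have h1 : 0 < 1 - μ := by linarith
    have h2 : Real.log (μ / (1 - μ)) ≤ 3 * Real.log m := by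
      have e : 3 * Real.log m = Real.log ((m : ℝ) ^ 3) := by rw [Real.log_pow]; norm_num
      rw [e]
      refine Real.log_le_log (div_pos (by linarith) h1) ?_
      rw [div_le_iff₀ h1]
      nlinarith
    have h3 : 0 ≤ Real.log (μ / (1 - μ)) := Real.log_nonneg (by rw [le_div_iff₀ h1]; linarith)
    rw [hDdef, klBern_one_sub]
    nlinarith
  have hBn : n / 24 ≤ B := by rw [hB]; nlinarith
  -- The rate is dominated either by `D` or, when the fraction `k / m` exceeds `1 - d²`, by
  -- `log (m / k)`.
  have key : ∀ k : ℕ, 0 < k → (k : ℝ) ≤ Real.exp (-80) * m →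
      3.9 * B ≤ flipRate p m k ∨ 21 / 64 * (n * Real.log (m / k)) ≤ flipRate p m k := by
    intro k hk hka
    have hk' : (0 : ℝ) < k := by exact_mod_cast hk
    have ha : 0 < (k : ℝ) / m := by positivity
    have hr := log_le_flipRate (m := m) (k := k) hn hp ha hν (by linarith)
    have hL : 80 ≤ Real.log (m / k) := by
      rw [Real.le_log_iff_exp_le (by positivity), le_div_iff₀ hk']
      rw [Real.exp_neg] at hka
      have := mul_le_mul_of_nonneg_left hka (Real.exp_pos 80).le
      rwa [mul_inv_cancel_left₀ (Real.exp_pos 80).ne'] at this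
    rcases le_or_gt ((k : ℝ) / m) ((1 - d ^ 2) / 8) with h | h
    · left
      have h1 : Real.log (1 - d ^ 2 + k / m) ≤ 1 / 8 + Real.log (1 - d ^ 2) := by
        have h2 : Real.log (1 - d ^ 2 + k / m) ≤ Real.log (9 / 8 * (1 - d ^ 2)) :=
          Real.log_le_log (by positivity) (by linarith)
        rw [Real.log_mul (by norm_num) hd2.ne'] at h2
        have := Real.log_le_sub_one_of_pos (show (0 : ℝ) < 9 / 8 by norm_num)
        linarith
      refine le_trans ?_ hr
      rw [hB]
      have : n * (D / 2 - 1 / 8) ≤ n * -Real.log (1 - d ^ 2 + k / m) :=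
        mul_le_mul_of_nonneg_left (by linarith) hn'.le
      nlinarith
    · right
      have h1 : Real.log (1 - d ^ 2 + k / m) ≤ 8 - Real.log (m / k) := by
        have h2 : Real.log (1 - d ^ 2 + k / m) ≤ Real.log (9 * (k / m)) :=
          Real.log_le_log (by positivity) (by linarith)
        have e : Real.log ((k : ℝ) / m) = -Real.log (m / k) := by rw [← inv_div, Real.log_inv]
        rw [Real.log_mul (by norm_num) ha.ne', e] at h2
        have := Real.log_le_sub_one_of_pos (show (0 : ℝ) < 9 by norm_num)
        linarith
      refine le_trans ?_ hr
      have : n * (3 / 4 * Real.log (m / k)) ≤ n * -Real.log (1 - d ^ 2 + k / m) :=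
        mul_le_mul_of_nonneg_left (by linarith) hn'.le
      linarith
  constructor
  · intro k hk hka hl
    have hk' : (0 : ℝ) < k := by exact_mod_cast hk
    have hL : 80 ≤ Real.log (m / k) := by
      rw [Real.le_log_iff_exp_le (by positivity), le_div_iff₀ hk']
      rw [Real.exp_neg] at hka
      have := mul_le_mul_of_nonneg_left hka (Real.exp_pos 80).le
      rwa [mul_inv_cancel_left₀ (Real.exp_pos 80).ne'] at this
    rcases key k hk hka with h | h
    · linarith only [h, hl, hBn, hnC, hC, hC0, hlog2]
    · refine le_trans ?_ h
      have h5 := mul_le_mul_of_nonneg_right hnC (by linarith : 0 ≤ Real.log (m / k))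
      have h6 := mul_le_mul_of_nonneg_left hL hC0
      linarith only [h5, h6, hC, hL, hC0]
  · intro hl
    have h1m : ((1 : ℕ) : ℝ) ≤ Real.exp (-80) * m := by
      rw [Real.exp_neg, ← div_eq_inv_mul, le_div_iff₀ (Real.exp_pos _)]
      simpa using hn80.trans hnm'
    rcases key 1 one_pos h1m with h | h
    · linarith only [h, hl, hBn, hnC, hC, hC0, hlogm]
    · refine le_trans ?_ h
      rw [Nat.cast_one, div_one]
      have h4 := mul_le_mul_of_nonneg_left hD3 hn'.le
      have h5 := mul_le_mul_of_nonneg_right hnC (by linarith : 0 ≤ Real.log m)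
      have h6 := mul_le_mul_of_nonneg_left hlogm hC0
      rw [hB]
      linarith only [h4, h5, h6, hC, hlogm, hC0]

/-! ### The objective at a maximizer -/

lemma extLog_of_pos {t : ℝ} (ht : 0 < t) : extLog t = (Real.log t : EReal) := by
  rw [extLog, ENNReal.log_ofReal_of_pos ht]

lemma extLog_of_nonpos {t : ℝ} (ht : t ≤ 0) : extLog t = ⊥ := by
  rw [extLog, ENNReal.ofReal_of_nonpos ht, ENNReal.log_zero]

/-- The extended logarithm lies below the tangent lines of the logarithm. -/
lemma extLog_le_tangent {t q : ℝ} (hq : 0 < q) :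
    extLog t ≤ ((Real.log q + t / q - 1 : ℝ) : EReal) := by
  rcases le_or_gt t 0 with ht | ht
  · rw [extLog_of_nonpos ht]; exact bot_le
  · rw [extLog_of_pos ht, EReal.coe_le_coe_iff]
    have := Real.log_le_sub_one_of_pos (div_pos ht hq)
    rw [Real.log_div ht.ne' hq.ne'] at this
    linarith

lemma extLog_nonpos {t : ℝ} (ht : t ≤ 1) : extLog t ≤ ((0 : ℝ) : EReal) := by
  have := extLog_le_tangent (t := t) one_pos
  refine this.trans ?_
  rw [EReal.coe_le_coe_iff]
  simp [ht]

lemma coe_mul_extLog {c t : ℝ} (h : c ≠ 0 → 0 < t) :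
    (c : EReal) * extLog t = ((c * Real.log t : ℝ) : EReal) := by
  by_cases hc : c = 0
  · simp [hc]
  · rw [extLog_of_pos (h hc), EReal.coe_mul]

lemma EReal.coe_finset_sum {ι : Type*} (s : Finset ι) (f : ι → ℝ) :
    ((∑ i ∈ s, f i : ℝ) : EReal) = ∑ i ∈ s, (f i : EReal) := by
  classical
  induction s using Finset.induction_on with
  | empty => simp
  | insert a s ha ih => rw [Finset.sum_insert ha, Finset.sum_insert ha, EReal.coe_add, ih]

noncomputable section

/-- The weight that the soft label `y` of an item puts on the answer `b`. -/
def agreement (y : ℝ) (b : Bool) : ℝ := if b then y else 1 - y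

end

lemma agreement_mem {y : ℝ} (hy : y ∈ Set.Icc (0 : ℝ) 1) (b : Bool) :
    0 ≤ agreement y b ∧ 0 ≤ 1 - agreement y b := by
  have := hy.1
  have := hy.2
  cases b <;> simp [agreement, *]

lemma objective_eq {n m : ℕ} (x : Fin n → Fin m → Bool) (p : Fin n → ℝ) (y : Fin m → ℝ) :
    objective x p y = (∑ i, ∑ j, ((agreement (y j) (x i j) : EReal) * extLog (p i)
      + ((1 - agreement (y j) (x i j) : ℝ) : EReal) * extLog (1 - p i)))
      + ((∑ j, binEntropy (y j) : ℝ) : EReal) := by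
  rw [objective, ← Finset.sum_add_distrib]
  congr 1
  refine Finset.sum_congr rfl fun i _ => ?_
  rw [← Finset.sum_add_distrib]
  refine Finset.sum_congr rfl fun j _ => ?_
  cases x i j <;> simp [agreement, bit, add_comm]

/-- Gibbs' inequality in the form needed for a single worker: among all abilities `p`, the
log-likelihood is largest at the average agreement, where it is `-m` times an entropy. -/
lemma sum_extLog_le {m : ℕ} (hm : 0 < m) (v : Fin m → ℝ) (hv : ∀ j, 0 ≤ v j ∧ 0 ≤ 1 - v j) {p : ℝ}
    (hp : p ∈ Set.Icc (0 : ℝ) 1) :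
    ∑ j, ((v j : EReal) * extLog p + ((1 - v j : ℝ) : EReal) * extLog (1 - p))
      ≤ ((-(m * binEntropy ((∑ j, v j) / m)) : ℝ) : EReal) := by
  have hm' : (0 : ℝ) < m := by exact_mod_cast hm
  have key : ∀ r s : ℝ, extLog p ≤ (r : EReal) → extLog (1 - p) ≤ (s : EReal) →
      (∑ j, v j) * r + (m - ∑ j, v j) * s ≤ -(m * binEntropy ((∑ j, v j) / m)) →
      ∑ j, ((v j : EReal) * extLog p + ((1 - v j : ℝ) : EReal) * extLog (1 - p))
      ≤ ((-(m * binEntropy ((∑ j, v j) / m)) : ℝ) : EReal) := by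
    intro r s hr hs h
    calc ∑ j, ((v j : EReal) * extLog p + ((1 - v j : ℝ) : EReal) * extLog (1 - p))
        ≤ ∑ j, ((v j * r + (1 - v j) * s : ℝ) : EReal) := Finset.sum_le_sum fun j _ => by
          rw [EReal.coe_add, EReal.coe_mul, EReal.coe_mul]
          exact add_le_add (mul_le_mul_of_nonneg_left hr (by exact_mod_cast (hv j).1))
            (mul_le_mul_of_nonneg_left hs (by exact_mod_cast (hv j).2))
      _ = (((∑ j, v j) * r + (m - ∑ j, v j) * s : ℝ) : EReal) := by
          rw [← EReal.coe_finset_sum, Finset.sum_add_distrib, ← Finset.sum_mul, ← Finset.sum_mul,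
            Finset.sum_sub_distrib]
          simp
      _ ≤ _ := EReal.coe_le_coe_iff.2 h
  set A := ∑ j, v j with hA
  have hA0 : 0 ≤ A := Finset.sum_nonneg fun j _ => (hv j).1
  have hAm : A ≤ m := by
    have : ∑ j, v j ≤ ∑ _j : Fin m, (1 : ℝ) := Finset.sum_le_sum fun j _ => by linarith [(hv j).2]
    simpa using this
  -- The tangent at the average `A / m` is not available if the average is `0` or `1`, but then one
  -- of the two logarithms has coefficient `0` throughout.
  rcases hA0.eq_or_lt with h0 | h0
  · refine key (Real.log 1 + p / 1 - 1) 0 (extLog_le_tangent one_pos)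
      (extLog_nonpos (by linarith [hp.1])) ?_
    rw [← h0]; simp
  rcases hAm.eq_or_lt with h1 | h1
  · refine key 0 (Real.log 1 + (1 - p) / 1 - 1) (extLog_nonpos hp.2) (extLog_le_tangent one_pos) ?_
    rw [h1, div_self hm'.ne']; simp
  · have hq : 0 < A / m := by positivity
    have hq1 : 0 < 1 - A / m := by rw [sub_pos, div_lt_one hm']; exact h1
    refine key _ _ (extLog_le_tangent hq) (extLog_le_tangent hq1) (le_of_eq ?_)
    have e : (m : ℝ) - A = m * (1 - A / m) := by field_simp
    rw [e, binEntropy, Real.log_inv, Real.log_inv]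
    generalize hX : Real.log (A / m) = Xv
    generalize hY : Real.log (1 - A / m) = Yv
    have e2 : A * (p / (A / m)) = m * p := by field_simp
    have e3 : (m * (1 - A / m)) * ((1 - p) / (1 - A / m)) = m * (1 - p) := by field_simp
    have e4 : (m : ℝ) * (A / m) = A := by field_simp
    linear_combination e2 + e3 + (1 - Xv) * e4

/-- The objective is at most its supremum over the abilities. -/
lemma objective_le {n m : ℕ} (hm : 0 < m) (x : Fin n → Fin m → Bool) {p : Fin n → ℝ}
    {y : Fin m → ℝ} (hp : ∀ i, p i ∈ Set.Icc (0 : ℝ) 1) (hy : ∀ j, y j ∈ Set.Icc (0 : ℝ) 1) :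
    objective x p y ≤ ((∑ i, -(m * binEntropy ((∑ j, agreement (y j) (x i j)) / m))
      + ∑ j, binEntropy (y j) : ℝ) : EReal) := by
  rw [objective_eq, EReal.coe_add]
  refine add_le_add ?_ le_rfl
  rw [EReal.coe_finset_sum]
  exact Finset.sum_le_sum fun i _ => sum_extLog_le hm _ (fun j => agreement_mem (hy j) _) (hp i)

/-- At hard labels and their profile abilities the upper bound `objective_le` is attained; the
entropies of the labels vanish. -/
lemma objective_bit_eq {n m : ℕ} (hm : 0 < m) (x : Fin n → Fin m → Bool) (y : Fin m → Bool) :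
    objective x (fun i => (∑ j, agreement (bit (y j)) (x i j)) / m) (fun j => bit (y j))
      = ((∑ i, -(m * binEntropy ((∑ j, agreement (bit (y j)) (x i j)) / m)) : ℝ) : EReal) := by
  have hm' : (0 : ℝ) < m := by exact_mod_cast hm
  have hb : ∀ j, bit (y j) ∈ Set.Icc (0 : ℝ) 1 := fun j => by cases y j <;> simp [bit]
  have hent : ∑ j, binEntropy (bit (y j)) = 0 :=
    Finset.sum_eq_zero fun j _ => by cases y j <;> simp [bit]
  rw [objective_eq, hent, EReal.coe_zero, add_zero, EReal.coe_finset_sum]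
  refine Finset.sum_congr rfl fun i _ => ?_
  set v : Fin m → ℝ := fun j => agreement (bit (y j)) (x i j) with hv
  have hv0 : ∀ j, 0 ≤ v j := fun j => (agreement_mem (hb j) _).1
  have hv1 : ∀ j, 0 ≤ 1 - v j := fun j => (agreement_mem (hb j) _).2
  have hsum1 : ∑ j, (1 - v j) = m - ∑ j, v j := by simp
  have e : 1 - (∑ j, v j) / m = (∑ j, (1 - v j)) / m := by
    rw [hsum1]; field_simp
  have h1 : ∀ j, ((v j : EReal) * extLog ((∑ j, v j) / m)
      + ((1 - v j : ℝ) : EReal) * extLog (1 - (∑ j, v j) / m))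
      = ((v j * Real.log ((∑ j, v j) / m) + (1 - v j) * Real.log (1 - (∑ j, v j) / m) : ℝ) :
        EReal) := by
    intro j
    rw [EReal.coe_add, coe_mul_extLog, coe_mul_extLog]
    · intro h
      rw [e]
      exact div_pos (Finset.sum_pos' (fun j _ => hv1 j) ⟨j, Finset.mem_univ j, (hv1 j).lt_of_ne' h⟩)
        hm'
    · intro h
      exact div_pos (Finset.sum_pos' (fun j _ => hv0 j) ⟨j, Finset.mem_univ j, (hv0 j).lt_of_ne' h⟩)
        hm'
  rw [Finset.sum_congr rfl fun j _ => h1 j, ← EReal.coe_finset_sum, Finset.sum_add_distrib,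
    ← Finset.sum_mul, ← Finset.sum_mul, hsum1, binEntropy, Real.log_inv, Real.log_inv]
  congr 1
  field_simp
  ring

noncomputable section

/-- The number of wrong answers of a worker with wrong set `T` relative to labels of which the
fraction `w j` of item `j` has been flipped; for `w` the indicator of `S` it is the size of
`symmDiff T S`. -/
def softWrong {m : ℕ} (T : Finset (Fin m)) (w : Fin m → ℝ) : ℝ :=
  ∑ j, if j ∈ T then 1 - w j else w j

/-- The analogue of `gain` for soft flips `w : Fin m → [0,1]`. -/
def softGain {n m : ℕ} (w : Fin m → ℝ) (T : Fin n → Finset (Fin m)) : ℝ :=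
  ∑ i, (m : ℝ) * (binEntropy ((T i).card / m) - binEntropy (softWrong (T i) w / m))

end

lemma softWrong_one_sub {m : ℕ} (T : Finset (Fin m)) (w : Fin m → ℝ) :
    softWrong T (fun j => 1 - w j) = m - softWrong T w := by
  have : ∑ _j : Fin m, (1 : ℝ) = m := by simp
  rw [softWrong, softWrong, ← this, ← Finset.sum_sub_distrib]
  refine Finset.sum_congr rfl fun j _ => ?_
  split_ifs <;> ring

lemma binEntropy_sub_div {m : ℕ} (hm : 0 < m) (t : ℝ) :
    binEntropy ((m - t) / m) = binEntropy (t / m) := by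
  have hm' : (m : ℝ) ≠ 0 := by exact_mod_cast hm.ne'
  rw [sub_div, div_self hm', Real.binEntropy_one_sub]

lemma softGain_one_sub {n m : ℕ} (hm : 0 < m) (w : Fin m → ℝ) (T : Fin n → Finset (Fin m)) :
    softGain (fun j => 1 - w j) T = softGain w T := by
  rw [softGain, softGain]
  refine Finset.sum_congr rfl fun i _ => ?_
  rw [softWrong_one_sub, binEntropy_sub_div hm]

/-- A maximizer is at least as good as the true labels together with their profile abilities. -/
lemma IsGlobalMaximizer.softGain_nonneg {n m : ℕ} (hm : 0 < m) {x : Fin n → Fin m → Bool}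
    {p : Fin n → ℝ} {y : Fin m → ℝ} (h : IsGlobalMaximizer x p y) (yTrue : Fin m → Bool) :
    0 ≤ softGain (fun j => |y j - bit (yTrue j)|) (wrongSet x yTrue)
      + ∑ j, binEntropy |y j - bit (yTrue j)| := by
  have hm' : (0 : ℝ) < m := by exact_mod_cast hm
  obtain ⟨⟨hp, hy⟩, hmax⟩ := h
  have hb : ∀ j, bit (yTrue j) ∈ Set.Icc (0 : ℝ) 1 := fun j => by cases yTrue j <;> simp [bit]
  have hq : ∀ i, (∑ j, agreement (bit (yTrue j)) (x i j)) / m ∈ Set.Icc (0 : ℝ) 1 := by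
    intro i
    refine ⟨div_nonneg (Finset.sum_nonneg fun j _ => (agreement_mem (hb j) _).1) hm'.le, ?_⟩
    rw [div_le_one hm']
    have : ∑ j, agreement (bit (yTrue j)) (x i j) ≤ ∑ _j : Fin m, (1 : ℝ) :=
      Finset.sum_le_sum fun j _ => by linarith [(agreement_mem (hb j) (x i j)).2]
    simpa using this
  have h1 := (hmax _ _ hq hb).trans (objective_le hm x hp hy)
  rw [objective_bit_eq hm, EReal.coe_le_coe_iff] at h1
  have e1 : ∀ i, ∑ j, agreement (bit (yTrue j)) (x i j) = m - (wrongSet x yTrue i).card := by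
    intro i
    have : ((wrongSet x yTrue i).card : ℝ) = ∑ j, if x i j ≠ yTrue j then (1 : ℝ) else 0 := by
      rw [wrongSet, Finset.sum_boole]
    have e : ∑ _j : Fin m, (1 : ℝ) = m := by simp
    rw [this, ← e, ← Finset.sum_sub_distrib]
    refine Finset.sum_congr rfl fun j _ => ?_
    cases x i j <;> cases yTrue j <;> simp [agreement, bit]
  have e2 : ∀ i, ∑ j, agreement (y j) (x i j)
      = m - softWrong (wrongSet x yTrue i) (fun j => |y j - bit (yTrue j)|) := by
    intro i
    have e : ∑ _j : Fin m, (1 : ℝ) = m := by simp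
    rw [softWrong, ← e, ← Finset.sum_sub_distrib]
    refine Finset.sum_congr rfl fun j _ => ?_
    have a1 : |y j| = y j := abs_of_nonneg (hy j).1
    have a2 : |y j - 1| = 1 - y j := by rw [abs_sub_comm, abs_of_nonneg]; linarith [(hy j).2]
    cases hx : x i j <;> cases ht : yTrue j <;> simp [agreement, bit, wrongSet, hx, ht, a1, a2]
  have e3 : ∑ j, binEntropy |y j - bit (yTrue j)| = ∑ j, binEntropy (y j) := by
    refine Finset.sum_congr rfl fun j _ => ?_
    have a1 : |y j| = y j := abs_of_nonneg (hy j).1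
    have a2 : |y j - 1| = 1 - y j := by rw [abs_sub_comm, abs_of_nonneg]; linarith [(hy j).2]
    cases yTrue j <;> simp [bit, a1, a2, Real.binEntropy_one_sub]
  simp_rw [e1, e2, binEntropy_sub_div hm] at h1
  rw [e3, softGain]
  simp_rw [mul_sub]
  rw [Finset.sum_sub_distrib]
  rw [Finset.sum_neg_distrib, Finset.sum_neg_distrib] at h1
  linarith

/-! ### Rounding soft flips -/

/-- The set of the `k` largest values. -/
lemma exists_top_subset {ι : Type*} [Fintype ι] [DecidableEq ι] (c : ι → ℝ) (k : ℕ)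
    (hk : k ≤ Fintype.card ι) :
    ∃ S : Finset ι, S.card = k ∧ ∀ i ∈ S, ∀ j ∉ S, c j ≤ c i := by
  induction k with
  | zero => exact ⟨∅, rfl, by simp⟩
  | succ k ih =>
    obtain ⟨S, hS, h⟩ := ih (by omega)
    have hne : Sᶜ.Nonempty := by
      rw [← Finset.card_pos, Finset.card_compl]; omega
    obtain ⟨a, ha, hmax⟩ := Finset.exists_max_image Sᶜ c hne
    rw [Finset.mem_compl] at ha
    refine ⟨insert a S, by rw [Finset.card_insert_of_notMem ha, hS], ?_⟩
    intro i hi j hj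
    rw [Finset.mem_insert, not_or] at hj
    rcases Finset.mem_insert.1 hi with rfl | hi
    · exact hmax j (Finset.mem_compl.2 hj.2)
    · exact h i hi j hj.2

/-- A linear function of weights in `[0,1]` of total `k + τ` is at most a mixture of its values at
indicators of sets of sizes `k` and `k + 1`. -/
lemma exists_sum_mul_le {m : ℕ} (c w : Fin m → ℝ) (hw : ∀ j, w j ∈ Set.Icc (0 : ℝ) 1) {k : ℕ}
    (hk : k < m) {τ : ℝ} (hsum : ∑ j, w j = k + τ) :
    ∃ S S' : Finset (Fin m), S.card = k ∧ S'.card = k + 1 ∧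
      ∑ j, w j * c j ≤ (1 - τ) * ∑ j ∈ S, c j + τ * ∑ j ∈ S', c j := by
  obtain ⟨S, hS, h⟩ := exists_top_subset c k (by simpa using hk.le)
  have hne : Sᶜ.Nonempty := by
    rw [← Finset.card_pos, Finset.card_compl, Fintype.card_fin]; omega
  obtain ⟨a, ha, hmax⟩ := Finset.exists_max_image Sᶜ c hne
  rw [Finset.mem_compl] at ha
  refine ⟨S, insert a S, hS, by rw [Finset.card_insert_of_notMem ha, hS], ?_⟩
  rw [Finset.sum_insert ha]
  have h1 : ∑ j, w j * (c j - c a) ≤ ∑ j, if j ∈ S then c j - c a else 0 := by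
    refine Finset.sum_le_sum fun j _ => ?_
    split_ifs with hj
    · have := h j hj a ha
      nlinarith [(hw j).1, (hw j).2]
    · have := hmax j (Finset.mem_compl.2 hj)
      nlinarith [(hw j).1, (hw j).2]
  rw [← Finset.sum_filter, Finset.filter_mem_eq_inter, Finset.univ_inter, Finset.sum_sub_distrib,
    Finset.sum_const, hS, nsmul_eq_mul] at h1
  simp_rw [mul_sub] at h1
  rw [Finset.sum_sub_distrib, ← Finset.sum_mul, hsum] at h1
  linarith

lemma softWrong_eq {m : ℕ} (T : Finset (Fin m)) (w : Fin m → ℝ) :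
    softWrong T w = T.card + ∑ j, w j * (if j ∈ T then -1 else 1) := by
  have : (T.card : ℝ) = ∑ j, if j ∈ T then (1 : ℝ) else 0 := by simp
  rw [softWrong, this, ← Finset.sum_add_distrib]
  refine Finset.sum_congr rfl fun j _ => ?_
  split_ifs <;> ring

lemma card_symmDiff_eq {m : ℕ} (T S : Finset (Fin m)) :
    ((symmDiff T S).card : ℝ) = T.card + ∑ j ∈ S, if j ∈ T then (-1 : ℝ) else 1 := by
  have h1 : (T.card : ℝ) = ∑ j, if j ∈ T then (1 : ℝ) else 0 := by simp
  have h2 : ((symmDiff T S).card : ℝ) = ∑ j, if j ∈ symmDiff T S then (1 : ℝ) else 0 := by simp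
  have h3 : ∑ j ∈ S, (if j ∈ T then (-1 : ℝ) else 1)
      = ∑ j, if j ∈ S then (if j ∈ T then (-1 : ℝ) else 1) else 0 := by simp
  rw [h1, h2, h3, ← Finset.sum_add_distrib]
  refine Finset.sum_congr rfl fun j _ => ?_
  by_cases a : j ∈ T <;> by_cases b : j ∈ S <;> simp [a, b, Finset.mem_symmDiff]

/-- The gain of a soft flip of total weight `k + τ` is at most a mixture of the gains of flips of
`k` and of `k + 1` labels. Since `-h` is convex, it
suffices to consider its tangents, which exist where `softWrong` is neither `0` nor `m`. -/
lemma exists_softGain_le_of_interior {n m : ℕ} (T : Fin n → Finset (Fin m)) (w : Fin m → ℝ)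
    (hw : ∀ j, w j ∈ Set.Icc (0 : ℝ) 1) {k : ℕ} (hk : k < m) {τ : ℝ}
    (hint : ∀ i, 0 < softWrong (T i) w ∧ softWrong (T i) w < m) (hsum : ∑ j, w j = k + τ)
    (hτ0 : 0 ≤ τ) (hτ1 : τ ≤ 1) :
    ∃ S S' : Finset (Fin m), S.card = k ∧ S'.card = k + 1 ∧
      softGain w T ≤ (1 - τ) * gain S T + τ * gain S' T := by
  have hm' : (0 : ℝ) < m := by exact_mod_cast (by omega : 0 < m)
  set q : Fin n → ℝ := fun i => softWrong (T i) w / m with hq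
  have hq0 : ∀ i, 0 < q i := fun i => div_pos (hint i).1 hm'
  have hq1 : ∀ i, q i < 1 := fun i => (div_lt_one hm').2 (hint i).2
  set κ : Fin n → ℝ := fun i => Real.log (q i) - Real.log (1 - q i) with hκ
  set c : Fin m → ℝ := fun j => ∑ i, κ i * (if j ∈ T i then (-1 : ℝ) else 1) with hc
  obtain ⟨S, S', hS, hS', hle⟩ := exists_sum_mul_le c w hw hk hsum
  refine ⟨S, S', hS, hS', ?_⟩
  set b : ℝ := ∑ i, (m * binEntropy ((T i).card / m) + m * Real.log (1 - q i)
    + κ i * (T i).card) with hb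
  have e1 : softGain w T = b + ∑ j, w j * c j := by
    simp_rw [hc, Finset.mul_sum]
    rw [Finset.sum_comm, hb, ← Finset.sum_add_distrib, softGain]
    refine Finset.sum_congr rfl fun i _ => ?_
    have h1 : ∑ j, w j * (κ i * if j ∈ T i then (-1 : ℝ) else 1)
        = κ i * (softWrong (T i) w - (T i).card) := by
      rw [softWrong_eq, add_sub_cancel_left, Finset.mul_sum]
      exact Finset.sum_congr rfl fun j _ => by ring
    have h2 : softWrong (T i) w = m * q i := by simp only [hq]; field_simp
    have h3 : binEntropy (softWrong (T i) w / m) = -(q i * Real.log (q i))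
        - (1 - q i) * Real.log (1 - q i) := by
      rw [binEntropy, Real.log_inv, Real.log_inv]; ring
    rw [h1, h3, h2]
    simp only [hκ]
    ring
  have e2 : ∀ S : Finset (Fin m), b + ∑ j ∈ S, c j ≤ gain S T := by
    intro S
    rw [hc, Finset.sum_comm, hb, ← Finset.sum_add_distrib, gain]
    refine Finset.sum_le_sum fun i _ => ?_
    have hle : ((symmDiff (T i) S).card : ℝ) ≤ m := by
      have : (symmDiff (T i) S).card ≤ m := by simpa using Finset.card_le_univ (symmDiff (T i) S)
      exact_mod_cast this
    have h1 := binEntropy_le_crossEntropy (x := (symmDiff (T i) S).card / m) (by positivity)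
      (by rw [div_le_one hm']; exact hle) (hq0 i) (hq1 i)
    have h2 := mul_le_mul_of_nonneg_left h1 hm'.le
    have h3 : (m : ℝ) * (-((symmDiff (T i) S).card / m * Real.log (q i))
        - (1 - (symmDiff (T i) S).card / m) * Real.log (1 - q i))
        = -((symmDiff (T i) S).card * κ i) - m * Real.log (1 - q i) := by
      simp only [hκ]; field_simp; ring
    have h4 : ((symmDiff (T i) S).card : ℝ) * κ i
        = κ i * (T i).card + κ i * ∑ j ∈ S, if j ∈ T i then (-1 : ℝ) else 1 := by
      rw [card_symmDiff_eq]; ring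
    rw [← Finset.mul_sum]
    rw [h3] at h2
    rw [mul_sub]
    linarith
  have := mul_le_mul_of_nonneg_left (e2 S) (sub_nonneg.2 hτ1)
  have := mul_le_mul_of_nonneg_left (e2 S') hτ0
  rw [e1]
  linarith

lemma softWrong_term_nonneg {m : ℕ} (T : Finset (Fin m)) {w : Fin m → ℝ}
    (hw : ∀ j, w j ∈ Set.Icc (0 : ℝ) 1) (j : Fin m) : 0 ≤ if j ∈ T then 1 - w j else w j := by
  split_ifs
  · linarith [(hw j).2]
  · exact (hw j).1

lemma exists_eq_indicator_of_softWrong_eq_zero {m : ℕ} {T : Finset (Fin m)} {w : Fin m → ℝ}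
    (hw : ∀ j, w j ∈ Set.Icc (0 : ℝ) 1) (h : softWrong T w = 0) :
    ∃ S : Finset (Fin m), w = fun j => if j ∈ S then 1 else 0 := by
  have h1 := (Finset.sum_eq_zero_iff_of_nonneg fun j _ => softWrong_term_nonneg T hw j).1 h
  refine ⟨T, funext fun j => ?_⟩
  have := h1 j (Finset.mem_univ j)
  split_ifs at this ⊢ <;> linarith

/-- The gain of a soft flip is at most a mixture of the gains of flips of sets of sizes the integer
part of its total weight and one more. -/
lemma exists_softGain_le {n m : ℕ} (T : Fin n → Finset (Fin m)) (w : Fin m → ℝ)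
    (hw : ∀ j, w j ∈ Set.Icc (0 : ℝ) 1) {k : ℕ} (hk : k < m) {τ : ℝ} (hsum : ∑ j, w j = k + τ)
    (hτ0 : 0 ≤ τ) (hτ1 : τ < 1) :
    ∃ S S' : Finset (Fin m), S.card = k ∧ S'.card = k + 1 ∧
      softGain w T ≤ (1 - τ) * gain S T + τ * gain S' T := by
  by_cases hint : ∀ i, 0 < softWrong (T i) w ∧ softWrong (T i) w < m
  · exact exists_softGain_le_of_interior T w hw hk hint hsum hτ0 hτ1.le
  -- If `softWrong` is `0` or `m` for some worker, then `w` is the indicator of a set.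
  have hind : ∃ S : Finset (Fin m), w = fun j => if j ∈ S then 1 else 0 := by
    push Not at hint
    obtain ⟨i, hi⟩ := hint
    have hw' : ∀ j, 1 - w j ∈ Set.Icc (0 : ℝ) 1 := fun j =>
      ⟨by linarith [(hw j).2], by linarith [(hw j).1]⟩
    have h0 : 0 ≤ softWrong (T i) w := Finset.sum_nonneg fun j _ => softWrong_term_nonneg _ hw j
    have h1 : 0 ≤ softWrong (T i) (fun j => 1 - w j) :=
      Finset.sum_nonneg fun j _ => softWrong_term_nonneg _ hw' j
    rcases h0.eq_or_lt with h | h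
    · exact exists_eq_indicator_of_softWrong_eq_zero hw h.symm
    · obtain ⟨S, hS⟩ := exists_eq_indicator_of_softWrong_eq_zero hw'
        (T := T i) (by
          rw [softWrong_one_sub] at h1 ⊢
          linarith [hi h])
      refine ⟨Sᶜ, funext fun j => ?_⟩
      have := congrFun hS j
      simp only [Finset.mem_compl] at this ⊢
      split_ifs at this ⊢ <;> simp_all; linarith
  obtain ⟨S, hS⟩ := hind
  have hcard : (S.card : ℝ) = k + τ := by rw [← hsum, hS]; simp
  have hSk : S.card = k := by
    have h1 : (k : ℝ) ≤ S.card := by linarith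
    have h2 : (S.card : ℝ) < k + 1 := by linarith
    have h1' : k ≤ S.card := by exact_mod_cast h1
    have h2' : S.card < k + 1 := by exact_mod_cast h2
    omega
  have hτ : τ = 0 := by rw [hSk] at hcard; linarith
  obtain ⟨S', hS', -⟩ := exists_top_subset (fun _ : Fin m => (0 : ℝ)) (k + 1) (by simpa using hk)
  refine ⟨S, S', hSk, hS', le_of_eq ?_⟩
  rw [hτ, sub_zero, one_mul, zero_mul, add_zero, softGain, gain]
  refine Finset.sum_congr rfl fun i _ => ?_
  rw [softWrong_eq, card_symmDiff_eq, hS]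
  simp only [ite_mul, one_mul, zero_mul, Finset.sum_ite_mem, Finset.univ_inter]

/-! ### The clustering error of a maximizer -/

lemma gain_empty {n m : ℕ} (T : Fin n → Finset (Fin m)) : gain ∅ T = 0 := by
  rw [gain]
  refine Finset.sum_eq_zero fun i _ => ?_
  rw [← Finset.bot_eq_empty, symmDiff_bot, sub_self, mul_zero]

/-- Jensen's inequality for the binary entropy. -/
lemma sum_binEntropy_le {m : ℕ} (hm : 0 < m) {w : Fin m → ℝ}
    (hw : ∀ j, w j ∈ Set.Icc (0 : ℝ) 1) :
    ∑ j, binEntropy (w j) ≤ m * binEntropy ((∑ j, w j) / m) := by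
  have hm' : (0 : ℝ) < m := by exact_mod_cast hm
  have h := Real.strictConcave_binEntropy.concaveOn.le_map_sum (t := Finset.univ)
    (w := fun _ : Fin m => (1 / m : ℝ)) (p := w) (fun _ _ => by positivity)
    (by simp [hm'.ne']) (fun j _ => hw j)
  simp only [smul_eq_mul, ← Finset.mul_sum] at h
  rw [one_div_mul_eq_div, one_div_mul_eq_div, div_le_iff₀ hm'] at h
  linarith

/-- The soft labels of a maximizer, compared to the true labels or to their flips, whichever is
closer. -/
lemma IsGlobalMaximizer.exists_softFlip {n m : ℕ} (hm : 0 < m) {x : Fin n → Fin m → Bool}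
    {p : Fin n → ℝ} {y : Fin m → ℝ} (h : IsGlobalMaximizer x p y) (yTrue : Fin m → Bool) :
    ∃ w : Fin m → ℝ, (∀ j, w j ∈ Set.Icc (0 : ℝ) 1) ∧ (∑ j, w j) / m ≤ 1 / 2 ∧
      clusteringError y yTrue ≤ (∑ j, w j) / m ∧
      0 ≤ softGain w (wrongSet x yTrue) + m * binEntropy ((∑ j, w j) / m) := by
  have hm' : (0 : ℝ) < m := by exact_mod_cast hm
  have hy := h.1.2
  set w : Fin m → ℝ := fun j => |y j - bit (yTrue j)| with hw
  have hw01 : ∀ j, w j ∈ Set.Icc (0 : ℝ) 1 := fun j => by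
    have := hy j
    refine ⟨abs_nonneg _, abs_le.2 ?_⟩
    cases yTrue j <;> constructor <;> simp [bit] <;> linarith [this.1, this.2]
  have hflip : ∀ j, |y j - (1 - bit (yTrue j))| = 1 - w j := fun j => by
    have a1 : |y j| = y j := abs_of_nonneg (hy j).1
    have a2 : |y j - 1| = 1 - y j := by rw [abs_sub_comm, abs_of_nonneg]; linarith [(hy j).2]
    simp only [hw]
    cases yTrue j <;> simp [bit, a1, a2]
  have hg : 0 ≤ softGain w (wrongSet x yTrue) + m * binEntropy ((∑ j, w j) / m) :=
    (h.softGain_nonneg hm yTrue).trans (add_le_add le_rfl (sum_binEntropy_le hm hw01))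
  have hsum : ∑ j, (1 - w j) = m - ∑ j, w j := by simp
  have hce : clusteringError y yTrue = min ((∑ j, w j) / m) ((∑ j, (1 - w j)) / m) := by
    rw [clusteringError, one_div_mul_eq_div, one_div_mul_eq_div]
    simp_rw [hflip]
    rfl
  rcases le_total ((∑ j, w j) / m) (1 / 2) with ha | ha
  · exact ⟨w, hw01, ha, hce.trans_le (min_le_left _ _), hg⟩
  · refine ⟨fun j => 1 - w j, fun j => ⟨by linarith [(hw01 j).2], by linarith [(hw01 j).1]⟩, ?_,
      hce.trans_le (min_le_right _ _), ?_⟩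
    · rw [hsum, sub_div, div_self hm'.ne']; linarith
    · rw [softGain_one_sub hm, hsum, binEntropy_sub_div hm]; exact hg

/-- A clustering error `a > exp (-B)` is impossible on the event `FlipsCostly B`: with `σ = am`, the
gain `-σ (log (m / σ) + 2 - log 2)` outweighs the entropy `m h(a) ≤ σ (log (m / σ) + 1)`. -/
lemma clusteringError_le_of_flipsCostly {n m : ℕ} (hm : 0 < m) {x : Fin n → Fin m → Bool}
    {p : Fin n → ℝ} {y : Fin m → ℝ} (h : IsGlobalMaximizer x p y) {yTrue : Fin m → Bool} {B : ℝ}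
    (hT : FlipsCostly B (wrongSet x yTrue)) : clusteringError y yTrue ≤ Real.exp (-B) := by
  have hm' : (0 : ℝ) < m := by exact_mod_cast hm
  obtain ⟨w, hw, ha, hce, hg⟩ := h.exists_softFlip hm yTrue
  refine hce.trans ?_
  by_contra! hlt
  set σ := ∑ j, w j with hσ
  have ha0 : 0 < σ / m := (Real.exp_pos _).trans hlt
  have hσ0 : 0 < σ := by rwa [div_pos_iff_of_pos_right hm'] at ha0
  have hσm : 2 * σ ≤ m := by rw [div_le_iff₀ hm'] at ha; linarith
  have hℓ : Real.log (m / σ) < B := by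
    rw [Real.log_lt_iff_lt_exp (by positivity), ← inv_div, inv_lt_comm₀ ha0 (Real.exp_pos _),
      ← Real.exp_neg]
    exact hlt
  have hℓ2 : Real.log 2 ≤ Real.log (m / σ) :=
    Real.log_le_log two_pos (by rw [le_div_iff₀ hσ0]; linarith)
  have hlog2 : Real.log 2 < 1 := by linarith [Real.log_two_lt_d9]
  have hent : m * binEntropy (σ / m) ≤ σ * (Real.log (m / σ) + 1) := by
    have h1 := mul_le_mul_of_nonneg_left (binEntropy_le_mul_log (x := σ / m) (by linarith)) hm'.le
    rw [inv_div, ← mul_assoc, mul_div_cancel₀ _ hm'.ne'] at h1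
    exact h1
  set k := ⌊σ⌋₊ with hk
  have hkσ : (k : ℝ) ≤ σ := Nat.floor_le hσ0.le
  have hσk : σ < k + 1 := Nat.lt_floor_add_one σ
  have hkm : 2 * k ≤ m := by
    have : (2 : ℝ) * k ≤ m := by linarith
    exact_mod_cast this
  obtain ⟨S, S', hS, hS', hle⟩ := exists_softGain_le (wrongSet x yTrue) w hw (k := k) (by omega)
    (τ := σ - k) (by ring) (by linarith) (by linarith)
  set τ := σ - k with hτ
  have hτ0 : 0 ≤ τ := by linarith
  rcases Nat.eq_zero_or_pos k with hk0 | hk0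
  -- Fewer than one item is flipped in total. The entropy per unit of weight is not bounded by
  -- `log m` here but still by `B + 1`, which is why `FlipsCostly` has a clause for singletons.
  · rw [hk0, Finset.card_eq_zero] at hS
    have hk0' : (k : ℝ) = 0 := by exact_mod_cast hk0
    have hτσ : τ = σ := by rw [hτ, hk0', sub_zero]
    have hmB : Real.log m ≤ B := by
      refine le_trans (Real.log_le_log hm' ?_) hℓ.le
      rw [le_div_iff₀ hσ0]
      nlinarith
    have h1 := (hT S' (by omega) (by omega)).2 (by omega) hmB
    rw [hS, gain_empty, mul_zero, zero_add, hτσ] at hle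
    have h2 := mul_le_mul_of_nonneg_left h1 hσ0.le
    have h3 := mul_lt_mul_of_pos_left hℓ hσ0
    linarith
  · have hk' : (1 : ℝ) ≤ k := by exact_mod_cast hk0
    have h1 : gain S (wrongSet x yTrue) ≤ -(k * (2 - Real.log 2 + Real.log (m / σ))) := by
      have h2 := (hT S (by omega) (by omega)).1
      rw [hS] at h2
      have h3 : Real.log (m / k) ≤ Real.log (m / σ) + Real.log 2 := by
        rw [← Real.log_mul (by positivity) two_ne_zero]
        refine Real.log_le_log (by positivity) ?_
        rw [div_mul_eq_mul_div, div_le_div_iff₀ (by linarith) hσ0]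
        nlinarith
      have h4 : Real.log (m / σ) ≤ Real.log (m / k) :=
        Real.log_le_log (by positivity) (by gcongr)
      have h5 := h2 (by linarith)
      have h6 : (k : ℝ) * (2 - Real.log 2 + Real.log (m / σ)) ≤ k * (2 + Real.log (m / k)) :=
        mul_le_mul_of_nonneg_left (by linarith [Real.log_pos one_lt_two]) (by linarith)
      linarith
    have h1' : τ * gain S' (wrongSet x yTrue)
        ≤ τ * -((k + 1) * (2 - Real.log 2 + Real.log (m / σ))) := by
      rcases hτ0.eq_or_lt with h0 | h0
      · rw [← h0, zero_mul, zero_mul]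
      · refine mul_le_mul_of_nonneg_left ?_ hτ0
        have h2k : 2 * (k + 1) ≤ m + 1 := by
          have : (2 : ℝ) * k < m := by linarith
          have : 2 * k < m := by exact_mod_cast this
          omega
        have h2 := (hT S' (by omega) (by omega)).1
        rw [hS', Nat.cast_add, Nat.cast_one] at h2
        have h3 : Real.log (m / (k + 1)) ≤ Real.log (m / σ) :=
          Real.log_le_log (by positivity) (by gcongr)
        have h4 : Real.log (m / σ) - Real.log 2 ≤ Real.log (m / (k + 1)) := by
          rw [← Real.log_div (by positivity) two_ne_zero]
          refine Real.log_le_log (by positivity) ?_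
          rw [div_div, div_le_div_iff_of_pos_left hm' (by positivity) (by positivity)]
          linarith
        have h5 := h2 (by linarith [Real.log_pos one_lt_two])
        have h6 : ((k : ℝ) + 1) * (2 - Real.log 2 + Real.log (m / σ))
            ≤ (k + 1) * (2 + Real.log (m / (k + 1))) :=
          mul_le_mul_of_nonneg_left (by linarith) (by linarith)
        linarith
    have h2 := mul_le_mul_of_nonneg_left h1 (by linarith : 0 ≤ 1 - τ)
    have h3 : (1 - τ) * -(k * (2 - Real.log 2 + Real.log (m / σ)))
        + τ * -((k + 1) * (2 - Real.log 2 + Real.log (m / σ)))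
        = -(σ * (2 - Real.log 2 + Real.log (m / σ))) := by rw [hτ]; ring
    have h4 : 0 < σ * (1 - Real.log 2) := mul_pos hσ0 (by linarith)
    linarith

/-- If every worker is always right or always wrong, the maximizers recover the clusters exactly. -/
lemma clusteringError_le_zero_of_unanimous {n m : ℕ} (hn : 2 ≤ n) (hm : 0 < m)
    {x : Fin n → Fin m → Bool} {p : Fin n → ℝ} {y : Fin m → ℝ} (h : IsGlobalMaximizer x p y)
    {yTrue : Fin m → Bool}
    (hT : ∀ i, wrongSet x yTrue i = ∅ ∨ wrongSet x yTrue i = Finset.univ) :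
    clusteringError y yTrue ≤ 0 := by
  have hm' : (0 : ℝ) < m := by exact_mod_cast hm
  have hn' : (2 : ℝ) ≤ n := by exact_mod_cast hn
  obtain ⟨w, hw, ha, hce, hg⟩ := h.exists_softFlip hm yTrue
  refine hce.trans ?_
  by_contra! hlt
  have e : softGain w (wrongSet x yTrue) = -(n * (m * binEntropy ((∑ j, w j) / m))) := by
    have h1 : ∀ i, (m : ℝ) * (binEntropy ((wrongSet x yTrue i).card / m)
        - binEntropy (softWrong (wrongSet x yTrue i) w / m))
        = -(m * binEntropy ((∑ j, w j) / m)) := by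
      intro i
      rcases hT i with h | h
      · rw [h]; simp [softWrong]
      · have e1 : softWrong (Finset.univ : Finset (Fin m)) w = m - ∑ j, w j := by simp [softWrong]
        rw [h, e1, binEntropy_sub_div hm]
        simp [hm'.ne']
    rw [softGain, Finset.sum_congr rfl fun i _ => h1 i]
    simp
  have hpos : 0 < m * binEntropy ((∑ j, w j) / m) :=
    mul_pos hm' (Real.binEntropy_pos hlt (by linarith))
  rw [e] at hg
  nlinarith

section Law

variable {Ω : Type*} [MeasurableSpace Ω] {P : Measure Ω} [IsProbabilityMeasure P] {n m : ℕ}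
  {X : Fin n → Fin m → Ω → Bool} {pTrue : Fin n → ℝ} {yTrue : Fin m → Bool}

/-- A worker of ability `p` is right on all items, or wrong on all of them if `p < 1 / 2`, up to an
event of probability `m (1 - μᵢ)`. -/
lemma IsOneCoinModel.real_not_unanimous_le (h : IsOneCoinModel P X pTrue yTrue) (hn : 0 < n) :
    P.real {ω | ¬ ∀ i, wrongSet (fun i j => X i j ω) yTrue i = ∅ ∨
      wrongSet (fun i j => X i j ω) yTrue i = Finset.univ} ≤ m * (n * (1 - muBar pTrue)) := by
  set E : Fin n × Fin m → Set Ω := fun ij => if 1 / 2 ≤ pTrue ij.1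
    then {ω | X ij.1 ij.2 ω = yTrue ij.2}ᶜ else {ω | X ij.1 ij.2 ω = yTrue ij.2} with hE
  have hPE : ∀ ij, P.real (E ij) = 1 - effAbility (pTrue ij.1) := by
    intro ij
    have hmeas : MeasurableSet {ω | X ij.1 ij.2 ω = yTrue ij.2} :=
      h.measurable ij.1 ij.2 (MeasurableSet.singleton (yTrue ij.2))
    simp only [hE, effAbility]
    split_ifs
    · rw [probReal_compl_eq_one_sub hmeas, h.prob_correct]
    · rw [h.prob_correct]; ring
  have hsub : {ω | ¬ ∀ i, wrongSet (fun i j => X i j ω) yTrue i = ∅ ∨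
      wrongSet (fun i j => X i j ω) yTrue i = Finset.univ}
      ⊆ ⋃ ij ∈ (Finset.univ : Finset (Fin n × Fin m)), E ij := by
    intro ω hω
    by_contra hc
    simp only [Finset.mem_univ, Set.iUnion_true, Set.mem_iUnion, not_exists, Prod.forall] at hc
    refine hω fun i => ?_
    by_cases hi : 1 / 2 ≤ pTrue i
    · left
      refine Finset.filter_eq_empty_iff.2 fun j _ => ?_
      have := hc i j
      simp only [hE, if_pos hi] at this
      rwa [Set.mem_compl_iff] at this
    · right
      refine Finset.filter_true_of_mem fun j _ => ?_
      have := hc i j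
      simp only [hE, if_neg hi] at this
      exact this
  refine (measureReal_mono hsub (measure_ne_top _ _)).trans
    ((measureReal_biUnion_finset_le _ _).trans (le_of_eq ?_))
  have hn' : (n : ℝ) ≠ 0 := by exact_mod_cast hn.ne'
  rw [Finset.sum_congr rfl fun ij _ => hPE ij, Fintype.sum_prod_type, muBar]
  simp only [Finset.sum_const, Finset.card_univ, Fintype.card_fin, nsmul_eq_mul]
  rw [← Finset.mul_sum, Finset.sum_sub_distrib]
  simp only [Finset.sum_const, Finset.card_univ, Fintype.card_fin, nsmul_eq_mul, mul_one]
  field_simp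

lemma one_sub_le_real_of_compl_le {A B : Set Ω} {δ : ℝ} (hA : P.real {ω | ¬ ω ∈ A} ≤ δ)
    (h : A ⊆ B) : 1 - δ ≤ P.real B := by
  have h1 : (Set.univ : Set Ω) ⊆ {ω | ¬ ω ∈ A} ∪ B := fun ω _ => by
    by_cases hω : ω ∈ A
    · exact Or.inr (h hω)
    · exact Or.inl hω
  have h2 := (measureReal_mono h1 (measure_ne_top P _)).trans (measureReal_union_le _ _)
  rw [probReal_univ] at h2
  linarith

end Law

end DawidSkene

open DawidSkene in
theorem theorem3p1 :
    ∃ C' : ℝ, 0 < C' ∧ ∃ N : ℕ, ∀ n m : ℕ, N ≤ n → N ≤ m →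
      n ≤ m → (m : ℝ) ≤ Real.exp n →
      ∀ (pTrue : Fin n → ℝ) (yTrue : Fin m → Bool), (∀ i, pTrue i ∈ Set.Icc (0 : ℝ) 1) →
      12 * Real.log n / n ≤ DawidSkene.nuBar pTrue →
      ∀ (Ω : Type*) [MeasurableSpace Ω] (P : Measure Ω) [IsProbabilityMeasure P]
        (X : Fin n → Fin m → Ω → Bool), DawidSkene.IsOneCoinModel P X pTrue yTrue →
        1 - C' / m ≤ P.real {ω | ∀ (p : Fin n → ℝ) (y : Fin m → ℝ),
            DawidSkene.IsGlobalMaximizer (fun i j => X i j ω) p y →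
            DawidSkene.clusteringError y yTrue
              ≤ Real.exp (-(1 / 8) * n * DawidSkene.nuBar pTrue)}
        ∧ (DawidSkene.muBar pTrue < 1 →
          (1 / (n : ℝ)) * Real.log (4 / (1 - DawidSkene.muBar pTrue))
            < DawidSkene.nuBar pTrue →
          1 - C' / m ≤ P.real {ω | ∀ (p : Fin n → ℝ) (y : Fin m → ℝ),
            DawidSkene.IsGlobalMaximizer (fun i j => X i j ω) p y →
            DawidSkene.clusteringError y yTrue
              ≤ Real.exp (-(1 / 8) * n * max (DawidSkene.nuBar pTrue)
                  ((1 / 3) * DawidSkene.klBern (DawidSkene.muBar pTrue)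
                    (1 - DawidSkene.muBar pTrue)))}) := by
  obtain ⟨a₁, ha₁, ha₁80, C, N₀, hN₀, hmain⟩ := exists_real_not_flipsCostly_le
  obtain ⟨N₁, -, hrate₁⟩ := exists_flipRate_ge_nuBar C
  obtain ⟨N₂, hrate₂⟩ := exists_flipRate_ge_klBern C
  refine ⟨3, by norm_num, max N₀ (max N₁ N₂), ?_⟩
  intro n m hNn _ hnm _ pTrue yTrue hp hν Ω _ P _ X hX
  have hn₀ : N₀ ≤ n := (le_max_left _ _).trans hNn
  have hn₁ : N₁ ≤ n := ((le_max_left _ _).trans (le_max_right _ _)).trans hNn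
  have hn₂ : N₂ ≤ n := ((le_max_right _ _).trans (le_max_right _ _)).trans hNn
  have hn : 0 < n := by omega
  have hm : 0 < m := by omega
  have hm' : (0 : ℝ) < m := by exact_mod_cast hm
  have hnm' : (n : ℝ) ≤ m := by exact_mod_cast hnm
  have ha₁1 : a₁ ≤ Real.exp (-1) := ha₁80.trans (Real.exp_le_exp.2 (by norm_num))
  have hgood : ∀ B : ℝ, (∀ k : ℕ, 0 < k → (k : ℝ) ≤ a₁ * m → Real.log (m / k) ≤ B + Real.log 2 →
      3 * Real.log (m / k) + C ≤ flipRate pTrue m k) →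
      (Real.log m ≤ B → 2 * Real.log m + B / 2 + C ≤ flipRate pTrue m 1) →
      1 - 3 / m ≤ P.real {ω | ∀ (p : Fin n → ℝ) (y : Fin m → ℝ),
        IsGlobalMaximizer (fun i j => X i j ω) p y →
        clusteringError y yTrue ≤ Real.exp (-B)} := fun B h1 h2 =>
    one_sub_le_real_of_compl_le
      (A := {ω | FlipsCostly B (wrongSet (fun i j => X i j ω) yTrue)})
      (hmain n m hn₀ hnm pTrue yTrue hp hν B h1 h2 Ω P X hX)
      fun ω hω p y h => clusteringError_le_of_flipsCostly hm h hω
  have hclaim₁ : 1 - 3 / (m : ℝ) ≤ P.real {ω | ∀ (p : Fin n → ℝ) (y : Fin m → ℝ),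
      IsGlobalMaximizer (fun i j => X i j ω) p y →
      clusteringError y yTrue ≤ Real.exp (-(1 / 8) * n * nuBar pTrue)} := by
    obtain ⟨h1, h2⟩ := hrate₁ n m hn₁ hnm pTrue hp hν _ rfl
    rw [show -(1 / 8) * n * nuBar pTrue = -(n * nuBar pTrue / 8) by ring]
    exact hgood _ (fun k hk hka => h1 k hk (hka.trans (by gcongr))) h2
  refine ⟨hclaim₁, fun hμ _ => ?_⟩
  rcases le_or_gt (klBern (muBar pTrue) (1 - muBar pTrue)) (3 * nuBar pTrue) with hD | hD
  · rw [max_eq_left (by linarith)]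
    exact hclaim₁
  rw [max_eq_right (by linarith)]
  rcases le_or_gt 1 ((1 - muBar pTrue) * (m : ℝ) ^ 3) with hδ | hδ
  · obtain ⟨h1, h2⟩ := hrate₂ n m hn₂ hnm pTrue hp hμ hD hδ _ rfl
    rw [show -(1 / 8) * (n : ℝ) * (1 / 3 * klBern (muBar pTrue) (1 - muBar pTrue))
      = -(n * klBern (muBar pTrue) (1 - muBar pTrue) / 24) by ring]
    exact hgood _ (fun k hk hka => h1 k hk (hka.trans (by gcongr))) h2
  -- `μ̄` is so close to `1` that no exponential rate is needed.
  · refine one_sub_le_real_of_compl_le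
      (A := {ω | ∀ i, wrongSet (fun i j => X i j ω) yTrue i = ∅ ∨
        wrongSet (fun i j => X i j ω) yTrue i = Finset.univ})
      ((hX.real_not_unanimous_le hn).trans ?_) fun ω hω p y h =>
        (clusteringError_le_zero_of_unanimous (by omega) hm h hω).trans (Real.exp_pos _).le
    rw [le_div_iff₀ hm']
    have h1 : 0 ≤ 1 - muBar pTrue := by linarith
    calc (m : ℝ) * (n * (1 - muBar pTrue)) * m ≤ m * (m * (1 - muBar pTrue)) * m := by gcongr
      _ = (1 - muBar pTrue) * (m : ℝ) ^ 3 := by ring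
      _ ≤ 3 := by linarith
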